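/- Let $V=\mathbb{R}^{2n+2}$ with its Euclidean inner product, and let $(P_0,\dots,P_m)$ be a symmetric Clifford system on $V$: symmetric endomorphisms with $P_iP_j+P_jP_i=2\delta_{ij}\,\mathrm{Id}$. Put $\mathcal{P}=\mathrm{span}\{P_0,\dots,P_m\}$, $m_1=m$, $m_2=n-m$, and assume that $m_2>0$ and $m_1\le m_2$. The FKM-foliation $\mathcal{F}_{\mathcal{P}}$ of the unit sphere $S(V)$ has as leaves the level sets of the restriction to $S(V)$ of $$F(x)=\langle x,x\rangle^2-2\sum_{i=0}^m\langle P_ix,x\rangle^2 ,$$ and $\mathrm{Aut}(\mathcal{F}_{\mathcal{P}})\subseteq O(V)$ is the group of orthogonal transformations that map leaves to leaves. Let $\mathrm{Cl}^*_{m+1}$ be the Clifford algebra of $\mathbb{R}^{m+1}$ with relations $E_iE_j+E_jE_i=2\delta_{ij}$, let $\mathrm{Pin}(m+1)$ be the group generated by the unit vectors in $\mathrm{Cl}^*_{m+1}$, and let $\mathrm{Spin}(m+1)$ be its subgroup of even elements. Let $\chi_{\mathcal{P}}:\mathrm{Cl}^*_{m+1}\to\mathrm{End}(V)$, $E_i\mapsto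 P_i$. Write $\mathrm{Spin}(\mathcal{P})=\chi_{\mathcal{P}}(\mathrm{Spin}(m+1))$ and $U^+(\mathcal{P})=\{U\in O(V): PU=UP\text{ for all }P\in\mathcal{P}\}$. Let $\mathbb{K}=\mathbb{R}$ if $m\equiv 0,1,7$, $\mathbb{K}=\mathbb{C}$ if $m\equiv 2,6$, and $\mathbb{K}=\mathbb{H}$ if $m\equiv 3,4,5 \pmod 8$. There are irreducible real representations $\chi$ of $\mathrm{Cl}^*_{m+1}$ on some $\mathfrak{d}=\mathbb{K}^r$ by $\mathbb{K}$-matrices (acting on columns from the left, so commuting with right multiplication by $\mathbb{K}$); let $\chi$ be any of them. If $m\equiv 0\pmod 4$, put $\mathfrak{d}_+=\mathfrak{d}$, and let $\mathfrak{d}_-$ be the same space with the representation $\chi\circ\alpha$, where $\alpha$ is the automorphism of $\mathrm{Cl}^*_{m+1}$ extending $-\mathrm{Id}$ on $\mathbb{R}^{m+1}$. If $m\not\equiv 0\pmod 4$, then $V\cong\bigoplus_{i=1}^k\mathfrak{d}$ as a $\mathrm{Cl}^*_{m+1}$-module for some $k$; if $m\equiv 0\pmod 4$, then $V\cong\bigl(\bigoplus_{i=1}^{k_+}\mathfrak{d}_+\bigr)\oplus\bigl(\bigoplus_{i=1}^{k_-}\mathfrak{d}_-\bigr)$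 for some $k_+,k_-\ge 0$. For these numbers the following holds. 1. If $m$ is odd, the representation of $\mathrm{Aut}(\mathcal{F}_{\mathcal{P}})$ on $V$ is equivalent to the action of $\mathrm{Pin}(m+1)\cdot O(k)$ on $\mathfrak{d}\otimes_{\mathbb{R}}\mathbb{R}^k$ if $m\equiv 1,7\pmod 8$, or of $\mathrm{Pin}(m+1)\cdot \mathrm{Sp}(k)$ on $\mathfrak{d}\otimes_{\mathbb{H}}\mathbb{H}^k$ if $m\equiv 3,5\pmod 8$. 2. If $m\equiv 2\pmod 4$, then $\mathrm{Spin}(\mathcal{P})\cdot U^+(\mathcal{P})$ is a subgroup of $\mathrm{Aut}(\mathcal{F}_{\mathcal{P}})$, and its representation on $V$ is equivalent to the action of $\mathrm{Spin}(m+1)\cdot U(k)$ on $\mathfrak{d}\otimes_{\mathbb{C}}\mathbb{C}^k$. 3. If $m\equiv 0\pmod 4$, then $\mathrm{Spin}(\mathcal{P})\cdot U^+(\mathcal{P})$ is a subgroup of $\mathrm{Aut}(\mathcal{F}_{\mathcal{P}})$, and its representation on $V$ is equivalent to the action of $\mathrm{Spin}(m+1)\cdot(O(k_+)\times O(k_-))$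 if $m\equiv 0\pmod 8$, or of $\mathrm{Spin}(m+1)\cdot(\mathrm{Sp}(k_+)\times \mathrm{Sp}(k_-))$ if $m\equiv 4\pmod 8$, on $(\mathfrak{d}_+\otimes_{\mathbb{K}}\mathbb{K}^{k_+})\oplus(\mathfrak{d}_-\otimes_{\mathbb{K}}\mathbb{K}^{k_-})$. Here $\mathrm{Pin}(m+1)$ and $\mathrm{Spin}(m+1)$ act on the left factors through $\chi$ (respectively $\chi$ and $\chi\circ\alpha$), and the classical groups act on the right factors by their standard representations. For $\mathbb{K}=\mathbb{H}$ the tensor product of right $\mathbb{H}$-spaces is formed with $vq\otimes w=v\otimes w\bar q$. The dot denotes a direct product modulo a finite subgroup, and "equivalent" means that there are a group isomorphism and a real linear isomorphism from $V$ onto the tensor product space that intertwine the two actions. The group isomorphism can be chosen so that $\chi_{\mathcal{P}}(f)$ corresponds to $f$ for every $f$ in $\mathrm{Pin}(m+1)$ (respectively $\mathrm{Spin}(m+1)$), and so that $U^+(\mathcal{P})$ corresponds to the image of the classical group. -/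

import Mathlib

open scoped TensorProduct Quaternion

noncomputable section

namespace FKM

/-! ### Clifford algebra, pin and spin groups of Euclidean space -/

/-- The standard positive definite quadratic form `∑ i, v i ^ 2` on `ℝ^(m+1)`. -/
abbrev stdForm (m : ℕ) : QuadraticForm ℝ (Fin (m + 1) → ℝ) :=
  QuadraticMap.weightedSumSquares ℝ (fun _ : Fin (m + 1) => (1 : ℝ))

/-- The Clifford algebra `Cl*_{m+1}` of the positive definite form: `v * v = |v|^2`. -/
abbrev Cl (m : ℕ) : Type := CliffordAlgebra (stdForm m)

/-- `Pin(m+1)`: the group generated by the unit vectors inside the units of `Cl*_{m+1}`.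
(Mathlib's `pinGroup` imposes `star x * x = 1` with `star v = -v` on vectors, which for a positive
definite form excludes the unit vectors.) -/
def Pin (m : ℕ) : Subgroup (Cl m)ˣ :=
  Subgroup.closure {u | ∃ v : Fin (m + 1) → ℝ,
    stdForm m v = 1 ∧ (u : Cl m) = CliffordAlgebra.ι (stdForm m) v}

/-- `Spin(m+1)`: the elements of `Pin(m+1)` that lie in the even part of the Clifford algebra. -/
def Spin (m : ℕ) : Subgroup (Cl m)ˣ :=
  Pin m ⊓ (CliffordAlgebra.even (stdForm m)).toSubmonoid.units

/-! ### Clifford systems and FKM-foliations -/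

/-- The Euclidean space `V = ℝ^(2n+2)`. -/
abbrev V (n : ℕ) : Type := EuclideanSpace ℝ (Fin (2 * n + 2))

/-- The orthogonal group `O(V)`. -/
abbrev OV (n : ℕ) : Type := V n ≃ₗᵢ[ℝ] V n

/-- A symmetric Clifford system `(P_0, …, P_m)` on `V = ℝ^(2n+2)`. -/
structure CliffordSystem (m n : ℕ) where
  /-- The operators `P_0, …, P_m`. -/
  P : Fin (m + 1) → Module.End ℝ (V n)
  symm : ∀ i, (P i).IsSymmetric
  rel : ∀ i j, P i * P j + P j * P i = if i = j then 2 else 0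

namespace CliffordSystem

variable {m n : ℕ} (C : CliffordSystem m n)

/-- The linear map `v ↦ ∑ i, v i • P i`. -/
def gen : (Fin (m + 1) → ℝ) →ₗ[ℝ] Module.End ℝ (V n) := Fintype.linearCombination ℝ C.P

theorem gen_mul_self (v : Fin (m + 1) → ℝ) :
    C.gen v * C.gen v = algebraMap ℝ (Module.End ℝ (V n)) (stdForm m v) := by
  have key : (2 : ℝ) • (C.gen v * C.gen v) =
      (2 : ℝ) • algebraMap ℝ (Module.End ℝ (V n)) (stdForm m v) := by
    have h1 : C.gen v * C.gen v = ∑ i, ∑ j, (v i * v j) • (C.P i * C.P j) := by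
      simp only [gen, Fintype.linearCombination_apply, Finset.sum_mul, Finset.mul_sum,
        smul_mul_smul_comm]
      rw [Finset.sum_comm]
    have h2 : C.gen v * C.gen v = ∑ i, ∑ j, (v i * v j) • (C.P j * C.P i) := by
      rw [h1, Finset.sum_comm]
      simp only [mul_comm]
    rw [two_smul]
    conv_lhs => rw [h1]
    conv_lhs => arg 2; rw [← h1, h2]
    simp only [← Finset.sum_add_distrib, ← smul_add, C.rel]
    simp [QuadraticMap.weightedSumSquares_apply, Algebra.algebraMap_eq_smul_one,
      Finset.smul_sum, smul_smul]
    refine Finset.sum_congr rfl fun i _ => ?_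
    rw [mul_comm (2 : ℝ), mul_smul (v i * v i) (2 : ℝ), two_smul, one_add_one_eq_two]
  exact smul_right_injective _ (two_ne_zero) key

/-- The representation `χ : Cl*_{m+1} → End V` with `χ(E_i) = P_i`. -/
def rep : Cl m →ₐ[ℝ] Module.End ℝ (V n) :=
  CliffordAlgebra.lift (stdForm m) ⟨C.gen, C.gen_mul_self⟩

/-- The vector space `𝒫 = span {P_0, …, P_m}`. -/
def space : Submodule ℝ (Module.End ℝ (V n)) := Submodule.span ℝ (Set.range C.P)

/-- The Cartan–Münzner polynomial `F(x) = ⟨x,x⟩² - 2 ∑ i, ⟨P_i x, x⟩²`. -/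
def cartanMunzner (x : V n) : ℝ :=
  (inner ℝ x x) ^ 2 - 2 * ∑ i, (inner ℝ (C.P i x) x) ^ 2

/-- The leaves of the FKM-foliation: the (nonempty) level sets of `F` on the unit sphere. -/
def leaves : Set (Set (V n)) :=
  {L | L.Nonempty ∧ ∃ c : ℝ, L = {x | x ∈ Metric.sphere (0 : V n) 1 ∧ C.cartanMunzner x = c}}

/-- The group `Aut(F_𝒫)` of the orthogonal transformations that map leaves to leaves. -/
def aut : Subgroup (OV n) where
  carrier := {A | ∀ L ∈ C.leaves, A '' L ∈ C.leaves ∧ (A⁻¹ : OV n) '' L ∈ C.leaves}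
  one_mem' := by
    intro L hL
    simpa using hL
  mul_mem' := by
    intro A B hA hB L hL
    refine ⟨?_, ?_⟩
    · have := (hA _ (hB L hL).1).1
      rwa [← Set.image_comp, ← LinearIsometryEquiv.coe_mul] at this
    · have := (hB _ (hA L hL).2).2
      rwa [← Set.image_comp, ← LinearIsometryEquiv.coe_mul, ← mul_inv_rev] at this
  inv_mem' := by
    intro A hA L hL
    exact ⟨(hA L hL).2, by simpa using (hA L hL).1⟩

/-- The image in `O(V)` of a group of units of the Clifford algebra. -/
def image (L : Subgroup (Cl m)ˣ) : Subgroup (OV n) where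
  carrier := {A | ∃ f ∈ L, ∀ x, A x = C.rep (f : Cl m) x}
  one_mem' := ⟨1, L.one_mem, by simp⟩
  mul_mem' := by
    rintro A B ⟨f, hf, hA⟩ ⟨g, hg, hB⟩
    exact ⟨f * g, L.mul_mem hf hg, fun x => by simp [hA, hB]⟩
  inv_mem' := by
    rintro A ⟨f, hf, hA⟩
    refine ⟨f⁻¹, L.inv_mem hf, fun x => A.injective ?_⟩
    rw [hA (C.rep _ x), ← Module.End.mul_apply, ← map_mul, Units.mul_inv, map_one]
    exact A.apply_symm_apply x

/-- `Spin(𝒫) ⊆ O(V)`. -/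
def spin : Subgroup (OV n) := C.image (Spin m)

/-- `U⁺(𝒫)`: the orthogonal transformations that commute with every element of `𝒫`. -/
def uPlus : Subgroup (OV n) where
  carrier := {U | ∀ Q ∈ C.space, ∀ x, Q (U x) = U (Q x)}
  one_mem' := by simp
  mul_mem' := by
    intro A B hA hB Q hQ x
    simp [hA Q hQ, hB Q hQ]
  inv_mem' := by
    intro A hA Q hQ x
    apply A.injective
    change A (Q (A.symm x)) = A (A.symm (Q x))
    rw [← hA Q hQ, A.apply_symm_apply, A.apply_symm_apply]

/-- `Spin(𝒫) · U⁺(𝒫)`. -/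
def spinUPlus : Subgroup (OV n) := C.spin ⊔ C.uPlus

end CliffordSystem

/-! ### Irreducible Clifford modules on `𝕂^r` and multiplicities -/

section Modules

variable {𝕂 : Type} [Ring 𝕂] [Algebra ℝ 𝕂]

/-- The real linear action of a matrix over `𝕂` on columns, by left multiplication; it commutes
with the right multiplication by scalars of `𝕂`. -/
def colAct {r : ℕ} (M : Matrix (Fin r) (Fin r) 𝕂) : (Fin r → 𝕂) →ₗ[ℝ] (Fin r → 𝕂) where
  toFun v := M.mulVec v
  map_add' v w := M.mulVec_add v w
  map_smul' c v := M.mulVec_smul c v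

/-- The real representation of `Cl*_{m+1}` on the right `𝕂`-space `𝕂^r` given by a homomorphism
into `𝕂(r)` is irreducible. -/
def IsIrreducibleRep {m r : ℕ} (χ : Cl m →ₐ[ℝ] Matrix (Fin r) (Fin r) 𝕂) : Prop :=
  Nontrivial (Fin r → 𝕂) ∧ ∀ W : Submodule ℝ (Fin r → 𝕂),
    (∀ a : Cl m, ∀ w ∈ W, colAct (χ a) w ∈ W) → W = ⊥ ∨ W = ⊤

/-- `χ₋ = χ₊ ∘ α`, where `α` is the automorphism of the Clifford algebra with `α(v) = -v`. -/
def twist {m r : ℕ} (χ : Cl m →ₐ[ℝ] Matrix (Fin r) (Fin r) 𝕂) :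
    Cl m →ₐ[ℝ] Matrix (Fin r) (Fin r) 𝕂 :=
  χ.comp CliffordAlgebra.involute

/-- As a `Cl*_{m+1}`-module, `V` is isomorphic to the sum of `k` copies of `χ`. -/
def IsSumOf {m n r : ℕ} (C : CliffordSystem m n) (χ : Cl m →ₐ[ℝ] Matrix (Fin r) (Fin r) 𝕂)
    (k : ℕ) : Prop :=
  ∃ S : V n ≃ₗ[ℝ] (Fin k → Fin r → 𝕂),
    ∀ (a : Cl m) (x : V n) (i : Fin k), S (C.rep a x) i = colAct (χ a) (S x i)

/-- As a `Cl*_{m+1}`-module, `V` is isomorphic to the sum of `k₁` copies of `χ₁` and `k₂` copies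
of `χ₂`. -/
def IsSumOf₂ {m n r : ℕ} (C : CliffordSystem m n) (χ₁ χ₂ : Cl m →ₐ[ℝ] Matrix (Fin r) (Fin r) 𝕂)
    (k₁ k₂ : ℕ) : Prop :=
  ∃ S : V n ≃ₗ[ℝ] (Fin k₁ → Fin r → 𝕂) × (Fin k₂ → Fin r → 𝕂),
    ∀ (a : Cl m) (x : V n), (∀ i, (S (C.rep a x)).1 i = colAct (χ₁ a) ((S x).1 i)) ∧
      (∀ i, (S (C.rep a x)).2 i = colAct (χ₂ a) ((S x).2 i))

end Modules

/-! ### The tensor products `𝕂^r ⊗_𝕂 𝕂^k` -/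

/-- `M ⊗ U` on `𝕂^r ⊗_𝕂 𝕂^k`, for commutative `𝕂` (`ℝ` or `ℂ`), as a real linear map. -/
def tensorAct {𝕂 : Type} [CommRing 𝕂] [Algebra ℝ 𝕂] {r k : ℕ}
    (M : Matrix (Fin r) (Fin r) 𝕂) (U : Matrix (Fin k) (Fin k) 𝕂) :
    ((Fin r → 𝕂) ⊗[𝕂] (Fin k → 𝕂)) →ₗ[ℝ] ((Fin r → 𝕂) ⊗[𝕂] (Fin k → 𝕂)) :=
  (TensorProduct.map M.mulVecLin U.mulVecLin).restrictScalars ℝ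

/-- The relations `(v q) ⊗ w = v ⊗ (w q̄)` defining the tensor product over `ℍ` of two right
quaternionic vector spaces (the second one is made a left space by `q · w = w q̄`). -/
def quatRel (r k : ℕ) : Submodule ℝ ((Fin r → ℍ[ℝ]) ⊗[ℝ] (Fin k → ℍ[ℝ])) :=
  Submodule.span ℝ {t | ∃ (v : Fin r → ℍ[ℝ]) (w : Fin k → ℍ[ℝ]) (q : ℍ[ℝ]),
    t = (fun i => v i * q) ⊗ₜ[ℝ] w - v ⊗ₜ[ℝ] (fun j => w j * star q)}

/-- The real vector space `ℍ^r ⊗_ℍ ℍ^k`. -/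
abbrev QuatTensor (r k : ℕ) : Type :=
  ((Fin r → ℍ[ℝ]) ⊗[ℝ] (Fin k → ℍ[ℝ])) ⧸ quatRel r k

theorem colAct_mul_right {r : ℕ} (M : Matrix (Fin r) (Fin r) ℍ[ℝ]) (v : Fin r → ℍ[ℝ])
    (q : ℍ[ℝ]) : colAct M (fun i => v i * q) = fun i => colAct M v i * q := by
  funext i
  simp [colAct, Matrix.mulVec, dotProduct, Finset.sum_mul, mul_assoc]

theorem quatRel_le {r k : ℕ} (M : Matrix (Fin r) (Fin r) ℍ[ℝ]) (U : Matrix (Fin k) (Fin k) ℍ[ℝ]) :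
    quatRel r k ≤ (quatRel r k).comap (TensorProduct.map (colAct M) (colAct U)) := by
  refine Submodule.span_le.2 ?_
  rintro _ ⟨v, w, q, rfl⟩
  refine Submodule.subset_span ⟨colAct M v, colAct U w, q, ?_⟩
  rw [map_sub, TensorProduct.map_tmul, TensorProduct.map_tmul, colAct_mul_right, colAct_mul_right]

/-- `M ⊗ U` on `ℍ^r ⊗_ℍ ℍ^k`. -/
def quatTensorAct {r k : ℕ} (M : Matrix (Fin r) (Fin r) ℍ[ℝ]) (U : Matrix (Fin k) (Fin k) ℍ[ℝ]) :
    QuatTensor r k →ₗ[ℝ] QuatTensor r k :=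
  (quatRel r k).mapQ (quatRel r k) (TensorProduct.map (colAct M) (colAct U)) (quatRel_le M U)

/-- The compact symplectic group `Sp(k)`: quaternionic `k × k` matrices with `A* A = A A* = 1`. -/
abbrev Sp (k : ℕ) : Submonoid (Matrix (Fin k) (Fin k) ℍ[ℝ]) := unitary _

/-! ### Equivalence with a tensor product representation -/

/-- The representation on `V` of the group `H ⊆ O(V)` is equivalent to the action of `L · B` on
`X`, where `L` is `Pin(m+1)` or `Spin(m+1)`, `B` is a group, `L · B` is the direct product modulo
a finite subgroup, and `(f, b)` acts on `X` by `act f b`. The group isomorphism between `L · B`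
and `H` comes from the homomorphism `Φ : L × B → O(V)`; it is `χ` on `L` and takes `B` onto
`U⁺(𝒫)`. -/
def IsEquivalentToAction {m n : ℕ} (C : CliffordSystem m n) (H : Subgroup (OV n))
    (L : Subgroup (Cl m)ˣ) (B : Type) [Group B] (X : Type) [AddCommGroup X] [Module ℝ X]
    (act : Cl m → B → (X →ₗ[ℝ] X)) : Prop :=
  ∃ Φ : L × B →* OV n,
    Φ.range = H ∧
    (Φ.ker : Set (L × B)).Finite ∧
    (∀ (f : L) (x : V n), Φ (f, 1) x = C.rep ((f : (Cl m)ˣ) : Cl m) x) ∧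
    (Φ.comp (MonoidHom.inr L B)).range = C.uPlus ∧
    ∃ T : V n ≃ₗ[ℝ] X, ∀ (f : L) (b : B) (x : V n),
      T (Φ (f, b) x) = act ((f : (Cl m)ˣ) : Cl m) b (T x)

end FKM

end

open FKM

/-!
The stabiliser of the span of the `P_i` is the product of the image of `Pin(m+1)` and `U⁺(𝒫)`. The
inclusion into `Aut(ℱ_𝒫)` is clear, since conjugation by a unit vector of `𝒫` is, up to sign, a
reflection of `𝒫`. For the converse in the case of odd `m`, note that an automorphism either
preserves or exchanges the two focal submanifolds: `F` takes the values `-cos t`, `0 ≤ t ≤ π`, along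
a path joining them, and an injective continuous function on an interval is monotone. They are not
exchanged. If they were, conjugation would give a second Clifford system all of whose elements
anticommute with those of the first, so that for `n = 2m` a product `P_i P_j` would be a complex
structure on an eigenspace of odd dimension `n + 1`, while for `2m < n` a dimension count yields a
common point of the submanifolds `M_+` of both systems. An automorphism that preserves `M_- = ⋃
E_+(P)` permutes the eigenspaces `E_+(P)`, again by a dimension count, so it normalises `𝒫`; and
every isometry of `𝒫` comes from `Pin(m+1)` by the Cartan–Dieudonné theorem.

The representation on `V` is analysed by averaging over the monomials in the `E_i`. The trace of the
average of conjugation computes the dimension of the commutant of an irreducible representation,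
which therefore is a division algebra isomorphic to `𝕂`, and the averages of rank one maps provide
intertwiners between any two irreducible representations of the same type.
-/

noncomputable section

namespace FKM

/-! ### Monomials in the Clifford algebra -/

section Monomials

variable {m : ℕ}

theorem stdForm_apply (v : Fin (m + 1) → ℝ) : stdForm m v = ∑ i, v i ^ 2 := by
  simp [QuadraticMap.weightedSumSquares_apply, pow_two]

theorem stdForm_single (i : Fin (m + 1)) : stdForm m (Pi.single i 1) = 1 := by
  rw [stdForm_apply, Finset.sum_eq_single i] <;> simp +contextual

theorem polar_stdForm (v w : Fin (m + 1) → ℝ) :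
    QuadraticMap.polar (stdForm m) v w = 2 * ∑ i, v i * w i := by
  simp only [QuadraticMap.polar, stdForm_apply, Finset.mul_sum, ← Finset.sum_sub_distrib]
  exact Finset.sum_congr rfl fun i _ => by rw [Pi.add_apply]; ring

/-- The standard generator `E_i` of `Cl*_{m+1}`. -/
def stdGen (i : Fin (m + 1)) : Cl m := CliffordAlgebra.ι (stdForm m) (Pi.single i 1)

@[simp] theorem stdGen_mul_self (i : Fin (m + 1)) : stdGen i * stdGen i = 1 := by
  rw [stdGen, CliffordAlgebra.ι_sq_scalar, stdForm_single, map_one]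

@[simp] theorem stdGen_mul_cancel_left (i : Fin (m + 1)) (a : Cl m) :
    stdGen i * (stdGen i * a) = a := by
  rw [← mul_assoc, stdGen_mul_self, one_mul]

theorem stdGen_anticomm {i j : Fin (m + 1)} (h : i ≠ j) :
    stdGen i * stdGen j = -(stdGen j * stdGen i) := by
  rw [eq_neg_iff_add_eq_zero, stdGen, stdGen, CliffordAlgebra.ι_mul_ι_add_swap, polar_stdForm]
  simp [Pi.single_apply, h.symm]

theorem ι_eq_sum (v : Fin (m + 1) → ℝ) :
    CliffordAlgebra.ι (stdForm m) v = ∑ i, v i • stdGen i := by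
  conv_lhs => rw [pi_eq_sum_univ' v]
  simp only [map_sum, map_smul, stdGen]

theorem adjoin_range_stdGen : Algebra.adjoin ℝ (Set.range (stdGen (m := m))) = ⊤ := by
  rw [eq_top_iff, ← CliffordAlgebra.adjoin_range_ι]
  refine Algebra.adjoin_le ?_
  rintro _ ⟨v, rfl⟩
  rw [ι_eq_sum]
  exact sum_mem fun i _ => Subalgebra.smul_mem _ (Algebra.subset_adjoin (Set.mem_range_self i)) _

@[simp] theorem reverse_stdGen (i : Fin (m + 1)) :
    CliffordAlgebra.reverse (stdGen i) = stdGen i :=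
  CliffordAlgebra.reverse_ι _

@[simp] theorem involute_stdGen (i : Fin (m + 1)) :
    CliffordAlgebra.involute (stdGen i) = -stdGen i :=
  CliffordAlgebra.involute_ι _

theorem prod_stdGen_eq_or_eq_neg_of_perm {l l' : List (Fin (m + 1))} (h : l.Perm l')
    (hl : l.Nodup) :
    (l'.map stdGen).prod = (l.map stdGen).prod ∨ (l'.map stdGen).prod = -(l.map stdGen).prod := by
  induction h with
  | nil => simp
  | cons i _ ih => rcases ih (List.nodup_cons.1 hl).2 with h | h <;> simp [h]
  | swap i j l =>
    have hij : i ≠ j := by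
      rintro rfl
      simp at hl
    simp [← mul_assoc, stdGen_anticomm hij]
  | trans h₁ _ ih₁ ih₂ =>
    rcases ih₁ hl with h | h <;> rcases ih₂ (h₁.nodup_iff.1 hl) with h' | h' <;> simp [h', h]

/-- The monomial `E_{i_1} ⋯ E_{i_k}` for `I = {i_1 < ⋯ < i_k}`. Most arguments only need it up to
sign, so that the order of the factors rarely matters. -/
def monomial (I : Finset (Fin (m + 1))) : Cl m := ((I.sort (· ≤ ·)).map stdGen).prod

@[simp] theorem monomial_empty : monomial (∅ : Finset (Fin (m + 1))) = 1 := by simp [monomial]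

theorem monomial_insert {i : Fin (m + 1)} {I : Finset (Fin (m + 1))} (h : i ∉ I) :
    monomial (insert i I) = stdGen i * monomial I ∨
      monomial (insert i I) = -(stdGen i * monomial I) := by
  have hperm : (i :: I.sort (· ≤ ·)).Perm ((insert i I).sort (· ≤ ·)) :=
    (List.perm_ext_iff_of_nodup (by simp [h]) (by simp)).2 (by simp)
  simpa [monomial] using prod_stdGen_eq_or_eq_neg_of_perm hperm (by simp [h])

theorem stdGen_mul_monomial (i : Fin (m + 1)) (I : Finset (Fin (m + 1))) :
    stdGen i * monomial I = monomial (symmDiff I {i}) ∨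
      stdGen i * monomial I = -monomial (symmDiff I {i}) := by
  by_cases h : i ∈ I
  · have hI : symmDiff I {i} = I.erase i := by
      ext j
      simp only [Finset.mem_symmDiff, Finset.mem_singleton, Finset.mem_erase]
      grind
    have h' := monomial_insert (Finset.notMem_erase i I)
    rw [Finset.insert_erase h] at h'
    rcases h' with h' | h' <;> simp [hI, h']
  · have hI : symmDiff I {i} = insert i I := by
      ext j
      simp only [Finset.mem_symmDiff, Finset.mem_singleton, Finset.mem_insert]
      grind
    rcases monomial_insert h with h' | h' <;> simp [hI, h']

theorem stdGen_mul_monomial_comm (i : Fin (m + 1)) (I : Finset (Fin (m + 1))) :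
    stdGen i * monomial I = (-1 : ℝ) ^ (I.erase i).card • (monomial I * stdGen i) := by
  induction I using Finset.induction_on with
  | empty => simp
  | insert j I hj ih =>
    suffices h : stdGen i * (stdGen j * monomial I) =
        (-1 : ℝ) ^ ((insert j I).erase i).card • (stdGen j * monomial I * stdGen i) by
      rcases monomial_insert hj with h' | h' <;> simp [h', h]
    by_cases hij : i = j
    · subst hij
      rw [Finset.erase_eq_of_notMem hj] at ih
      rw [Finset.erase_insert hj, mul_assoc, ← mul_smul_comm, ← ih]
    · rw [Finset.erase_insert_of_ne (Ne.symm hij), Finset.card_insert_of_notMem (by simp [hj]),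
        ← mul_assoc, stdGen_anticomm hij, neg_mul, mul_assoc, ih, pow_succ]
      simp [mul_assoc]

theorem exists_stdGen_mul_monomial_eq_neg {I : Finset (Fin (m + 1))} (hI : I ≠ ∅)
    (hvol : ¬(I = Finset.univ ∧ Even m)) :
    ∃ i, stdGen i * monomial I = -(monomial I * stdGen i) := by
  suffices h : ∃ i, Odd (I.erase i).card by
    obtain ⟨i, hi⟩ := h
    exact ⟨i, by rw [stdGen_mul_monomial_comm, hi.neg_one_pow, neg_one_smul]⟩
  rcases Nat.even_or_odd I.card with h | h
  · obtain ⟨i, hi⟩ := Finset.nonempty_iff_ne_empty.2 hI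
    exact ⟨i, by
      rw [Finset.card_erase_of_mem hi]
      exact Nat.Even.sub_odd (Finset.card_pos.2 ⟨i, hi⟩) h odd_one⟩
  · obtain ⟨i, hi⟩ : ∃ i, i ∉ I := by
      by_contra! hc
      obtain rfl := Finset.eq_univ_iff_forall.2 hc
      exact hvol ⟨rfl, by rw [Finset.card_univ, Fintype.card_fin] at h; grind⟩
    exact ⟨i, by rwa [Finset.erase_eq_of_notMem hi]⟩

theorem span_range_monomial : Submodule.span ℝ (Set.range (monomial (m := m))) = ⊤ := by
  set S := Submodule.span ℝ (Set.range (monomial (m := m)))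
  have hgen : ∀ i, S ≤ S.comap (LinearMap.mulLeft ℝ (stdGen i)) := by
    refine fun i => Submodule.span_le.2 ?_
    rintro _ ⟨I, rfl⟩
    have hmem : monomial (symmDiff I {i}) ∈ S := Submodule.subset_span ⟨_, rfl⟩
    rcases stdGen_mul_monomial i I with h | h <;> simp [h, hmem]
  rw [eq_top_iff]
  intro a _
  induction a using CliffordAlgebra.left_induction with
  | algebraMap c =>
    rw [Algebra.algebraMap_eq_smul_one, ← monomial_empty]
    exact Submodule.smul_mem _ _ (Submodule.subset_span ⟨_, rfl⟩)
  | add a b ha hb => exact Submodule.add_mem _ (ha trivial) (hb trivial)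
  | ι_mul a v ha =>
    rw [ι_eq_sum, Finset.sum_mul]
    refine Submodule.sum_mem _ fun i _ => ?_
    rw [smul_mul_assoc]
    exact Submodule.smul_mem _ _ (hgen i (ha trivial))

/-- The sign `(-1) ^ (k (k - 1) / 2)` of the square of a monomial with `k` factors. -/
def monomialSign (k : ℕ) : ℝ := (-1) ^ k.choose 2

theorem monomialSign_succ (k : ℕ) : monomialSign (k + 1) = (-1) ^ k * monomialSign k := by
  simp [monomialSign, Nat.choose_succ_succ, pow_add]

theorem monomialSign_mul_self (k : ℕ) : monomialSign k * monomialSign k = 1 := by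
  rw [monomialSign, ← mul_pow, neg_mul_neg, one_mul, one_pow]

theorem monomialSign_succ_of_even {m : ℕ} (hm : Even m) :
    monomialSign (m + 1) = if m % 4 = 0 then 1 else -1 := by
  obtain ⟨k, rfl⟩ := hm
  have hchoose : (k + k + 1).choose 2 = k * (k + k + 1) := by
    rw [Nat.choose_two_right, Nat.add_sub_cancel, ← two_mul, mul_comm, mul_assoc,
      Nat.mul_div_cancel_left _ two_pos]
  rw [monomialSign, hchoose, pow_mul', Odd.neg_one_pow ⟨k, by ring⟩]
  split_ifs with h
  · exact Even.neg_one_pow (Nat.even_iff.2 (by omega))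
  · exact Odd.neg_one_pow (Nat.odd_iff.2 (by omega))

theorem monomial_mul_self (I : Finset (Fin (m + 1))) :
    monomial I * monomial I = monomialSign I.card • (1 : Cl m) := by
  induction I using Finset.induction_on with
  | empty => simp [monomialSign]
  | insert j I hj ih =>
    have hsq : monomial (insert j I) * monomial (insert j I) =
        stdGen j * monomial I * (stdGen j * monomial I) := by
      rcases monomial_insert hj with h | h <;> simp [h]
    have hcomm := stdGen_mul_monomial_comm j I
    rw [Finset.erase_eq_of_notMem hj] at hcomm
    rw [hsq, Finset.card_insert_of_notMem hj, monomialSign_succ, mul_smul, ← ih]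
    nth_rewrite 1 [hcomm]
    rw [smul_mul_assoc, mul_assoc, stdGen_mul_cancel_left]

theorem reverse_monomial_mul_self (I : Finset (Fin (m + 1))) :
    CliffordAlgebra.reverse (monomial I) * monomial I = 1 := by
  induction I using Finset.induction_on with
  | empty => simp
  | insert j I hj ih =>
    rcases monomial_insert hj with h | h <;>
      simp [h, CliffordAlgebra.reverse.map_mul, mul_assoc, ih]

theorem reverse_monomial (I : Finset (Fin (m + 1))) :
    CliffordAlgebra.reverse (monomial I) = monomialSign I.card • monomial I := by
  calc CliffordAlgebra.reverse (monomial I)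
      = monomialSign I.card • (CliffordAlgebra.reverse (monomial I) * monomial I * monomial I) := by
        rw [mul_assoc, monomial_mul_self, mul_smul_one, smul_smul, monomialSign_mul_self, one_smul]
    _ = _ := by rw [reverse_monomial_mul_self, one_mul]

theorem involute_monomial (I : Finset (Fin (m + 1))) :
    CliffordAlgebra.involute (monomial I) = (-1 : ℝ) ^ I.card • monomial I := by
  induction I using Finset.induction_on with
  | empty => simp
  | insert j I hj ih =>
    rcases monomial_insert hj with h | h <;>
      simp [h, Finset.card_insert_of_notMem hj, ih, pow_succ]

theorem monomial_mul_stdGen (i : Fin (m + 1)) (I : Finset (Fin (m + 1))) :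
    monomial I * stdGen i = monomial (symmDiff I {i}) ∨
      monomial I * stdGen i = -monomial (symmDiff I {i}) := by
  have hcomm := stdGen_mul_monomial_comm i I
  rcases neg_one_pow_eq_or ℝ (I.erase i).card with hs | hs <;>
    rcases stdGen_mul_monomial i I with h | h <;>
    simp only [hs, h, one_smul, neg_smul, neg_inj] at hcomm <;>
    simp [hcomm, ← neg_eq_iff_eq_neg]

end Monomials

section Averaging

variable {m : ℕ} {Y : Type*} [AddCommGroup Y] [Module ℝ Y]

theorem sum_symmDiff_singleton {ι N : Type*} [Fintype ι] [DecidableEq ι] [AddCommMonoid N]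
    (i : ι) (f : Finset ι → N) : ∑ I : Finset ι, f (symmDiff I {i}) = ∑ I, f I :=
  Equiv.sum_comp (Function.Involutive.toPerm _ fun I => symmDiff_symmDiff_cancel_right {i} I) f

theorem sum_monomial_mul_stdGen (β : Cl m →ₗ[ℝ] Cl m →ₗ[ℝ] Y) (i : Fin (m + 1)) :
    ∑ I, β (stdGen i * CliffordAlgebra.reverse (monomial I)) (monomial I * stdGen i) =
      ∑ I, β (CliffordAlgebra.reverse (monomial I)) (monomial I) := by
  conv_rhs => rw [← sum_symmDiff_singleton i]
  refine Finset.sum_congr rfl fun I _ => ?_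
  rw [← reverse_stdGen i, ← CliffordAlgebra.reverse.map_mul, reverse_stdGen]
  rcases monomial_mul_stdGen i I with h | h <;> simp [h]

theorem sum_stdGen_mul_monomial (β : Cl m →ₗ[ℝ] Cl m →ₗ[ℝ] Y) (i : Fin (m + 1)) :
    ∑ I, β (CliffordAlgebra.reverse (monomial I) * stdGen i) (stdGen i * monomial I) =
      ∑ I, β (CliffordAlgebra.reverse (monomial I)) (monomial I) := by
  conv_rhs => rw [← sum_symmDiff_singleton i]
  refine Finset.sum_congr rfl fun I _ => ?_
  rw [← reverse_stdGen i, ← CliffordAlgebra.reverse.map_mul, reverse_stdGen]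
  rcases stdGen_mul_monomial i I with h | h <;> simp [h]

end Averaging

/-! ### The center of the Clifford algebra -/

section Center

variable {m : ℕ}

theorem commute_of_commute_stdGen {x : Cl m} (h : ∀ i, Commute (stdGen i) x) (a : Cl m) :
    Commute a x := by
  have hle : Algebra.adjoin ℝ (Set.range stdGen) ≤ Subalgebra.centralizer ℝ {x} := by
    refine Algebra.adjoin_le ?_
    rintro _ ⟨i, rfl⟩
    rw [SetLike.mem_coe, Subalgebra.mem_centralizer_iff]
    rintro _ rfl
    exact (h i).symm.eq
  have ha : a ∈ Subalgebra.centralizer ℝ {x} := hle (by simp [adjoin_range_stdGen])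
  exact (Subalgebra.mem_centralizer_iff ℝ |>.1 ha x rfl).symm

/-- The volume element `E_0 ⋯ E_m`. It is central exactly for even `m`, where it distinguishes
the irreducible representations if `m ≡ 0 (mod 4)` and acts as a complex structure if
`m ≡ 2 (mod 4)`. -/
def volumeElement (m : ℕ) : Cl m := monomial Finset.univ

theorem volumeElement_mul_self :
    volumeElement m * volumeElement m = monomialSign (m + 1) • (1 : Cl m) := by
  rw [volumeElement, monomial_mul_self, Finset.card_univ, Fintype.card_fin]

theorem stdGen_mul_volumeElement (i : Fin (m + 1)) :
    stdGen i * volumeElement m = (-1 : ℝ) ^ m • (volumeElement m * stdGen i) := by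
  rw [volumeElement, stdGen_mul_monomial_comm, Finset.card_erase_of_mem (Finset.mem_univ i),
    Finset.card_univ, Fintype.card_fin, Nat.add_sub_cancel]

theorem commute_volumeElement (hm : Even m) (a : Cl m) : Commute a (volumeElement m) :=
  commute_of_commute_stdGen
    (fun i => by rw [commute_iff_eq, stdGen_mul_volumeElement, hm.neg_one_pow, one_smul]) a

theorem involute_volumeElement (hm : Even m) :
    CliffordAlgebra.involute (volumeElement m) = -volumeElement m := by
  rw [volumeElement, involute_monomial, Finset.card_univ, Fintype.card_fin,
    hm.add_one.neg_one_pow, neg_one_smul]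

/-- The sum of the conjugates `e⁻¹ x e` of `x` by the monomials `e`: up to the factor `2 ^ (m + 1)`,
a projection onto the center. -/
def conjSum : Cl m →ₗ[ℝ] Cl m :=
  ∑ I : Finset (Fin (m + 1)), LinearMap.mulLeft ℝ (CliffordAlgebra.reverse (monomial I)) ∘ₗ
    LinearMap.mulRight ℝ (monomial I)

theorem conjSum_apply (x : Cl m) :
    conjSum x = ∑ I, CliffordAlgebra.reverse (monomial I) * (x * monomial I) := by
  simp [conjSum, LinearMap.sum_apply]

theorem conjSum_of_central {x : Cl m} (h : ∀ a, Commute a x) :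
    conjSum x = (2 : ℝ) ^ (m + 1) • x := by
  have hI : ∀ I, CliffordAlgebra.reverse (monomial I) * (x * monomial I) = x := fun I => by
    rw [← (h _).eq, ← mul_assoc, reverse_monomial_mul_self, one_mul]
  simp [conjSum_apply, hI, ← Nat.cast_smul_eq_nsmul ℝ]

theorem conjSum_monomial_eq_zero {J : Finset (Fin (m + 1))} (hJ : J ≠ ∅)
    (hvol : ¬(J = Finset.univ ∧ Even m)) : conjSum (monomial J) = 0 := by
  obtain ⟨i, hi⟩ := exists_stdGen_mul_monomial_eq_neg hJ hvol
  have hsum := sum_stdGen_mul_monomial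
    ((LinearMap.mul ℝ (Cl m)).compl₂ (LinearMap.mulLeft ℝ (monomial J))) i
  have hconj : stdGen i * (monomial J * (stdGen i)) = -monomial J := by
    rw [← mul_assoc, hi, neg_mul, mul_assoc, stdGen_mul_self, mul_one]
  have hterm : ∀ x y : Cl m, x * stdGen i * (monomial J * (stdGen i * y)) =
      -(x * (monomial J * y)) := fun x y => by
    calc _ = x * (stdGen i * (monomial J * stdGen i)) * y := by simp only [mul_assoc]
      _ = _ := by rw [hconj]; simp [mul_assoc]
  simp only [LinearMap.compl₂_apply, LinearMap.mul_apply', LinearMap.mulLeft_apply, hterm,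
    Finset.sum_neg_distrib, ← conjSum_apply] at hsum
  have htwo : (2 : ℝ) • conjSum (monomial J) = 0 := by
    rw [two_smul]
    nth_rewrite 1 [← hsum]
    exact neg_add_cancel _
  exact (smul_eq_zero.1 htwo).resolve_left two_ne_zero

theorem mem_of_forall_commute {x : Cl m} (h : ∀ a, Commute a x) {S : Submodule ℝ (Cl m)}
    (hone : 1 ∈ S) (hvol : Even m → volumeElement m ∈ S) : x ∈ S := by
  have hle : (⊤ : Submodule ℝ (Cl m)) ≤ S.comap conjSum := by
    rw [← span_range_monomial, Submodule.span_le]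
    rintro _ ⟨J, rfl⟩
    change conjSum (monomial J) ∈ S
    by_cases hJ : J = ∅
    · rw [hJ, monomial_empty, conjSum_of_central fun a => Commute.one_right a]
      exact S.smul_mem _ hone
    by_cases hJvol : J = Finset.univ ∧ Even m
    · rw [hJvol.1, ← volumeElement, conjSum_of_central (commute_volumeElement hJvol.2)]
      exact S.smul_mem _ (hvol hJvol.2)
    · rw [conjSum_monomial_eq_zero hJ hJvol]
      exact S.zero_mem
  have hx : conjSum x ∈ S := hle Submodule.mem_top
  rw [conjSum_of_central h] at hx
  exact (S.smul_mem_iff (pow_ne_zero _ two_ne_zero)).1 hx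

end Center

/-! ### Representations of an algebra -/

section Representations

variable {k A M M' M'' : Type*} [Field k] [Ring A] [Algebra k A] [AddCommGroup M] [Module k M]
  [AddCommGroup M'] [Module k M'] [AddCommGroup M''] [Module k M'']

/-- `T` intertwines the representations `ρ` and `σ`. -/
def Intertwines (ρ : A →ₐ[k] Module.End k M) (σ : A →ₐ[k] Module.End k M') (T : M →ₗ[k] M') :
    Prop :=
  ∀ a x, T (ρ a x) = σ a (T x)

/-- `W` is an invariant subspace of the representation `ρ`. -/
def IsInvariant (ρ : A →ₐ[k] Module.End k M) (W : Submodule k M) : Prop :=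
  ∀ a, ∀ w ∈ W, ρ a w ∈ W

/-- The representation `ρ` is irreducible; in particular its space is not zero. -/
def IsIrreducible (ρ : A →ₐ[k] Module.End k M) : Prop :=
  Nontrivial M ∧ ∀ W : Submodule k M, IsInvariant ρ W → W = ⊥ ∨ W = ⊤

/-- The subrepresentation on an invariant subspace. -/
def subRep (ρ : A →ₐ[k] Module.End k M) (W : Submodule k M) (hW : IsInvariant ρ W) :
    A →ₐ[k] Module.End k W :=
  AlgHom.ofLinearMap
    { toFun := fun a => (ρ a).restrict (hW a)
      map_add' := fun a b => by ext; simp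
      map_smul' := fun c a => by ext; simp }
    (by ext; simp) (fun a b => by ext; simp)

variable {ρ : A →ₐ[k] Module.End k M} {σ : A →ₐ[k] Module.End k M'} {τ : A →ₐ[k] Module.End k M''}

theorem Intertwines.comp {S : M' →ₗ[k] M''} {T : M →ₗ[k] M'} (hS : Intertwines σ τ S)
    (hT : Intertwines ρ σ T) : Intertwines ρ τ (S ∘ₗ T) :=
  fun a x => by rw [LinearMap.comp_apply, hT a x, hS a, LinearMap.comp_apply]

theorem intertwines_of_adjoin_eq_top {s : Set A} (hs : Algebra.adjoin k s = ⊤) {T : M →ₗ[k] M'}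
    (h : ∀ a ∈ s, ∀ x, T (ρ a x) = σ a (T x)) : Intertwines ρ σ T := by
  intro a
  have ha : a ∈ Algebra.adjoin k s := hs ▸ Algebra.mem_top
  induction ha using Algebra.adjoin_induction with
  | mem a ha => exact h a ha
  | algebraMap c => simp [Algebra.algebraMap_eq_smul_one]
  | add a b _ _ ha hb => simp [ha, hb]
  | mul a b _ _ ha hb => simp [ha, hb]

theorem Intertwines.isInvariant_ker {T : M →ₗ[k] M'} (hT : Intertwines ρ σ T) :
    IsInvariant ρ (LinearMap.ker T) := by
  intro a w hw
  rw [LinearMap.mem_ker] at hw ⊢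
  rw [hT, hw, map_zero]

theorem Intertwines.isInvariant_range {T : M →ₗ[k] M'} (hT : Intertwines ρ σ T) :
    IsInvariant σ (LinearMap.range T) := by
  rintro a _ ⟨x, rfl⟩
  exact ⟨ρ a x, hT a x⟩

theorem IsIrreducible.injective (h : IsIrreducible ρ) {T : M →ₗ[k] M'} (hT : Intertwines ρ σ T)
    (h0 : T ≠ 0) : Function.Injective T :=
  (h.2 _ hT.isInvariant_ker).elim LinearMap.ker_eq_bot.1
    fun h => absurd (LinearMap.ker_eq_top.1 h) h0

theorem IsIrreducible.of_equiv (h : IsIrreducible ρ) (f : M ≃ₗ[k] M')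
    (hf : Intertwines ρ σ f.toLinearMap) : IsIrreducible σ := by
  have := h.1
  refine ⟨f.injective.nontrivial, fun W hW => ?_⟩
  have hinv : IsInvariant ρ (W.comap f.toLinearMap) := fun a w hw => by
    rw [Submodule.mem_comap, hf]
    exact hW a _ hw
  rw [← Submodule.map_comap_eq_of_surjective (f := f.toLinearMap) f.surjective W]
  rcases h.2 _ hinv with h | h
  · exact Or.inl (by rw [h, Submodule.map_bot])
  · exact Or.inr (by rw [h, Submodule.map_top]; exact f.range)

theorem exists_isIrreducible_subRep [FiniteDimensional k M] [Nontrivial M]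
    (ρ : A →ₐ[k] Module.End k M) :
    ∃ (U : Submodule k M) (hU : IsInvariant ρ U), IsIrreducible (subRep ρ U hU) := by
  obtain ⟨U, ⟨hU, hU0⟩, hmin⟩ := WellFounded.has_min (wellFounded_lt (α := Submodule k M))
    {U | IsInvariant ρ U ∧ U ≠ ⊥} ⟨⊤, fun _ _ _ => trivial, top_ne_bot⟩
  refine ⟨U, hU, Submodule.nontrivial_iff_ne_bot.2 hU0, fun W hW => ?_⟩
  have hinv : IsInvariant ρ (W.map U.subtype) := by
    rintro a _ ⟨x, hx, rfl⟩
    exact ⟨_, hW a x hx, rfl⟩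
  by_contra! hW0
  refine hmin (W.map U.subtype) ⟨hinv, ?_⟩ (lt_of_le_of_ne (Submodule.map_subtype_le U W) ?_)
  · exact fun h => hW0.1 (Submodule.map_injective_of_injective U.subtype_injective
      (h.trans (Submodule.map_bot _).symm))
  · exact fun h => hW0.2 (by
      rw [← Submodule.comap_map_eq_of_injective U.subtype_injective W, h,
        Submodule.comap_subtype_self])

end Representations

/-! ### Real ⋆-algebras of Frobenius type -/

/-- A real ⋆-algebra whose self-adjoint elements are scalars and in which `star x * x` is a
positive scalar for all `x ≠ 0`. By the theorem of Frobenius these are `ℝ`, `ℂ` and `ℍ`; the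
commutants of irreducible orthogonal representations are of this form. -/
structure IsScalarStarAlgebra (D : Type*) [Ring D] [StarRing D] [Algebra ℝ D] : Prop where
  exists_eq_algebraMap : ∀ x : D, star x = x → ∃ c : ℝ, x = algebraMap ℝ D c
  exists_star_mul_self : ∀ x : D, x ≠ 0 → ∃ c : ℝ, 0 < c ∧ star x * x = algebraMap ℝ D c

/-- The map `x ↦ a x⋆ b`. -/
def mulStarMul {D : Type*} [Ring D] [StarRing D] [Algebra ℝ D] [StarModule ℝ D] (a b : D) :
    D →ₗ[ℝ] D where
  toFun x := a * star x * b
  map_add' x y := by rw [star_add, mul_add, add_mul]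
  map_smul' c x := by simp

@[simp] theorem mulStarMul_apply {D : Type*} [Ring D] [StarRing D] [Algebra ℝ D] [StarModule ℝ D]
    (a b x : D) : mulStarMul a b x = a * star x * b := rfl

namespace IsScalarStarAlgebra

theorem real : IsScalarStarAlgebra ℝ where
  exists_eq_algebraMap x _ := ⟨x, rfl⟩
  exists_star_mul_self x hx := ⟨x * x, mul_self_pos.2 hx, rfl⟩

theorem complex : IsScalarStarAlgebra ℂ where
  exists_eq_algebraMap x hx := ⟨x.re, (Complex.conj_eq_iff_re.1 hx).symm⟩
  exists_star_mul_self x hx := ⟨Complex.normSq x, Complex.normSq_pos.2 hx,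
    (Complex.normSq_eq_conj_mul_self (z := x)).symm⟩

theorem quaternion : IsScalarStarAlgebra ℍ[ℝ] where
  exists_eq_algebraMap x hx := ⟨x.re, Quaternion.star_eq_self.1 hx⟩
  exists_star_mul_self x hx := ⟨Quaternion.normSq x,
    lt_of_le_of_ne Quaternion.normSq_nonneg (Quaternion.normSq_ne_zero.2 hx).symm,
    Quaternion.star_mul_self x⟩

variable {D K : Type*} [Ring D] [StarRing D] [Algebra ℝ D]
  [Ring K] [StarRing K] [Algebra ℝ K]

theorem exists_smul_mul_self_eq_neg_one (hD : IsScalarStarAlgebra D) {x : D} (hx : star x = -x)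
    (h0 : x ≠ 0) : ∃ t : ℝ, t ≠ 0 ∧ (t • x) * (t • x) = -1 := by
  obtain ⟨c, hc, h⟩ := hD.exists_star_mul_self x h0
  rw [hx, neg_mul, neg_eq_iff_eq_neg] at h
  refine ⟨(√c)⁻¹, inv_ne_zero (Real.sqrt_pos.2 hc).ne', ?_⟩
  rw [smul_mul_smul_comm, h, ← mul_inv, Real.mul_self_sqrt hc.le, smul_neg,
    Algebra.algebraMap_eq_smul_one, smul_smul, inv_mul_cancel₀ hc.ne', one_smul]

theorem exists_mul_add_mul_eq (hD : IsScalarStarAlgebra D) {x y : D} (hx : star x = -x)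
    (hy : star y = -y) : ∃ c : ℝ, x * y + y * x = algebraMap ℝ D c :=
  hD.exists_eq_algebraMap _ (by rw [star_add, star_mul, star_mul, hx, hy]; noncomm_ring)

variable [StarModule ℝ D]

theorem star_eq_neg_of_mul_self (hD : IsScalarStarAlgebra D) {x : D} (hx : x * x = -1) :
    star x = -x := by
  nontriviality D
  have hx0 : x ≠ 0 := by
    rintro rfl
    simp at hx
  obtain ⟨c, hc, h⟩ := hD.exists_star_mul_self x hx0
  have hstar : star x = -(c • x) := by
    have h' := congrArg (· * x) h
    simp only [mul_assoc, hx, mul_neg, mul_one, ← Algebra.smul_def] at h'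
    rw [← h', neg_neg]
  have hcc : (c * c) • x = (1 : ℝ) • x := by
    nth_rewrite 2 [← star_star x]
    rw [one_smul, hstar, star_neg, star_smul, hstar, smul_neg, neg_neg, smul_smul, star_trivial]
  have hc1 : c = 1 := by
    have := smul_left_injective ℝ hx0 hcc
    nlinarith
  rw [hstar, hc1, one_smul]

theorem exists_eq_add_skew (hD : IsScalarStarAlgebra D) (x : D) :
    ∃ (c : ℝ) (s : D), star s = -s ∧ x = algebraMap ℝ D c + s := by
  obtain ⟨c, hc⟩ := hD.exists_eq_algebraMap (x + star x) (by rw [star_add, star_star, add_comm])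
  refine ⟨c / 2, x - algebraMap ℝ D (c / 2), ?_, by abel⟩
  have hhalf : algebraMap ℝ D c = algebraMap ℝ D (c / 2) + algebraMap ℝ D (c / 2) := by
    rw [← map_add, add_halves]
  rw [star_sub, ← algebraMap_star_comm, star_trivial (c / 2), eq_sub_of_add_eq' hc, hhalf]
  abel

theorem exists_imaginary_unit (hD : IsScalarStarAlgebra D) {x : D}
    (hx : ∀ c : ℝ, x ≠ algebraMap ℝ D c) :
    ∃ (a b : ℝ) (j : D), j * j = -1 ∧ x = algebraMap ℝ D a + b • j := by
  obtain ⟨c, s, hs, rfl⟩ := hD.exists_eq_add_skew x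
  have hs0 : s ≠ 0 := by
    rintro rfl
    exact hx c (add_zero _)
  obtain ⟨t, ht, hsq⟩ := hD.exists_smul_mul_self_eq_neg_one hs hs0
  exact ⟨c, t⁻¹, t • s, hsq, by rw [smul_smul, inv_mul_cancel₀ ht, one_smul]⟩

theorem map_star_of_algHom [StarModule ℝ K] (hK : IsScalarStarAlgebra K)
    (hD : IsScalarStarAlgebra D) (l : K →ₐ[ℝ] D) (q : K) : l (star q) = star (l q) := by
  obtain ⟨c, s, hs, rfl⟩ := hK.exists_eq_add_skew q
  suffices h : star (l s) = -l s by
    rw [star_add, map_add, hs, map_add, star_add, h, ← algebraMap_star_comm, l.commutes, l.commutes,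
      map_neg, ← algebraMap_star_comm]
  by_cases hs0 : s = 0
  · simp [hs0]
  obtain ⟨t, ht, hsq⟩ := hK.exists_smul_mul_self_eq_neg_one hs hs0
  have hlsq : l (t • s) * l (t • s) = -1 := by rw [← map_mul, hsq, map_neg, map_one]
  have hstar := hD.star_eq_neg_of_mul_self hlsq
  rw [map_smul, star_smul, star_trivial, ← smul_neg] at hstar
  exact (smul_right_injective D ht) hstar

theorem trace_star [FiniteDimensional ℝ D] [Nontrivial D] (hD : IsScalarStarAlgebra D) :
    LinearMap.trace ℝ D (mulStarMul 1 1) = 2 - Module.finrank ℝ D := by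
  have hmem : ∀ x, (mulStarMul 1 1 + LinearMap.id : D →ₗ[ℝ] D) x ∈ Submodule.span ℝ {(1 : D)} := by
    intro x
    obtain ⟨c, hc⟩ := hD.exists_eq_algebraMap (star x + x) (by rw [star_add, star_star, add_comm])
    rw [Submodule.mem_span_singleton]
    exact ⟨c, by simp [hc, Algebra.algebraMap_eq_smul_one]⟩
  have hrestrict : (mulStarMul 1 1 + LinearMap.id : D →ₗ[ℝ] D).restrict (fun x _ => hmem x) =
      (2 : ℝ) • (LinearMap.id : Submodule.span ℝ {(1 : D)} →ₗ[ℝ] _) := by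
    refine LinearMap.ext fun x => Subtype.ext ?_
    obtain ⟨c, hc⟩ := Submodule.mem_span_singleton.1 x.2
    simp [← hc, two_smul]
  have htrace := LinearMap.trace_restrict_eq_of_forall_mem _ _ hmem
  rw [hrestrict, map_smul, LinearMap.trace_id, finrank_span_singleton one_ne_zero, map_add,
    LinearMap.trace_id] at htrace
  simp only [Nat.cast_one, smul_eq_mul, mul_one] at htrace
  linarith

end IsScalarStarAlgebra

section

variable {D : Type*} [Ring D] [Algebra ℝ D]

theorem exists_forall_ne_algebraMap (h : 1 < Module.finrank ℝ D) :
    ∃ x : D, ∀ c : ℝ, x ≠ algebraMap ℝ D c := by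
  by_contra! hc
  refine absurd (finrank_le_one (1 : D) fun x => ?_) h.not_ge
  obtain ⟨c, hc⟩ := hc x
  exact ⟨c, by rw [hc, Algebra.algebraMap_eq_smul_one]⟩

theorem exists_forall_ne_algebraMap_add_smul (h : 2 < Module.finrank ℝ D) (j : D) :
    ∃ x : D, ∀ a b : ℝ, x ≠ algebraMap ℝ D a + b • j := by
  by_contra! hc
  let f : ℝ × ℝ →ₗ[ℝ] D := (Algebra.linearMap ℝ D).coprod (LinearMap.toSpanSingleton ℝ D j)
  have hf : LinearMap.range f = ⊤ := by
    rw [LinearMap.range_eq_top]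
    intro x
    obtain ⟨a, b, rfl⟩ := hc x
    exact ⟨(a, b), by simp [f]⟩
  have hle := f.finrank_range_le
  rw [hf, finrank_top, Module.finrank_prod, Module.finrank_self] at hle
  omega

end

namespace IsScalarStarAlgebra

variable {D : Type*} [Ring D] [StarRing D] [Algebra ℝ D] [StarModule ℝ D]

theorem nonempty_complex_algHom (hD : IsScalarStarAlgebra D) (h : 1 < Module.finrank ℝ D) :
    Nonempty (ℂ →ₐ[ℝ] D) := by
  obtain ⟨x, hx⟩ := exists_forall_ne_algebraMap h
  obtain ⟨-, -, j, hj, -⟩ := hD.exists_imaginary_unit hx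
  exact ⟨Complex.lift ⟨j, hj⟩⟩

theorem exists_anticommuting_imaginary_unit (hD : IsScalarStarAlgebra D) {j : D}
    (hj : j * j = -1) {x : D} (hx : ∀ a b : ℝ, x ≠ algebraMap ℝ D a + b • j) :
    ∃ k : D, k * k = -1 ∧ k * j = -(j * k) := by
  obtain ⟨a, s, hs, rfl⟩ := hD.exists_eq_add_skew x
  have hjs := hD.star_eq_neg_of_mul_self hj
  obtain ⟨d, hd⟩ := hD.exists_mul_add_mul_eq hjs hs
  have hs' : star (s + (d / 2) • j) = -(s + (d / 2) • j) := by
    rw [star_add, star_smul, hs, hjs, star_trivial, smul_neg, neg_add]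
  have hne : s + (d / 2) • j ≠ 0 := fun h0 =>
    hx a (-(d / 2)) (by rw [neg_smul, ← eq_neg_of_add_eq_zero_left h0])
  obtain ⟨t, -, hsq⟩ := hD.exists_smul_mul_self_eq_neg_one hs' hne
  refine ⟨_, hsq, ?_⟩
  rw [smul_mul_assoc, mul_smul_comm, ← smul_neg]
  congr 1
  rw [Algebra.algebraMap_eq_smul_one] at hd
  simp only [add_mul, mul_add, smul_mul_assoc, mul_smul_comm, hj, smul_neg]
  linear_combination (norm := module) hd

theorem nonempty_quaternion_algHom (hD : IsScalarStarAlgebra D) (h : 2 < Module.finrank ℝ D) :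
    Nonempty (ℍ[ℝ] →ₐ[ℝ] D) := by
  obtain ⟨x, hx⟩ := exists_forall_ne_algebraMap (one_lt_two.trans h)
  obtain ⟨-, -, i, hi, -⟩ := hD.exists_imaginary_unit hx
  obtain ⟨y, hy⟩ := exists_forall_ne_algebraMap_add_smul h i
  obtain ⟨j, hj, hji⟩ := hD.exists_anticommuting_imaginary_unit hi hy
  exact ⟨QuaternionAlgebra.Basis.liftHom (c₁ := -1) (c₂ := 0) (c₃ := -1)
    { i := i
      j := j
      k := i * j
      i_mul_i := by simp [hi]
      j_mul_j := by simp [hj]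
      i_mul_j := rfl
      j_mul_i := by simp [hji] }⟩

theorem surjective_quaternion_algHom (hD : IsScalarStarAlgebra D) (l : ℍ[ℝ] →ₐ[ℝ] D) :
    Function.Surjective l := by
  obtain ⟨B, rfl⟩ := QuaternionAlgebra.lift.surjective l
  have hi : B.i * B.i = -1 := by simp
  have hj : B.j * B.j = -1 := by simp
  have hk : B.k * B.k = -1 := by simp
  intro x
  obtain ⟨c, s, hs, rfl⟩ := hD.exists_eq_add_skew x
  obtain ⟨a, ha⟩ := hD.exists_mul_add_mul_eq (hD.star_eq_neg_of_mul_self hi) hs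
  obtain ⟨b, hb⟩ := hD.exists_mul_add_mul_eq (hD.star_eq_neg_of_mul_self hj) hs
  obtain ⟨d, hd⟩ := hD.exists_mul_add_mul_eq (hD.star_eq_neg_of_mul_self hk) hs
  set s' := s + (a / 2) • B.i + (b / 2) • B.j + (d / 2) • B.k with hs'
  simp only [Algebra.algebraMap_eq_smul_one] at ha hb hd
  have hi' : B.i * s' = -(s' * B.i) := by
    simp only [hs', mul_add, add_mul, mul_smul_comm, smul_mul_assoc, hi, B.i_mul_j, B.j_mul_i,
      B.i_mul_k, B.k_mul_i]
    linear_combination (norm := module) ha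
  have hj' : B.j * s' = -(s' * B.j) := by
    simp only [hs', mul_add, add_mul, mul_smul_comm, smul_mul_assoc, hj, B.i_mul_j, B.j_mul_i,
      B.j_mul_k, B.k_mul_j]
    linear_combination (norm := module) hb
  have hk' : B.k * s' = -(s' * B.k) := by
    simp only [hs', mul_add, add_mul, mul_smul_comm, smul_mul_assoc, hk, B.i_mul_k, B.k_mul_i,
      B.j_mul_k, B.k_mul_j]
    linear_combination (norm := module) hd
  have hcomm : B.k * s' = s' * B.k := by
    rw [← B.i_mul_j, mul_assoc, hj', mul_neg, ← mul_assoc, hi', neg_mul, neg_neg, mul_assoc]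
  have h0 : s' = 0 := by
    have hks : B.k * s' = 0 := by
      linear_combination (norm := module) (1 / 2 : ℝ) • hk' + (1 / 2 : ℝ) • hcomm
    simpa [← mul_assoc, hk] using congrArg (B.k * ·) hks
  refine ⟨⟨c, -(a / 2), -(b / 2), -(d / 2)⟩, ?_⟩
  rw [hs'] at h0
  change algebraMap ℝ D c + -(a / 2) • B.i + -(b / 2) • B.j + -(d / 2) • B.k = _
  linear_combination (norm := module) -h0

end IsScalarStarAlgebra

/-! ### Symmetric representations and their commutants -/

section Symmetric

theorem trace_monomial {m : ℕ} {M : Type*} [AddCommGroup M] [Module ℝ M]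
    (ρ : Cl m →ₐ[ℝ] Module.End ℝ M) {I : Finset (Fin (m + 1))} (hI : I ≠ ∅)
    (hvol : ¬(I = Finset.univ ∧ Even m)) : LinearMap.trace ℝ M (ρ (monomial I)) = 0 := by
  obtain ⟨i, hi⟩ := exists_stdGen_mul_monomial_eq_neg hI hvol
  have h : LinearMap.trace ℝ M (ρ (monomial I)) = -LinearMap.trace ℝ M (ρ (monomial I)) :=
    calc LinearMap.trace ℝ M (ρ (monomial I))
        = LinearMap.trace ℝ M (ρ (stdGen i) * ρ (stdGen i * monomial I)) := by
          rw [← map_mul, stdGen_mul_cancel_left]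
      _ = LinearMap.trace ℝ M (ρ (stdGen i * monomial I) * ρ (stdGen i)) :=
          LinearMap.trace_mul_comm ..
      _ = _ := by
          rw [← map_mul, hi, neg_mul, mul_assoc, stdGen_mul_self, mul_one, map_neg, map_neg]
  linarith

variable {m : ℕ} {E F : Type*} [NormedAddCommGroup E] [InnerProductSpace ℝ E]
  [NormedAddCommGroup F] [InnerProductSpace ℝ F]
  {ρ : Cl m →ₐ[ℝ] Module.End ℝ E} {σ : Cl m →ₐ[ℝ] Module.End ℝ F}

/-- The generators `E_i` act by symmetric endomorphisms. -/
def IsSymmRep (ρ : Cl m →ₐ[ℝ] Module.End ℝ E) : Prop :=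
  ∀ i, (ρ (stdGen i)).IsSymmetric

theorem IsSymmRep.inner_left (h : IsSymmRep ρ) (a : Cl m) (x y : E) :
    inner ℝ (ρ a x) y = inner ℝ x (ρ (CliffordAlgebra.reverse a) y) := by
  have ha : a ∈ Algebra.adjoin ℝ (Set.range (stdGen (m := m))) :=
    adjoin_range_stdGen ▸ Algebra.mem_top
  induction ha using Algebra.adjoin_induction generalizing x y with
  | mem a ha =>
    obtain ⟨i, rfl⟩ := ha
    rw [reverse_stdGen, h i]
  | algebraMap c => simp [Algebra.algebraMap_eq_smul_one, inner_smul_left, inner_smul_right]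
  | add a b _ _ ha hb => simp [inner_add_left, inner_add_right, ha, hb]
  | mul a b _ _ ha hb => simp [CliffordAlgebra.reverse.map_mul, ha, hb]

theorem IsSymmRep.subRep (h : IsSymmRep ρ) {W : Submodule ℝ E} (hW : IsInvariant ρ W) :
    IsSymmRep (subRep ρ W hW) :=
  fun i x y => h i x y

theorem IsSymmRep.isInvariant_orthogonal (h : IsSymmRep ρ) {W : Submodule ℝ E}
    (hW : IsInvariant ρ W) : IsInvariant ρ Wᗮ := by
  intro a w hw
  rw [Submodule.mem_orthogonal'] at hw ⊢
  intro u hu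
  rw [h.inner_left]
  exact hw _ (hW _ _ hu)

variable [FiniteDimensional ℝ E] [FiniteDimensional ℝ F]

theorem IsSymmRep.star_apply (h : IsSymmRep ρ) (a : Cl m) :
    star (ρ a) = ρ (CliffordAlgebra.reverse a) :=
  LinearMap.ext fun x => ext_inner_left ℝ fun y => by
    rw [LinearMap.star_eq_adjoint, LinearMap.adjoint_inner_right, h.inner_left]

theorem Intertwines.adjoint (hρ : IsSymmRep ρ) (hσ : IsSymmRep σ) {T : E →ₗ[ℝ] F}
    (hT : Intertwines ρ σ T) : Intertwines σ ρ (LinearMap.adjoint T) := by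
  refine fun a x => ext_inner_right ℝ fun y => ?_
  rw [LinearMap.adjoint_inner_left, hσ.inner_left, ← hT, hρ.inner_left,
    LinearMap.adjoint_inner_left]

/-- The commutant of `ρ(Cl)` and of the adjoints of its elements, as a ⋆-algebra. -/
def commutant (ρ : Cl m →ₐ[ℝ] Module.End ℝ E) : StarSubalgebra ℝ (Module.End ℝ E) :=
  StarSubalgebra.centralizer ℝ (Set.range ρ)

theorem mem_commutant_iff (hρ : IsSymmRep ρ) {T : Module.End ℝ E} :
    T ∈ commutant ρ ↔ Intertwines ρ ρ T := by
  rw [commutant, StarSubalgebra.mem_centralizer_iff]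
  constructor
  · exact fun h a x => (LinearMap.congr_fun (h _ ⟨a, rfl⟩).1 x).symm
  · rintro h _ ⟨a, rfl⟩
    rw [hρ.star_apply]
    exact ⟨LinearMap.ext fun x => (h a x).symm, LinearMap.ext fun x => (h _ x).symm⟩

theorem IsIrreducible.exists_eq_algebraMap (h : IsIrreducible ρ) {T : Module.End ℝ E}
    (hs : T.IsSymmetric) (hT : Intertwines ρ ρ T) :
    ∃ c : ℝ, T = algebraMap ℝ (Module.End ℝ E) c := by
  have := h.1
  obtain ⟨c, hc⟩ : ∃ c, Module.End.HasEigenvalue T c :=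
    ⟨_, hs.hasEigenvalue_iSup_of_finiteDimensional⟩
  have hinv : IsInvariant ρ (Module.End.eigenspace T c) := fun a w hw => by
    rw [Module.End.mem_eigenspace_iff] at hw ⊢
    rw [hT, hw, map_smul]
  have htop : Module.End.eigenspace T c = ⊤ := (h.2 _ hinv).resolve_left hc
  refine ⟨c, LinearMap.ext fun x => ?_⟩
  exact Module.End.mem_eigenspace_iff.1 (htop ▸ Submodule.mem_top)

theorem isScalarStarAlgebra_commutant (hρ : IsSymmRep ρ) (h : IsIrreducible ρ) :
    IsScalarStarAlgebra (commutant ρ) where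
  exists_eq_algebraMap T hT := by
    have hsymm : (T : Module.End ℝ E).IsSymmetric :=
      LinearMap.isSymmetric_iff_isSelfAdjoint _ |>.2 (congrArg Subtype.val hT)
    obtain ⟨c, hc⟩ := h.exists_eq_algebraMap hsymm ((mem_commutant_iff hρ).1 T.2)
    exact ⟨c, Subtype.ext hc⟩
  exists_star_mul_self T hT := by
    have hsymm : (star T * T : Module.End ℝ E).IsSymmetric :=
      LinearMap.isSymmetric_iff_isSelfAdjoint _ |>.2 (IsSelfAdjoint.star_mul_self _)
    obtain ⟨c, hc : star (T : Module.End ℝ E) * T = algebraMap ℝ _ c⟩ :=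
      h.exists_eq_algebraMap hsymm ((mem_commutant_iff hρ).1 (star T * T).2)
    refine ⟨c, ?_, Subtype.ext hc⟩
    obtain ⟨x, hx⟩ : ∃ x, (T : Module.End ℝ E) x ≠ 0 := by
      by_contra! h0
      exact hT (Subtype.ext (LinearMap.ext h0))
    have hnorm : ‖(T : Module.End ℝ E) x‖ ^ 2 = c * ‖x‖ ^ 2 := by
      rw [← real_inner_self_eq_norm_sq, ← LinearMap.adjoint_inner_left, ← LinearMap.star_eq_adjoint,
        ← Module.End.mul_apply, hc, Module.algebraMap_end_apply, real_inner_smul_left,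
        real_inner_self_eq_norm_sq]
    have hpos : 0 < c * ‖x‖ ^ 2 := hnorm ▸ by positivity
    exact pos_of_mul_pos_left hpos (by positivity)

theorem trace_mulStarMul_matrix {ι : Type*} [Fintype ι] [DecidableEq ι] (A B : Matrix ι ι ℝ) :
    LinearMap.trace ℝ _ (mulStarMul A B) = (star A * B).trace := by
  rw [LinearMap.trace_eq_matrix_trace ℝ (Matrix.stdBasis ℝ ι ι), Matrix.trace,
    Fintype.sum_prod_type, Finset.sum_comm]
  refine Finset.sum_congr rfl fun j _ => Finset.sum_congr rfl fun i _ => ?_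
  rw [Matrix.diag_apply, LinearMap.toMatrix_apply, Matrix.stdBasis_eq_single]
  change (A * star (Matrix.single i j (1 : ℝ)) * B) i j = (star A) j i * B i j
  simp [Matrix.star_eq_conjTranspose, Matrix.mul_apply, Matrix.single_apply, ite_and]

theorem trace_mulStarMul (A B : Module.End ℝ E) :
    LinearMap.trace ℝ _ (mulStarMul A B) = LinearMap.trace ℝ E (star A * B) := by
  let b := stdOrthonormalBasis ℝ E
  let e := LinearMap.toMatrix b.toBasis b.toBasis
  have hstar (T : Module.End ℝ E) : e (star T) = star (e T) := LinearMap.toMatrix_adjoint b b T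
  have hmul (S T : Module.End ℝ E) : e (S * T) = e S * e T := LinearMap.toMatrix_mul b.toBasis S T
  have hconj : e.conj (mulStarMul A B) = mulStarMul (e A) (e B) := by
    refine LinearMap.ext fun X => ?_
    obtain ⟨T, rfl⟩ := e.surjective X
    rw [LinearEquiv.conj_apply_apply, e.symm_apply_apply, mulStarMul_apply, mulStarMul_apply,
      hmul, hmul, hstar]
  rw [← LinearMap.trace_conj' _ e, hconj, trace_mulStarMul_matrix, ← hstar, ← hmul,
    LinearMap.trace_eq_matrix_trace ℝ b.toBasis]

/-- The sum of the signs `E_I ^ 2` of all the monomials. -/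
def signSum (m : ℕ) : ℝ := ∑ I : Finset (Fin (m + 1)), monomialSign I.card

/-- The map `T ↦ ∑ I, ρ(E_I)⁻¹ T⋆ ρ(E_I)`. Its trace, computed on `End E` and on the commutant,
determines the dimension of the commutant, in the manner of the Frobenius–Schur indicator. -/
def starSum (ρ : Cl m →ₐ[ℝ] Module.End ℝ E) : Module.End ℝ (Module.End ℝ E) :=
  ∑ I : Finset (Fin (m + 1)),
    mulStarMul (ρ (CliffordAlgebra.reverse (monomial I))) (ρ (monomial I))

theorem starSum_apply (T : Module.End ℝ E) :
    starSum ρ T = ∑ I : Finset (Fin (m + 1)),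
      ρ (CliffordAlgebra.reverse (monomial I)) * star T * ρ (monomial I) := by
  simp only [starSum, LinearMap.sum_apply, mulStarMul_apply]

theorem starSum_mem_commutant (hρ : IsSymmRep ρ) (T : Module.End ℝ E) :
    starSum ρ T ∈ commutant ρ := by
  refine (mem_commutant_iff hρ).2 (intertwines_of_adjoin_eq_top adjoin_range_stdGen ?_)
  rintro _ ⟨i, rfl⟩
  have hconj : ρ (stdGen i) * (starSum ρ T * ρ (stdGen i)) = starSum ρ T := by
    have h := sum_monomial_mul_stdGen ((LinearMap.mul ℝ (Module.End ℝ E)).compl₁₂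
      (LinearMap.mulRight ℝ (star T) ∘ₗ ρ.toLinearMap) ρ.toLinearMap) i
    simpa [starSum_apply, Finset.mul_sum, Finset.sum_mul, mul_assoc] using h
  refine LinearMap.congr_fun (?_ : starSum ρ T * ρ (stdGen i) = ρ (stdGen i) * starSum ρ T)
  nth_rewrite 2 [← hconj]
  rw [← mul_assoc, ← map_mul, stdGen_mul_self, map_one, one_mul]

theorem starSum_of_mem_commutant (hρ : IsSymmRep ρ) {T : Module.End ℝ E}
    (hT : T ∈ commutant ρ) : starSum ρ T = (2 : ℝ) ^ (m + 1) • star T := by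
  have hcomm (a : Cl m) : star T * ρ a = ρ a * star T :=
    LinearMap.ext fun x => (mem_commutant_iff hρ).1 (star_mem hT) a x
  simp only [starSum_apply, mul_assoc, hcomm]
  simp only [← mul_assoc, ← map_mul, reverse_monomial_mul_self, map_one, one_mul,
    Finset.sum_const, Finset.card_univ, Fintype.card_finset, Fintype.card_fin]
  rw [← Nat.cast_smul_eq_nsmul ℝ, Nat.cast_pow, Nat.cast_ofNat]

theorem trace_starSum (hρ : IsSymmRep ρ) :
    LinearMap.trace ℝ _ (starSum ρ) = signSum m * Module.finrank ℝ E := by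
  simp only [starSum, map_sum, trace_mulStarMul, hρ.star_apply, CliffordAlgebra.reverse_reverse,
    ← map_mul, monomial_mul_self, map_smul, map_one, LinearMap.trace_one, signSum, Finset.sum_mul,
    smul_eq_mul]

instance : FiniteDimensional ℝ (commutant ρ) :=
  inferInstanceAs (FiniteDimensional ℝ (Subalgebra.toSubmodule (commutant ρ).toSubalgebra))

theorem two_sub_finrank_commutant (hρ : IsSymmRep ρ) (h : IsIrreducible ρ) :
    (2 : ℝ) ^ (m + 1) * (2 - Module.finrank ℝ (commutant ρ)) =
      signSum m * Module.finrank ℝ E := by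
  let W := Subalgebra.toSubmodule (commutant ρ).toSubalgebra
  have hW (T) : starSum ρ T ∈ W := starSum_mem_commutant hρ T
  have hrestrict : ((starSum ρ).restrict fun T _ => hW T : W →ₗ[ℝ] W) =
      (2 : ℝ) ^ (m + 1) • (mulStarMul 1 1 : commutant ρ →ₗ[ℝ] commutant ρ) := by
    refine LinearMap.ext fun T => Subtype.ext ((starSum_of_mem_commutant hρ T.2).trans ?_)
    change _ = (2 : ℝ) ^ (m + 1) • (1 * star (T : Module.End ℝ E) * 1)
    rw [one_mul, mul_one]
  have := h.1
  rw [← trace_starSum hρ, ← LinearMap.trace_restrict_eq_of_forall_mem W _ hW,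
    ← (isScalarStarAlgebra_commutant hρ h).trace_star, ← smul_eq_mul, ← map_smul, hrestrict]
  rfl

end Symmetric

/-! ### The type of the commutant -/

theorem monomialSign_eq_re_add_im (k : ℕ) :
    monomialSign k = (Complex.I ^ k).re + (Complex.I ^ k).im := by
  induction k using Nat.twoStepInduction with
  | zero => simp [monomialSign]
  | one => simp [monomialSign]
  | more k h _ =>
    have hodd : Odd (k + 1 + k) := ⟨k, by ring⟩
    rw [monomialSign_succ, monomialSign_succ, ← mul_assoc, ← pow_add, hodd.neg_one_pow,
      neg_one_mul, h, pow_add, Complex.I_sq, mul_neg_one, Complex.neg_re, Complex.neg_im, neg_add]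

theorem signSum_eq_re_add_im (m : ℕ) :
    signSum m = ((1 + Complex.I) ^ (m + 1)).re + ((1 + Complex.I) ^ (m + 1)).im := by
  have h := Finset.sum_pow_mul_eq_add_pow Complex.I (1 : ℂ) (Finset.univ : Finset (Fin (m + 1)))
  rw [Finset.card_univ, Fintype.card_fin, add_comm Complex.I] at h
  rw [← h, Complex.re_sum, Complex.im_sum, ← Finset.sum_add_distrib, signSum]
  simp [monomialSign_eq_re_add_im]

theorem signSum_eq_mul_signSum_mod (m : ℕ) : signSum m = 16 ^ (m / 8) * signSum (m % 8) := by
  have h8 : (1 + Complex.I) ^ 8 = ((16 : ℝ) : ℂ) := by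
    have h2 : (1 + Complex.I) ^ 2 = 2 * Complex.I := by rw [add_sq, Complex.I_sq]; ring
    rw [show 8 = 2 * 4 from rfl, pow_mul, h2, mul_pow, Complex.I_pow_four]
    norm_num
  have h : (1 + Complex.I) ^ (m + 1) =
      (((16 : ℝ) ^ (m / 8) : ℝ) : ℂ) * (1 + Complex.I) ^ (m % 8 + 1) := by
    conv_lhs => rw [← Nat.div_add_mod m 8]
    rw [add_assoc, pow_add, pow_mul, h8, Complex.ofReal_pow]
  rw [signSum_eq_re_add_im, signSum_eq_re_add_im, h, Complex.re_ofReal_mul, Complex.im_ofReal_mul,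
    mul_add]

theorem signSum_pos {m : ℕ} (h : m % 8 = 0 ∨ m % 8 = 1 ∨ m % 8 = 7) : 0 < signSum m := by
  rw [signSum_eq_mul_signSum_mod, mul_pos_iff_of_pos_left (by positivity), signSum_eq_re_add_im]
  rcases h with h | h | h <;> rw [h] <;> norm_num [pow_succ]

theorem signSum_eq_zero {m : ℕ} (h : m % 4 = 2) : signSum m = 0 := by
  have h8 : m % 8 = 2 ∨ m % 8 = 6 := by omega
  rw [signSum_eq_mul_signSum_mod, signSum_eq_re_add_im]
  rcases h8 with h | h <;> rw [h] <;> norm_num [pow_succ]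

theorem signSum_neg {m : ℕ} (h : m % 8 = 3 ∨ m % 8 = 4 ∨ m % 8 = 5) : signSum m < 0 := by
  rw [signSum_eq_mul_signSum_mod]
  refine mul_neg_of_pos_of_neg (by positivity) ?_
  rw [signSum_eq_re_add_im]
  rcases h with h | h | h <;> rw [h] <;> norm_num [pow_succ]

/-- `K` is the commutant of all the irreducible symmetric representations of the Clifford algebra:
it embeds into the commutant, and every embedding is onto. -/
def IsCommutantField (K : Type) [Ring K] [Algebra ℝ K] (m : ℕ) : Prop :=
  ∀ (E : Type) [NormedAddCommGroup E] [InnerProductSpace ℝ E] [FiniteDimensional ℝ E]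
    (ρ : Cl m →ₐ[ℝ] Module.End ℝ E), IsSymmRep ρ → IsIrreducible ρ →
    Nonempty (K →ₐ[ℝ] commutant ρ) ∧ ∀ l : K →ₐ[ℝ] commutant ρ, Function.Surjective l

theorem surjective_algHom_of_finrank_eq {K D : Type*} [DivisionRing K] [Algebra ℝ K] [Ring D]
    [Algebra ℝ D] [Nontrivial D] [FiniteDimensional ℝ K] [FiniteDimensional ℝ D]
    (h : Module.finrank ℝ K = Module.finrank ℝ D) (l : K →ₐ[ℝ] D) : Function.Surjective l :=
  (LinearMap.injective_iff_surjective_of_finrank_eq_finrank (f := l.toLinearMap) h).1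
    l.toRingHom.injective

section

variable {m : ℕ} {E : Type*} [NormedAddCommGroup E] [InnerProductSpace ℝ E]
  [FiniteDimensional ℝ E] {ρ : Cl m →ₐ[ℝ] Module.End ℝ E}

theorem IsIrreducible.nontrivial_commutant (h : IsIrreducible ρ) : Nontrivial (commutant ρ) :=
  have := h.1
  inferInstance

theorem finrank_commutant_eq_one (hm : m % 8 = 0 ∨ m % 8 = 1 ∨ m % 8 = 7) (hρ : IsSymmRep ρ)
    (h : IsIrreducible ρ) : Module.finrank ℝ (commutant ρ) = 1 := by
  have := h.1
  have := h.nontrivial_commutant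
  have hpos : 0 < (2 : ℝ) ^ (m + 1) * (2 - Module.finrank ℝ (commutant ρ)) := by
    rw [two_sub_finrank_commutant hρ h]
    exact mul_pos (signSum_pos hm) (Nat.cast_pos.2 Module.finrank_pos)
  have hlt : Module.finrank ℝ (commutant ρ) < 2 := by
    exact_mod_cast sub_pos.1 (pos_of_mul_pos_right hpos (by positivity))
  have : 0 < Module.finrank ℝ (commutant ρ) := Module.finrank_pos
  omega

theorem finrank_commutant_eq_two (hm : m % 4 = 2) (hρ : IsSymmRep ρ) (h : IsIrreducible ρ) :
    Module.finrank ℝ (commutant ρ) = 2 := by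
  have hdim := two_sub_finrank_commutant hρ h
  rw [signSum_eq_zero hm, zero_mul, mul_eq_zero_iff_left (by positivity), sub_eq_zero] at hdim
  exact_mod_cast hdim.symm

theorem two_lt_finrank_commutant (hm : m % 8 = 3 ∨ m % 8 = 4 ∨ m % 8 = 5) (hρ : IsSymmRep ρ)
    (h : IsIrreducible ρ) : 2 < Module.finrank ℝ (commutant ρ) := by
  have := h.1
  have hneg : (2 : ℝ) ^ (m + 1) * (2 - Module.finrank ℝ (commutant ρ)) < 0 := by
    rw [two_sub_finrank_commutant hρ h]
    exact mul_neg_of_neg_of_pos (signSum_neg hm) (Nat.cast_pos.2 Module.finrank_pos)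
  exact_mod_cast sub_neg.1 (neg_of_mul_neg_right hneg (by positivity))

end

theorem isCommutantField_real {m : ℕ} (hm : m % 8 = 0 ∨ m % 8 = 1 ∨ m % 8 = 7) :
    IsCommutantField ℝ m := fun _ _ _ _ _ hρ h =>
  have := h.nontrivial_commutant
  ⟨⟨Algebra.ofId _ _⟩, surjective_algHom_of_finrank_eq
    ((Module.finrank_self ℝ).trans (finrank_commutant_eq_one hm hρ h).symm)⟩

theorem isCommutantField_complex {m : ℕ} (hm : m % 4 = 2) : IsCommutantField ℂ m :=
  fun _ _ _ _ _ hρ h =>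
  have := h.nontrivial_commutant
  have hdim := finrank_commutant_eq_two hm hρ h
  ⟨(isScalarStarAlgebra_commutant hρ h).nonempty_complex_algHom (by omega),
    surjective_algHom_of_finrank_eq (Complex.finrank_real_complex.trans hdim.symm)⟩

theorem isCommutantField_quaternion {m : ℕ} (hm : m % 8 = 3 ∨ m % 8 = 4 ∨ m % 8 = 5) :
    IsCommutantField ℍ[ℝ] m := fun _ _ _ _ _ hρ h =>
  have hD := isScalarStarAlgebra_commutant hρ h
  ⟨hD.nonempty_quaternion_algHom (two_lt_finrank_commutant hm hρ h),
    hD.surjective_quaternion_algHom⟩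

/-! ### Irreducible representations by matrices -/

section Columns

variable {m r : ℕ} {K : Type} [Ring K] [Algebra ℝ K]

@[simp] theorem colAct_apply (A : Matrix (Fin r) (Fin r) K) (v : Fin r → K) :
    colAct A v = A.mulVec v := rfl

/-- The real representation on columns given by a homomorphism into a matrix algebra. -/
def colRep (χ : Cl m →ₐ[ℝ] Matrix (Fin r) (Fin r) K) : Cl m →ₐ[ℝ] Module.End ℝ (Fin r → K) :=
  AlgHom.ofLinearMap
    { toFun := fun a => colAct (χ a)
      map_add' := fun a b => LinearMap.ext fun x => by simp [Matrix.add_mulVec]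
      map_smul' := fun c a => LinearMap.ext fun x => by simp [Matrix.smul_mulVec] }
    (LinearMap.ext fun x => by simp) (fun a b => LinearMap.ext fun x => by simp)

@[simp] theorem colRep_apply (χ : Cl m →ₐ[ℝ] Matrix (Fin r) (Fin r) K) (a : Cl m) :
    colRep χ a = colAct (χ a) := rfl

theorem isIrreducible_colRep {χ : Cl m →ₐ[ℝ] Matrix (Fin r) (Fin r) K} :
    IsIrreducible (colRep χ) ↔ IsIrreducibleRep χ := Iff.rfl

end Columns

section RightSpaces

variable {m : ℕ} {K : Type} [DivisionRing K] [Algebra ℝ K]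

theorem exists_colRep_of_smul_comm {E : Type*} [AddCommGroup E] [Module ℝ E] [Module Kᵐᵒᵖ E]
    [IsScalarTower ℝ Kᵐᵒᵖ E] [Module.Finite Kᵐᵒᵖ E] (ρ : Cl m →ₐ[ℝ] Module.End ℝ E)
    (hρ : ∀ a (q : Kᵐᵒᵖ) x, ρ a (q • x) = q • ρ a x) :
    ∃ (r : ℕ) (χ : Cl m →ₐ[ℝ] Matrix (Fin r) (Fin r) K) (f : E ≃ₗ[ℝ] (Fin r → K)),
      Intertwines ρ (colRep χ) f.toLinearMap := by
  let b := Module.finBasis Kᵐᵒᵖ E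
  let f : E ≃ₗ[ℝ] (Fin (Module.finrank Kᵐᵒᵖ E) → K) :=
    (b.equivFun.restrictScalars ℝ).trans
      (LinearEquiv.piCongrRight fun _ => (MulOpposite.opLinearEquiv ℝ).symm)
  have hf : ∀ x i, f x i = (b.repr x i).unop := fun _ _ => rfl
  have hkey : ∀ a x i, f (ρ a x) i = ∑ j, f (ρ a (b j)) i * f x j := by
    intro a x i
    have hx : ρ a x = ∑ j, b.repr x j • ρ a (b j) := by
      conv_lhs => rw [← b.sum_repr x]
      simp only [map_sum, hρ]
    rw [hf, hx, map_sum, Finsupp.finsetSum_apply, Finset.unop_sum]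
    refine Finset.sum_congr rfl fun j _ => ?_
    rw [map_smul, Finsupp.smul_apply, smul_eq_mul, MulOpposite.unop_mul, hf, hf]
  let χ : Cl m →ₐ[ℝ] Matrix (Fin (Module.finrank Kᵐᵒᵖ E)) (Fin (Module.finrank Kᵐᵒᵖ E)) K :=
    AlgHom.ofLinearMap
      { toFun := fun a => Matrix.of fun i j => f (ρ a (b j)) i
        map_add' := fun a b => by ext; simp
        map_smul' := fun c a => by ext; simp }
      (by
        ext i j
        have h : f (b j) i = (1 : Matrix _ _ K) i j := by
          rw [hf, b.repr_self, Finsupp.single_apply, Matrix.one_apply]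
          simp only [eq_comm (a := j), apply_ite MulOpposite.unop, MulOpposite.unop_one,
            MulOpposite.unop_zero]
        simpa using h)
      (fun a c => by
        ext i j
        simpa [Matrix.mul_apply] using hkey a (ρ c (b j)) i)
  exact ⟨_, χ, f, fun a x => funext fun i => hkey a x i⟩

theorem exists_isIrreducibleRep [StarRing K] [StarModule ℝ K] {E : Type*} [NormedAddCommGroup E]
    [InnerProductSpace ℝ E] [FiniteDimensional ℝ E] {ρ : Cl m →ₐ[ℝ] Module.End ℝ E}
    (hρ : IsSymmRep ρ) (h : IsIrreducible ρ) (l : K →ₐ[ℝ] commutant ρ) :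
    ∃ (r : ℕ) (χ : Cl m →ₐ[ℝ] Matrix (Fin r) (Fin r) K), IsIrreducibleRep χ := by
  let l' : K →ₐ[ℝ] Module.End ℝ E := (commutant ρ).toSubalgebra.val.comp l
  let _ : Module Kᵐᵒᵖ E :=
    Module.compHom E (l'.toRingHom.comp (starRingEquiv (R := K)).symm.toRingHom)
  have hsmul : ∀ (q : Kᵐᵒᵖ) (x : E), q • x = l' (star q.unop) x := fun _ _ => rfl
  have : IsScalarTower ℝ Kᵐᵒᵖ E := ⟨fun c q x => by simp [hsmul]⟩
  have : Module.Finite Kᵐᵒᵖ E := Module.Finite.of_restrictScalars_finite ℝ _ _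
  obtain ⟨r, χ, f, hf⟩ := exists_colRep_of_smul_comm ρ fun a q x => by
    rw [hsmul, hsmul]
    exact ((mem_commutant_iff hρ).1 (l (star q.unop)).2 a x).symm
  exact ⟨r, χ, isIrreducible_colRep.1 (h.of_equiv f hf)⟩

end RightSpaces

/-! ### Existence of intertwiners -/

section Average

variable {m : ℕ} {M M' : Type*} [AddCommGroup M] [Module ℝ M] [AddCommGroup M'] [Module ℝ M']
  {ρ : Cl m →ₐ[ℝ] Module.End ℝ M} {σ : Cl m →ₐ[ℝ] Module.End ℝ M'}

/-- The average of the rank one map `x ↦ φ x • w` over the group of the signed monomials, up to the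
order of the group; it intertwines the two representations. -/
def average (ρ : Cl m →ₐ[ℝ] Module.End ℝ M) (σ : Cl m →ₐ[ℝ] Module.End ℝ M') (φ : M →ₗ[ℝ] ℝ)
    (w : M') : M →ₗ[ℝ] M' :=
  ∑ I : Finset (Fin (m + 1)),
    (φ ∘ₗ ρ (CliffordAlgebra.reverse (monomial I))).smulRight (σ (monomial I) w)

theorem average_apply (φ : M →ₗ[ℝ] ℝ) (w : M') (x : M) : average ρ σ φ w x =
    ∑ I, φ (ρ (CliffordAlgebra.reverse (monomial I)) x) • σ (monomial I) w := by
  simp [average, LinearMap.sum_apply]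

theorem intertwines_average (φ : M →ₗ[ℝ] ℝ) (w : M') : Intertwines ρ σ (average ρ σ φ w) := by
  refine intertwines_of_adjoin_eq_top adjoin_range_stdGen ?_
  rintro _ ⟨i, rfl⟩ x
  let β : Cl m →ₗ[ℝ] Cl m →ₗ[ℝ] M' :=
    (LinearMap.lsmul ℝ M').compl₁₂
      (φ ∘ₗ (LinearMap.applyₗ (ρ (stdGen i) x)) ∘ₗ ρ.toLinearMap)
      ((LinearMap.applyₗ w) ∘ₗ σ.toLinearMap)
  have hβ : ∀ a b, β a b = φ (ρ a (ρ (stdGen i) x)) • σ b w := fun _ _ => rfl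
  have hsum := sum_stdGen_mul_monomial β i
  simp only [hβ] at hsum
  rw [average_apply, average_apply, ← hsum, map_sum]
  refine Finset.sum_congr rfl fun I _ => ?_
  rw [map_smul, ← Module.End.mul_apply (ρ _), ← map_mul, mul_assoc, stdGen_mul_self, mul_one,
    map_mul σ, Module.End.mul_apply]

theorem range_average_le {U : Submodule ℝ M'} (hU : IsInvariant σ U) (φ : M →ₗ[ℝ] ℝ) {w : M'}
    (hw : w ∈ U) : LinearMap.range (average ρ σ φ w) ≤ U := by
  rintro _ ⟨x, rfl⟩
  rw [average_apply]
  exact U.sum_mem fun I _ => U.smul_mem _ (hU _ _ hw)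

theorem sum_average_coord {ι : Type*} [Fintype ι] (b : Module.Basis ι ℝ M)
    (w : M') : ∑ k, average ρ σ (b.coord k) w (b k) =
      ∑ I : Finset (Fin (m + 1)),
        LinearMap.trace ℝ M (ρ (CliffordAlgebra.reverse (monomial I))) • σ (monomial I) w := by
  classical
  simp only [average_apply]
  rw [Finset.sum_comm]
  refine Finset.sum_congr rfl fun I _ => ?_
  rw [← Finset.sum_smul]
  congr 1
  simp [LinearMap.trace_eq_matrix_trace ℝ b, Matrix.trace, LinearMap.toMatrix_apply]

variable [FiniteDimensional ℝ M]

theorem finrank_smul_add_trace_smul_eq_zero {w : M'} (h : ∀ φ, average ρ σ φ w = 0) :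
    (Module.finrank ℝ M : ℝ) • w +
      (monomialSign (m + 1) * LinearMap.trace ℝ M (ρ (volumeElement m))) •
        σ (volumeElement m) w = 0 := by
  have hsum := sum_average_coord (ρ := ρ) (σ := σ) (Module.finBasis ℝ M) w
  have hne : (∅ : Finset (Fin (m + 1))) ≠ Finset.univ := Finset.univ_nonempty.ne_empty.symm
  simp only [h, LinearMap.zero_apply, Finset.sum_const_zero, reverse_monomial, map_smul,
    smul_eq_mul] at hsum
  rw [← Finset.sum_subset (Finset.subset_univ {∅, Finset.univ}), Finset.sum_pair hne] at hsum
  · simpa [monomialSign, volumeElement] using hsum.symm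
  · intro I _ hI
    simp only [Finset.mem_insert, Finset.mem_singleton, not_or] at hI
    rw [trace_monomial ρ hI.1 fun h => hI.2 h.1, mul_zero, zero_smul]

variable [Nontrivial M] {w : M'}

theorem exists_average_ne_zero_of_odd (hm : Odd m) (hw : w ≠ 0) : ∃ φ, average ρ σ φ w ≠ 0 := by
  by_contra! hzero
  have hsum := finrank_smul_add_trace_smul_eq_zero hzero
  rw [volumeElement, trace_monomial ρ Finset.univ_nonempty.ne_empty
    fun h => Nat.not_even_iff_odd.2 hm h.2, mul_zero, zero_smul, add_zero] at hsum
  exact smul_ne_zero (Nat.cast_ne_zero.2 Module.finrank_pos.ne') hw hsum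

theorem exists_average_ne_zero_of_mod_four_eq_two (hm : m % 4 = 2) (hw : w ≠ 0) :
    ∃ φ, average ρ σ φ w ≠ 0 := by
  by_contra! hzero
  have hsum := finrank_smul_add_trace_smul_eq_zero hzero
  set d : ℝ := (Module.finrank ℝ M : ℝ)
  set c : ℝ := monomialSign (m + 1) * LinearMap.trace ℝ M (ρ (volumeElement m))
  have hd : 0 < d := Nat.cast_pos.2 Module.finrank_pos
  have hvol : σ (volumeElement m) (σ (volumeElement m) w) = -w := by
    rw [← Module.End.mul_apply, ← map_mul, volumeElement_mul_self,
      monomialSign_succ_of_even (Nat.even_iff.2 (by lia)), if_neg (by lia), map_smul, map_one,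
      neg_one_smul, LinearMap.neg_apply, Module.End.one_apply]
  have hsum' : d • σ (volumeElement m) w - c • w = 0 := by
    simpa [hvol, sub_eq_add_neg] using congrArg (σ (volumeElement m)) hsum
  have hnorm : (d * d + c * c) • w = 0 := by
    calc (d * d + c * c) • w = d • (d • w + c • σ (volumeElement m) w) -
          c • (d • σ (volumeElement m) w - c • w) := by module
      _ = 0 := by rw [hsum, hsum', smul_zero, smul_zero, sub_zero]
  exact smul_ne_zero (add_pos_of_pos_of_nonneg (mul_pos hd hd) (mul_self_nonneg c)).ne' hw hnorm

theorem exists_average_ne_zero_of_volumeElement_eq (hm : m % 4 = 0) {s : ℝ}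
    (hρ : ∀ x, ρ (volumeElement m) x = s • x) (hσ : σ (volumeElement m) w = s • w) (hw : w ≠ 0) :
    ∃ φ, average ρ σ φ w ≠ 0 := by
  by_contra! hzero
  have hsum := finrank_smul_add_trace_smul_eq_zero hzero
  have hd : (0 : ℝ) < Module.finrank ℝ M := Nat.cast_pos.2 Module.finrank_pos
  have hscalar : ρ (volumeElement m) = s • 1 := LinearMap.ext fun x => by simp [hρ]
  rw [monomialSign_succ_of_even (Nat.even_iff.2 (by lia)), if_pos hm, hscalar, hσ, map_smul,
    LinearMap.trace_one, smul_eq_mul, one_mul, smul_smul, ← add_smul] at hsum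
  rw [mul_right_comm] at hsum
  exact smul_ne_zero
    (add_pos_of_pos_of_nonneg hd (mul_nonneg (mul_self_nonneg s) hd.le)).ne' hw hsum

end Average

theorem IsIrreducible.exists_volumeElement_eq_smul {m : ℕ} {M : Type*} [AddCommGroup M] [Module ℝ M]
    {ρ : Cl m →ₐ[ℝ] Module.End ℝ M} (h : IsIrreducible ρ) (hm : m % 4 = 0) :
    ∃ s : ℝ, s * s = 1 ∧ ∀ x, ρ (volumeElement m) x = s • x := by
  have he : Even m := Nat.even_iff.2 (by lia)
  have hsq : ∀ x, ρ (volumeElement m) (ρ (volumeElement m) x) = x := fun x => by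
    rw [← Module.End.mul_apply, ← map_mul, volumeElement_mul_self, monomialSign_succ_of_even he,
      if_pos hm, one_smul, map_one, Module.End.one_apply]
  have hint : Intertwines ρ ρ (ρ (volumeElement m) - 1) := fun a x => by
    simp only [LinearMap.sub_apply, map_sub, Module.End.one_apply]
    rw [← Module.End.mul_apply, ← Module.End.mul_apply, ← map_mul, ← map_mul,
      (commute_volumeElement he a).eq]
  rcases h.2 _ hint.isInvariant_ker with hker | hker
  · refine ⟨-1, by norm_num, fun x => ?_⟩
    have hx : ρ (volumeElement m) x + x ∈ LinearMap.ker (ρ (volumeElement m) - 1) := by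
      rw [LinearMap.mem_ker, LinearMap.sub_apply, Module.End.one_apply, map_add, hsq]
      abel
    rw [hker, Submodule.mem_bot] at hx
    rw [neg_one_smul]
    exact eq_neg_of_add_eq_zero_left hx
  · refine ⟨1, by norm_num, fun x => ?_⟩
    rw [one_smul, ← sub_eq_zero, ← Module.End.one_apply (R := ℝ) x]
    exact LinearMap.congr_fun (LinearMap.ker_eq_top.1 hker) x

/-! ### Orthogonal decomposition into irreducible subspaces -/

section Decomposition

variable {m : ℕ} {E M : Type*} [NormedAddCommGroup E] [InnerProductSpace ℝ E] [AddCommGroup M]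
  [Module ℝ M] {ρ : Cl m →ₐ[ℝ] Module.End ℝ M} {σ : Cl m →ₐ[ℝ] Module.End ℝ E} {j₀ : M →ₗ[ℝ] E}

theorem exists_smul_inner_eq {T : M →ₗ[ℝ] E} (hT : T ≠ 0) {c : ℝ}
    (hc : ∀ x y, inner ℝ (T x) (T y) = c * inner ℝ (j₀ x) (j₀ y)) :
    ∃ t : ℝ, t ≠ 0 ∧ ∀ x y, inner ℝ ((t • T) x) ((t • T) y) = inner ℝ (j₀ x) (j₀ y) := by
  obtain ⟨x₀, hx₀⟩ : ∃ x, T x ≠ 0 := by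
    by_contra! hzero
    exact hT (LinearMap.ext hzero)
  have hpos : 0 < c := pos_of_mul_pos_left (hc x₀ x₀ ▸ real_inner_self_pos.2 hx₀)
    real_inner_self_nonneg
  refine ⟨(√c)⁻¹, inv_ne_zero (Real.sqrt_pos.2 hpos).ne', fun x y => ?_⟩
  simp only [LinearMap.smul_apply, real_inner_smul_left, real_inner_smul_right, hc]
  rw [← mul_assoc, ← mul_assoc, ← mul_inv, Real.mul_self_sqrt hpos.le, inv_mul_cancel₀ hpos.ne',
    one_mul]

theorem iSup_range_cons {k : ℕ} (T : M →ₗ[ℝ] E) (j : Fin k → M →ₗ[ℝ] E) :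
    ⨆ a, LinearMap.range ((Fin.cons T j : Fin (k + 1) → M →ₗ[ℝ] E) a) =
      LinearMap.range T ⊔ ⨆ a, LinearMap.range (j a) := by
  refine eq_of_forall_ge_iff fun W => ?_
  rw [sup_le_iff, iSup_le_iff, iSup_le_iff, Fin.forall_fin_succ]
  rfl

theorem inner_cons_eq_ite {k : ℕ} {T : M →ₗ[ℝ] E} {j : Fin k → M →ₗ[ℝ] E}
    (hT : ∀ x y, inner ℝ (T x) (T y) = inner ℝ (j₀ x) (j₀ y))
    (hj : ∀ a b x y, inner ℝ (j a x) (j b y) = if a = b then inner ℝ (j₀ x) (j₀ y) else 0)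
    (horth : ∀ a x y, inner ℝ (T x) (j a y) = 0) (a b : Fin (k + 1)) (x y : M) :
    inner ℝ ((Fin.cons T j : Fin (k + 1) → M →ₗ[ℝ] E) a x)
      ((Fin.cons T j : Fin (k + 1) → M →ₗ[ℝ] E) b y) =
      if a = b then inner ℝ (j₀ x) (j₀ y) else 0 := by
  refine Fin.cases ?_ (fun a => ?_) a <;> refine Fin.cases ?_ (fun b => ?_) b
  · simp [hT]
  · simp [horth, (Fin.succ_ne_zero b).symm]
  · rw [real_inner_comm]
    simp [horth]
  · simp [hj]

theorem IsSymmRep.exists_orthogonal_intertwiners [FiniteDimensional ℝ E] (hσ : IsSymmRep σ)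
    (hscale : ∀ T, Intertwines ρ σ T → ∃ c : ℝ, ∀ x y,
      inner ℝ (T x) (T y) = c * inner ℝ (j₀ x) (j₀ y)) (U : Submodule ℝ E) (hU : IsInvariant σ U)
    (hex : ∀ W ≤ U, IsInvariant σ W → W ≠ ⊥ →
      ∃ T : M →ₗ[ℝ] E, Intertwines ρ σ T ∧ T ≠ 0 ∧ LinearMap.range T ≤ W) :
    ∃ (k : ℕ) (j : Fin k → M →ₗ[ℝ] E), (∀ a, Intertwines ρ σ (j a)) ∧
      (∀ a b x y, inner ℝ (j a x) (j b y) = if a = b then inner ℝ (j₀ x) (j₀ y) else 0) ∧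
      ⨆ a, LinearMap.range (j a) = U := by
  induction hn : Module.finrank ℝ U using Nat.strong_induction_on generalizing U with
  | _ n ih =>
    by_cases hU0 : U = ⊥
    · exact ⟨0, Fin.elim0, fun a => a.elim0, fun a => a.elim0, by simp [hU0]⟩
    obtain ⟨T, hT, hT0, hTU⟩ := hex U le_rfl hU hU0
    obtain ⟨c, hc⟩ := hscale T hT
    obtain ⟨t, ht, hinner⟩ := exists_smul_inner_eq hT0 hc
    have hrange : LinearMap.range (t • T) = LinearMap.range T := LinearMap.range_smul T t ht
    let W := (LinearMap.range T)ᗮ ⊓ U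
    have hW : IsInvariant σ W := fun a w hw =>
      ⟨hσ.isInvariant_orthogonal hT.isInvariant_range a w hw.1, hU a w hw.2⟩
    have hlt : W < U := lt_of_le_of_ne inf_le_right fun h =>
      hT0 (LinearMap.range_eq_bot.1 ((Submodule.isOrtho_self).1
        (Submodule.isOrtho_iff_le.2 (hTU.trans (h ▸ inf_le_left)))))
    obtain ⟨k, j, hj, hjj, hsup⟩ := ih _ (hn ▸ Submodule.finrank_lt_finrank_of_lt hlt) W hW
      (fun W' hW' => hex W' (hW'.trans hlt.le)) rfl
    have horth : ∀ a x y, inner ℝ ((t • T) x) (j a y) = 0 := fun a x y =>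
      (Submodule.mem_orthogonal _ _).1 (hsup ▸ Submodule.mem_iSup_of_mem a ⟨y, rfl⟩ : j a y ∈ W).1 _
        (hrange ▸ ⟨x, rfl⟩)
    refine ⟨k + 1, Fin.cons (t • T) j, ?_, inner_cons_eq_ite hinner hjj horth, ?_⟩
    · exact Fin.cases (fun a x => by simp [hT a x]) hj
    · rw [iSup_range_cons, hsup, hrange]
      exact Submodule.sup_orthogonal_inf_of_hasOrthogonalProjection hTU

end Decomposition

/-! ### The pin group -/

section PinGroup

variable {m : ℕ}

theorem stdForm_eq_zero {v : Fin (m + 1) → ℝ} (h : stdForm m v = 0) : v = 0 := by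
  rw [stdForm_apply, Finset.sum_eq_zero_iff_of_nonneg fun i _ => sq_nonneg _] at h
  ext i
  simpa using h i (Finset.mem_univ i)

theorem ι_mul_ι_self {v : Fin (m + 1) → ℝ} (h : stdForm m v = 1) :
    CliffordAlgebra.ι (stdForm m) v * CliffordAlgebra.ι (stdForm m) v = 1 := by
  rw [CliffordAlgebra.ι_sq_scalar, h, map_one]

/-- A unit vector as a unit of the Clifford algebra, equal to its own inverse. -/
@[simps] def unitVector (v : Fin (m + 1) → ℝ) (h : stdForm m v = 1) : (Cl m)ˣ where
  val := CliffordAlgebra.ι (stdForm m) v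
  inv := CliffordAlgebra.ι (stdForm m) v
  val_inv := ι_mul_ι_self h
  inv_val := ι_mul_ι_self h

theorem unitVector_mem_pin (v : Fin (m + 1) → ℝ) (h : stdForm m v = 1) : unitVector v h ∈ Pin m :=
  Subgroup.subset_closure ⟨v, h, rfl⟩

theorem pin_induction {p : ∀ u : (Cl m)ˣ, u ∈ Pin m → Prop} (one : p 1 (Pin m).one_mem)
    (mul : ∀ v h u (hu : u ∈ Pin m), p u hu →
      p (unitVector v h * u) ((Pin m).mul_mem (unitVector_mem_pin v h) hu))
    {u : (Cl m)ˣ} (hu : u ∈ Pin m) : p u hu := by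
  refine Subgroup.closure_induction_left (p := p) one ?_ ?_ hu
  · rintro x ⟨v, h, hx⟩ y hy hp
    obtain rfl : x = unitVector v h := Units.ext hx
    exact mul v h y hy hp
  · rintro x ⟨v, h, hx⟩ y hy hp
    obtain rfl : x = unitVector v h := Units.ext hx
    exact mul v h y hy hp

theorem exists_conj_ι_eq_ι {u : (Cl m)ˣ} (hu : u ∈ Pin m) (w : Fin (m + 1) → ℝ) :
    ∃ w', (u : Cl m) * CliffordAlgebra.ι (stdForm m) w * (u⁻¹ : (Cl m)ˣ) =
      CliffordAlgebra.ι (stdForm m) w' := by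
  induction hu using pin_induction with
  | one => exact ⟨w, by simp⟩
  | mul v h u _ ih =>
    obtain ⟨w', hw'⟩ := ih
    refine ⟨QuadraticMap.polar (stdForm m) v w' • v - stdForm m v • w', ?_⟩
    rw [← CliffordAlgebra.ι_mul_ι_mul_ι, ← hw']
    simp [mul_assoc]

theorem involute_eq_or_eq_neg_of_mem_pin {u : (Cl m)ˣ} (hu : u ∈ Pin m) :
    CliffordAlgebra.involute (u : Cl m) = u ∨ CliffordAlgebra.involute (u : Cl m) = -u := by
  induction hu using pin_induction with
  | one => left; simp
  | mul v h u _ ih =>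
    rw [Units.val_mul, map_mul, val_unitVector, CliffordAlgebra.involute_ι]
    rcases ih with ih | ih <;> simp [ih]

theorem reverse_mul_self_of_mem_pin {u : (Cl m)ˣ} (hu : u ∈ Pin m) :
    CliffordAlgebra.reverse (u : Cl m) * u = 1 := by
  induction hu using pin_induction with
  | one => simp
  | mul v h u _ ih =>
    rw [Units.val_mul, CliffordAlgebra.reverse.map_mul, val_unitVector, CliffordAlgebra.reverse_ι,
      mul_assoc, ← mul_assoc (CliffordAlgebra.ι (stdForm m) v), ι_mul_ι_self h, one_mul, ih]

theorem mem_span_one_of_forall_commute {x : Cl m} (h : ∀ a, Commute a x)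
    (hx : CliffordAlgebra.involute x = x) : x ∈ Submodule.span ℝ {(1 : Cl m)} := by
  have hmem : x ∈ (Submodule.span ℝ {(1 : Cl m)}).comap
      (LinearMap.id + CliffordAlgebra.involute.toLinearMap) := by
    refine mem_of_forall_commute h ?_ fun he => ?_
    · simp [← two_smul ℝ (1 : Cl m), Submodule.mem_span_singleton_self]
    · simp [involute_volumeElement he]
  have h2 : (2 : ℝ) • x ∈ Submodule.span ℝ {(1 : Cl m)} := by simpa [hx, two_smul] using hmem
  exact (Submodule.smul_mem_iff _ two_ne_zero).1 h2

theorem mem_span_volumeElement_of_forall_commute {x : Cl m} (h : ∀ a, Commute a x)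
    (hx : CliffordAlgebra.involute x = -x) : x ∈ Submodule.span ℝ {volumeElement m} := by
  have hmem : x ∈ (Submodule.span ℝ {volumeElement m}).comap
      (LinearMap.id - CliffordAlgebra.involute.toLinearMap) := by
    refine mem_of_forall_commute h (by simp) fun he => ?_
    simp [involute_volumeElement he, ← two_smul ℝ (volumeElement m),
      Submodule.mem_span_singleton_self]
  have h2 : (2 : ℝ) • x ∈ Submodule.span ℝ {volumeElement m} := by
    simpa [hx, two_smul] using hmem
  exact (Submodule.smul_mem_iff _ two_ne_zero).1 h2

theorem eq_or_eq_neg_of_mem_pin_of_mem_span {u : (Cl m)ˣ} (hu : u ∈ Pin m) {x : Cl m}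
    (hx : CliffordAlgebra.reverse x * x = 1) (hux : (u : Cl m) ∈ Submodule.span ℝ {x}) :
    (u : Cl m) = x ∨ (u : Cl m) = -x := by
  obtain ⟨c, hc⟩ := Submodule.mem_span_singleton.1 hux
  have h := reverse_mul_self_of_mem_pin hu
  rw [← hc, map_smul, smul_mul_smul_comm, hx, ← Algebra.algebraMap_eq_smul_one,
    ← map_one (algebraMap ℝ (Cl m))] at h
  rcases mul_self_eq_one_iff.1 ((algebraMap ℝ (Cl m)).injective h) with rfl | rfl
  · exact Or.inl (by rw [← hc, one_smul])
  · exact Or.inr (by rw [← hc, neg_one_smul])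

theorem finite_center_pin : {u : (Cl m)ˣ | u ∈ Pin m ∧ ∀ a : Cl m, Commute a u}.Finite := by
  have hfin : ({1, -1, volumeElement m, -volumeElement m} : Set (Cl m)).Finite := by simp
  refine (hfin.preimage Units.val_injective.injOn).subset ?_
  rintro u ⟨hu, hc⟩
  rcases involute_eq_or_eq_neg_of_mem_pin hu with h | h
  · rcases eq_or_eq_neg_of_mem_pin_of_mem_span hu (by simp)
      (mem_span_one_of_forall_commute hc h) with h' | h' <;> simp [h']
  · rcases eq_or_eq_neg_of_mem_pin_of_mem_span hu (reverse_monomial_mul_self Finset.univ)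
      (mem_span_volumeElement_of_forall_commute hc h) with h' | h' <;> simp [h', volumeElement]

end PinGroup

/-- The isometry given by a norm preserving endomorphism of a finite dimensional space. -/
def isometryOfNorm {E : Type*} [NormedAddCommGroup E] [InnerProductSpace ℝ E]
    [FiniteDimensional ℝ E] (f : Module.End ℝ E) (hf : ∀ x, ‖f x‖ = ‖x‖) : E ≃ₗᵢ[ℝ] E :=
  (LinearIsometry.mk f hf).toLinearIsometryEquiv rfl

@[simp] theorem isometryOfNorm_apply {E : Type*} [NormedAddCommGroup E] [InnerProductSpace ℝ E]
    [FiniteDimensional ℝ E] (f : Module.End ℝ E) (hf : ∀ x, ‖f x‖ = ‖x‖) (x : E) :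
    isometryOfNorm f hf x = f x := rfl

namespace CliffordSystem

variable {m n : ℕ} (C : CliffordSystem m n)

theorem rep_ι (v : Fin (m + 1) → ℝ) : C.rep (CliffordAlgebra.ι (stdForm m) v) = C.gen v :=
  CliffordAlgebra.lift_ι_apply ..

theorem gen_apply (v : Fin (m + 1) → ℝ) : C.gen v = ∑ i, v i • C.P i :=
  Fintype.linearCombination_apply ..

theorem rep_stdGen (i : Fin (m + 1)) : C.rep (stdGen i) = C.P i := by
  rw [stdGen, rep_ι, gen, Fintype.linearCombination_apply_single, one_smul]

theorem isSymmetric_gen (v : Fin (m + 1) → ℝ) : (C.gen v).IsSymmetric := by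
  intro x y
  simp only [gen_apply, LinearMap.sum_apply, LinearMap.smul_apply, sum_inner, inner_sum,
    inner_smul_left, inner_smul_right, conj_trivial]
  exact Finset.sum_congr rfl fun i _ => by rw [C.symm i x y]

theorem isSymmRep : IsSymmRep C.rep := fun i => by rw [rep_stdGen]; exact C.symm i

theorem gen_gen (v : Fin (m + 1) → ℝ) (x : V n) : C.gen v (C.gen v x) = stdForm m v • x := by
  rw [← Module.End.mul_apply, gen_mul_self, Module.algebraMap_end_apply]

theorem norm_gen {v : Fin (m + 1) → ℝ} (h : stdForm m v = 1) (x : V n) : ‖C.gen v x‖ = ‖x‖ := by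
  rw [← sq_eq_sq₀ (norm_nonneg _) (norm_nonneg _), ← real_inner_self_eq_norm_sq,
    ← real_inner_self_eq_norm_sq, C.isSymmetric_gen v, C.gen_gen, h, one_smul]

theorem gen_injective : Function.Injective C.gen := by
  rw [injective_iff_map_eq_zero]
  intro v hv
  obtain ⟨x, hx⟩ := exists_ne (0 : V n)
  have h := C.gen_gen v x
  rw [hv, LinearMap.zero_apply] at h
  exact stdForm_eq_zero ((smul_eq_zero.1 h.symm).resolve_right hx)

theorem norm_rep_of_mem_pin {u : (Cl m)ˣ} (hu : u ∈ Pin m) (x : V n) :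
    ‖C.rep (u : Cl m) x‖ = ‖x‖ := by
  induction hu using pin_induction with
  | one => simp
  | mul v h u _ ih =>
    rw [Units.val_mul, map_mul, Module.End.mul_apply, val_unitVector, rep_ι, C.norm_gen h, ih]

/-- The representation `χ_𝒫` as a homomorphism `Pin(m+1) → O(V)`. -/
def pinHom : Pin m →* OV n where
  toFun u := isometryOfNorm (C.rep (u : (Cl m)ˣ)) (C.norm_rep_of_mem_pin u.2)
  map_one' := by ext1 x; simp
  map_mul' u v := by ext1 x; simp

theorem range_pinHom_comp_inclusion {L : Subgroup (Cl m)ˣ} (hL : L ≤ Pin m) :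
    (C.pinHom.comp (Subgroup.inclusion hL)).range = C.image L := by
  ext A
  constructor
  · rintro ⟨u, rfl⟩
    exact ⟨u, u.2, fun x => rfl⟩
  · rintro ⟨u, hu, h⟩
    exact ⟨⟨u, hu⟩, LinearIsometryEquiv.ext fun x => (h x).symm⟩

theorem mem_uPlus_iff {U : OV n} :
    U ∈ C.uPlus ↔ Intertwines C.rep C.rep (U.toLinearEquiv : V n →ₗ[ℝ] V n) := by
  constructor
  · refine fun h => intertwines_of_adjoin_eq_top adjoin_range_stdGen ?_
    rintro _ ⟨i, rfl⟩ x
    rw [rep_stdGen]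
    exact (h _ (Submodule.subset_span ⟨i, rfl⟩) x).symm
  · intro h Q hQ x
    induction hQ using Submodule.span_induction with
    | mem Q hQ =>
      obtain ⟨i, rfl⟩ := hQ
      rw [← rep_stdGen]
      exact (h (stdGen i) x).symm
    | zero => simp
    | add Q R _ _ hQ hR => simp [hQ, hR]
    | smul c Q _ hQ => simp [hQ]

/-- The representation itself need not be faithful, but it is injective on vectors, and
conjugation by `u` maps vectors to vectors. -/
theorem commute_of_mem_pin_of_intertwines {u : (Cl m)ˣ} (hu : u ∈ Pin m)
    (h : Intertwines C.rep C.rep (C.rep (u : Cl m))) (a : Cl m) : Commute a u := by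
  refine commute_of_commute_stdGen (fun i => ?_) a
  obtain ⟨w, hw⟩ := exists_conj_ι_eq_ι hu (Pi.single i 1)
  have hrep : C.rep (u : Cl m) * C.rep (stdGen i) = C.rep (stdGen i) * C.rep (u : Cl m) :=
    LinearMap.ext fun x => h (stdGen i) x
  have hgen : C.gen w = C.gen (Pi.single i 1) := by
    calc C.gen w = C.rep (u : Cl m) * C.rep (stdGen i) * C.rep (u⁻¹ : (Cl m)ˣ) := by
          rw [← rep_ι, ← hw, map_mul, map_mul, stdGen]
      _ = C.rep (stdGen i) := by rw [hrep, mul_assoc, ← map_mul, Units.mul_inv, map_one, mul_one]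
      _ = C.gen (Pi.single i 1) := by rw [stdGen, rep_ι]
  rw [C.gen_injective hgen, Units.mul_inv_eq_iff_eq_mul] at hw
  exact hw.symm

theorem finite_pin_intertwines :
    {u : (Cl m)ˣ | u ∈ Pin m ∧ Intertwines C.rep C.rep (C.rep (u : Cl m))}.Finite :=
  finite_center_pin.subset fun _ hu => ⟨hu.1, C.commute_of_mem_pin_of_intertwines hu.1 hu.2⟩

end CliffordSystem

/-! ### Right multiplication by scalars, and twisted representations -/

section RightMultiplication

variable {K : Type} [Ring K] [Algebra ℝ K] {r : ℕ}

theorem colAct_smul (A : Matrix (Fin r) (Fin r) K) (q : Kᵐᵒᵖ) (v : Fin r → K) :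
    colAct A (q • v) = q • colAct A v :=
  Matrix.mulVec_smul A q v

/-- `K` acts on columns from the left, `q` by right multiplication with `star q`. -/
def rmulStar [StarRing K] [StarModule ℝ K] : K →ₐ[ℝ] Module.End ℝ (Fin r → K) :=
  (Algebra.lsmul ℝ ℝ (Fin r → K)).comp <|
    AlgEquiv.toAlgHom <| AlgEquiv.ofRingEquiv (f := starRingEquiv) fun c =>
      congrArg MulOpposite.op (algebraMap_star_comm c).symm

theorem rmulStar_apply [StarRing K] [StarModule ℝ K] (q : K) (v : Fin r → K) :
    rmulStar q v = MulOpposite.op (star q) • v := rfl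

end RightMultiplication

section Twist

variable {m : ℕ} {M M' : Type*} [AddCommGroup M] [Module ℝ M] [AddCommGroup M'] [Module ℝ M']
  {ρ : Cl m →ₐ[ℝ] Module.End ℝ M} {σ : Cl m →ₐ[ℝ] Module.End ℝ M'}

/-- The composition of a representation with the automorphism `α` of the Clifford algebra that
extends `-1`; compare `twist`, which is this construction for matrices. -/
def twistRep (ρ : Cl m →ₐ[ℝ] Module.End ℝ M) : Cl m →ₐ[ℝ] Module.End ℝ M :=
  ρ.comp CliffordAlgebra.involute

theorem twistRep_apply (ρ : Cl m →ₐ[ℝ] Module.End ℝ M) (a : Cl m) :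
    twistRep ρ a = ρ (CliffordAlgebra.involute a) := rfl

theorem twistRep_volumeElement (ρ : Cl m →ₐ[ℝ] Module.End ℝ M) (hm : Even m) :
    twistRep ρ (volumeElement m) = -ρ (volumeElement m) := by
  rw [twistRep_apply, involute_volumeElement hm, map_neg]

theorem Intertwines.twist_right {T : M →ₗ[ℝ] M'} (h : Intertwines (twistRep ρ) σ T) :
    Intertwines ρ (twistRep σ) T := by
  intro a x
  have := h (CliffordAlgebra.involute a) x
  rwa [twistRep_apply, CliffordAlgebra.involute_involute] at this

theorem Intertwines.twist {T : M →ₗ[ℝ] M'} (h : Intertwines ρ σ T) :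
    Intertwines (twistRep ρ) (twistRep σ) T :=
  fun a x => h (CliffordAlgebra.involute a) x

theorem IsSymmRep.twist {E : Type*} [NormedAddCommGroup E] [InnerProductSpace ℝ E]
    {ρ : Cl m →ₐ[ℝ] Module.End ℝ E} (h : IsSymmRep ρ) : IsSymmRep (twistRep ρ) := by
  intro i x y
  rw [twistRep_apply, involute_stdGen, map_neg, LinearMap.neg_apply, LinearMap.neg_apply,
    inner_neg_left, inner_neg_right, h i]

theorem IsIrreducible.twist (h : IsIrreducible ρ) : IsIrreducible (twistRep ρ) := by
  refine ⟨h.1, fun W hW => h.2 W fun a w hw => ?_⟩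
  have := hW (CliffordAlgebra.involute a) w hw
  rwa [twistRep_apply, CliffordAlgebra.involute_involute] at this

variable {K : Type} [Ring K] [Algebra ℝ K] {r : ℕ}

theorem colRep_twist (χ : Cl m →ₐ[ℝ] Matrix (Fin r) (Fin r) K) :
    colRep (twist χ) = twistRep (colRep χ) := rfl

theorem twist_twist (χ : Cl m →ₐ[ℝ] Matrix (Fin r) (Fin r) K) : twist (twist χ) = χ :=
  AlgHom.ext fun a => by simp [twist]

theorem IsIrreducibleRep.twist {χ : Cl m →ₐ[ℝ] Matrix (Fin r) (Fin r) K}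
    (h : IsIrreducibleRep χ) : IsIrreducibleRep (twist χ) :=
  isIrreducible_colRep.1 (isIrreducible_colRep.2 h).twist

end Twist

/-! ### Isotypic decompositions -/

section Schur

variable {k A M M' : Type*} [Field k] [Ring A] [Algebra k A] [AddCommGroup M] [Module k M]
  [AddCommGroup M'] [Module k M'] {ρ : A →ₐ[k] Module.End k M} {σ : A →ₐ[k] Module.End k M'}

theorem Intertwines.symm {f : M ≃ₗ[k] M'} (hf : Intertwines ρ σ f.toLinearMap) :
    Intertwines σ ρ f.symm.toLinearMap := by
  intro a x
  have h := hf a (f.symm x)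
  simp only [LinearEquiv.coe_coe, LinearEquiv.apply_symm_apply] at h
  simp [← h]

theorem Intertwines.ofInjective {j : M →ₗ[k] M'} (hj : Intertwines ρ σ j)
    (hinj : Function.Injective j) :
    Intertwines ρ (subRep σ (LinearMap.range j) hj.isInvariant_range)
      (LinearEquiv.ofInjective j hinj).toLinearMap :=
  fun a x => Subtype.ext (hj a x)

theorem Intertwines.eq_zero_of_smul_ne {T : M →ₗ[k] M'} (hT : Intertwines ρ σ T) {a : A} {s t : k}
    (hst : s ≠ t) (hρ : ∀ x, ρ a x = s • x) (hσ : ∀ y, σ a y = t • y) : T = 0 := by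
  ext x
  have h := hT a x
  rw [hρ, hσ, map_smul, ← sub_eq_zero, ← sub_smul] at h
  exact (smul_eq_zero.1 h).resolve_left (sub_ne_zero.2 hst)

theorem isInvariant_eigenspace (ρ : A →ₐ[k] Module.End k M) {z : A} (hz : ∀ a, Commute a z)
    (t : k) : IsInvariant ρ (Module.End.eigenspace (ρ z) t) := by
  intro a w hw
  rw [Module.End.mem_eigenspace_iff] at hw ⊢
  rw [← Module.End.mul_apply, ← map_mul, ← (hz a).eq, map_mul, Module.End.mul_apply, hw, map_smul]

theorem eigenspace_sup_eigenspace_neg [CharZero k] {f : Module.End k M} (hf : f * f = 1) {s : k}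
    (hs : s * s = 1) : Module.End.eigenspace f s ⊔ Module.End.eigenspace f (-s) = ⊤ := by
  have hmem : ∀ t : k, t * t = 1 → ∀ w, w + t • f w ∈ Module.End.eigenspace f t := by
    intro t ht w
    rw [Module.End.mem_eigenspace_iff, map_add, map_smul, ← Module.End.mul_apply, hf, smul_add,
      smul_smul, ht, one_smul, Module.End.one_apply, add_comm]
  refine eq_top_iff.2 fun w _ => ?_
  have hw : w = (1 / 2 : k) • (w + s • f w) + (1 / 2 : k) • (w + (-s) • f w) := by module
  rw [hw]
  exact Submodule.add_mem_sup (Submodule.smul_mem _ _ (hmem s hs w))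
    (Submodule.smul_mem _ _ (hmem (-s) (by rw [neg_mul_neg, hs]) w))

end Schur

section InvariantForm

variable {m : ℕ} {M E F : Type*} [AddCommGroup M] [Module ℝ M] [NormedAddCommGroup E]
  [InnerProductSpace ℝ E] [FiniteDimensional ℝ E] [NormedAddCommGroup F] [InnerProductSpace ℝ F]
  [FiniteDimensional ℝ F] {ρ : Cl m →ₐ[ℝ] Module.End ℝ M} {σ : Cl m →ₐ[ℝ] Module.End ℝ E}
  {τ : Cl m →ₐ[ℝ] Module.End ℝ F}

theorem IsIrreducible.exists_inner_eq_mul_inner (h : IsIrreducible ρ) (hσ : IsSymmRep σ)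
    (hτ : IsSymmRep τ) {j : M →ₗ[ℝ] E} (hj : Intertwines ρ σ j) (hj0 : j ≠ 0) {T : M →ₗ[ℝ] F}
    (hT : Intertwines ρ τ T) :
    ∃ c : ℝ, ∀ x y, inner ℝ (T x) (T y) = c * inner ℝ (j x) (j y) := by
  have hinj := h.injective hj hj0
  let f := LinearEquiv.ofInjective j hinj
  have hf := hj.ofInjective hinj
  have hsymm := hσ.subRep hj.isInvariant_range
  let S := T ∘ₗ f.symm.toLinearMap
  have hS := hT.comp hf.symm
  obtain ⟨c, hc⟩ := (h.of_equiv f hf).exists_eq_algebraMap (T := LinearMap.adjoint S ∘ₗ S)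
    (LinearMap.isSymmetric_adjoint_comp_self S) ((hS.adjoint hsymm hτ).comp hS)
  have hSf : ∀ x, S (f x) = T x := fun x => by simp [S]
  have hadj : ∀ x, LinearMap.adjoint S (S (f x)) = c • f x := fun x => LinearMap.congr_fun hc (f x)
  refine ⟨c, fun x y => ?_⟩
  rw [← hSf, ← hSf, ← LinearMap.adjoint_inner_left, hadj, real_inner_smul_left]
  rfl

end InvariantForm

section UnitaryEmbedding

variable {m r : ℕ} {K : Type} [DivisionRing K] [StarRing K] [Algebra ℝ K] {E : Type}
  [NormedAddCommGroup E] [InnerProductSpace ℝ E] {χ : Cl m →ₐ[ℝ] Matrix (Fin r) (Fin r) K}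
  {σ : Cl m →ₐ[ℝ] Module.End ℝ E} {j : (Fin r → K) →ₗ[ℝ] E}

/-- The inner product that the embedding `j` induces on `K^r` serves for all the representations in
question: right multiplication by `star q` is the adjoint of right multiplication by `q` (written as
an action of `Kᵐᵒᵖ`), the intertwiners of `χ` are the right multiplications, and every copy of `χ`
or of its twist in `σ` carries a multiple of this inner product. -/
structure IsUnitaryEmbedding (χ : Cl m →ₐ[ℝ] Matrix (Fin r) (Fin r) K)
    (σ : Cl m →ₐ[ℝ] Module.End ℝ E) (j : (Fin r → K) →ₗ[ℝ] E) : Prop where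
  injective : Function.Injective j
  inner_smul : ∀ (q : Kᵐᵒᵖ) x y, inner ℝ (j (q • x)) (j y) = inner ℝ (j x) (j (star q • y))
  exists_eq_smul : ∀ T, Intertwines (colRep χ) (colRep χ) T →
    ∃ q : Kᵐᵒᵖ, ∀ x, T x = q • x
  exists_inner_eq : ∀ T, Intertwines (colRep χ) σ T ∨ Intertwines (colRep (twist χ)) σ T →
    ∃ c : ℝ, ∀ x y, inner ℝ (T x) (T y) = c * inner ℝ (j x) (j y)

theorem IsUnitaryEmbedding.of_twist (h : IsUnitaryEmbedding (twist χ) σ j) :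
    IsUnitaryEmbedding χ σ j where
  injective := h.injective
  inner_smul := h.inner_smul
  exists_eq_smul T hT := h.exists_eq_smul T hT.twist
  exists_inner_eq T hT := h.exists_inner_eq T (by rw [twist_twist]; exact hT.symm)

variable [StarModule ℝ K] [FiniteDimensional ℝ E]

theorem exists_algHom_commutant_range (hσ : IsSymmRep σ) (hj : Intertwines (colRep χ) σ j)
    (hinj : Function.Injective j) :
    ∃ l : K →ₐ[ℝ] commutant (subRep σ (LinearMap.range j) hj.isInvariant_range), ∀ q x,
      (l q : Module.End ℝ (LinearMap.range j)) (LinearEquiv.ofInjective j hinj x) =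
        LinearEquiv.ofInjective j hinj (rmulStar q x) := by
  let f := LinearEquiv.ofInjective j hinj
  let l : K →ₐ[ℝ] Module.End ℝ (LinearMap.range j) := ((f.conjAlgEquiv ℝ).toAlgHom).comp rmulStar
  have hl : ∀ q x, l q x = f (rmulStar q (f.symm x)) := fun _ _ => rfl
  have hf := hj.ofInjective hinj
  have hmem : ∀ q, l q ∈ commutant (subRep σ _ hj.isInvariant_range) := fun q => by
    refine (mem_commutant_iff (hσ.subRep hj.isInvariant_range)).2 fun a x => ?_
    have hsymm : f.symm (subRep σ _ hj.isInvariant_range a x) = colAct (χ a) (f.symm x) :=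
      hf.symm a x
    rw [hl, hl, hsymm, rmulStar_apply, rmulStar_apply, ← colAct_smul]
    exact hf a _
  exact ⟨l.codRestrict (commutant (subRep σ _ hj.isInvariant_range)).toSubalgebra hmem,
    fun q x => by
      change l q (f x) = _
      rw [hl, f.symm_apply_apply]⟩

theorem isUnitaryEmbedding_of_intertwines (hK : IsScalarStarAlgebra K) (hKm : IsCommutantField K m)
    (hσ : IsSymmRep σ) (hχ : IsIrreducibleRep χ) (hj : Intertwines (colRep χ) σ j) (hj0 : j ≠ 0) :
    IsUnitaryEmbedding χ σ j := by
  have hirr := isIrreducible_colRep.2 hχ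
  have hinj := hirr.injective hj hj0
  let f := LinearEquiv.ofInjective j hinj
  have hf := hj.ofInjective hinj
  have hsymm := hσ.subRep hj.isInvariant_range
  have hrange := hirr.of_equiv f hf
  obtain ⟨l, hl⟩ := exists_algHom_commutant_range hσ hj hinj
  refine ⟨hinj, fun q x y => ?_, fun T hT => ?_, fun T hT => ?_⟩
  · obtain ⟨q, rfl⟩ := MulOpposite.op_surjective q
    have hstar : l (star q) = star (l q) :=
      hK.map_star_of_algHom (isScalarStarAlgebra_commutant hsymm hrange) l q
    have hadj : inner ℝ ((l (star q) : Module.End ℝ _) (f x)) (f y) =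
        inner ℝ (f x) ((l q : Module.End ℝ _) (f y)) := by
      rw [hstar]
      exact LinearMap.adjoint_inner_left (l q : Module.End ℝ _) (f y) (f x)
    rwa [hl, hl, rmulStar_apply, rmulStar_apply, star_star] at hadj
  · obtain ⟨q, hq⟩ := (hKm _ _ hsymm hrange).2 l ⟨f.toLinearMap ∘ₗ T ∘ₗ f.symm.toLinearMap,
      (mem_commutant_iff hsymm).2 (hf.comp (hT.comp hf.symm))⟩
    refine ⟨MulOpposite.op (star q), fun x => f.injective ?_⟩
    rw [← rmulStar_apply, ← hl, hq]
    exact (congrArg (f ∘ T) (f.symm_apply_apply x)).symm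
  · rcases hT with hT | hT
    · exact hirr.exists_inner_eq_mul_inner hσ hσ hj hj0 hT
    · exact hirr.exists_inner_eq_mul_inner hσ hσ.twist hj hj0
        (Intertwines.twist_right hT)

end UnitaryEmbedding

section Frames

variable {m r : ℕ} {K : Type} [Ring K] [Algebra ℝ K] {E ι : Type*} [NormedAddCommGroup E]
  [InnerProductSpace ℝ E] [Fintype ι] {σ : Cl m →ₐ[ℝ] Module.End ℝ E} {j₀ : (Fin r → K) →ₗ[ℝ] E}

/-- The coordinates `T` identify the representation `σ` with the sum of the representations `ψ a`,
and its inner product with the sum of the inner products that `j₀` induces on the summands. -/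
structure IsFrame (σ : Cl m →ₐ[ℝ] Module.End ℝ E) (j₀ : (Fin r → K) →ₗ[ℝ] E)
    (ψ : ι → Cl m →ₐ[ℝ] Matrix (Fin r) (Fin r) K) (T : E ≃ₗ[ℝ] (ι → Fin r → K)) : Prop where
  map_rep : ∀ a x i, T (σ a x) i = colAct (ψ i a) (T x i)
  inner_eq : ∀ x y, inner ℝ x y = ∑ i, inner ℝ (j₀ (T x i)) (j₀ (T y i))

theorem injective_of_inner_eq_sum (hinj : Function.Injective j₀)
    {S : (ι → Fin r → K) →ₗ[ℝ] E}
    (hS : ∀ x y, inner ℝ (S x) (S y) = ∑ i, inner ℝ (j₀ (x i)) (j₀ (y i))) :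
    Function.Injective S := by
  rw [injective_iff_map_eq_zero]
  intro x hx
  have hsum := hS x x
  rw [hx, inner_zero_left, eq_comm, Finset.sum_eq_zero_iff_of_nonneg
    fun i _ => real_inner_self_nonneg] at hsum
  funext i
  exact hinj (by rw [inner_self_eq_zero.1 (hsum i (Finset.mem_univ i)), Pi.zero_apply, map_zero])

theorem exists_isFrame [DecidableEq ι] (hinj : Function.Injective j₀)
    {ψ : ι → Cl m →ₐ[ℝ] Matrix (Fin r) (Fin r) K} {j : ι → (Fin r → K) →ₗ[ℝ] E}
    (hj : ∀ i, Intertwines (colRep (ψ i)) σ (j i))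
    (horth : ∀ a b x y, inner ℝ (j a x) (j b y) = if a = b then inner ℝ (j₀ x) (j₀ y) else 0)
    (htop : ⨆ i, LinearMap.range (j i) = ⊤) :
    ∃ T : E ≃ₗ[ℝ] (ι → Fin r → K), IsFrame σ j₀ ψ T := by
  let S : (ι → Fin r → K) →ₗ[ℝ] E := LinearMap.lsum ℝ _ ℝ j
  have hS : ∀ x, S x = ∑ i, j i (x i) := fun x => by simp [S]
  have hinner : ∀ x y, inner ℝ (S x) (S y) = ∑ i, inner ℝ (j₀ (x i)) (j₀ (y i)) := by
    intro x y
    simp [hS, sum_inner, inner_sum, horth]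
  have hrange : LinearMap.range S = ⊤ := by
    refine eq_top_iff.2 (htop ▸ iSup_le fun i => ?_)
    rintro _ ⟨x, rfl⟩
    exact ⟨Pi.single i x, LinearMap.lsum_piSingle ..⟩
  let f := LinearEquiv.ofBijective S
    ⟨injective_of_inner_eq_sum hinj hinner, LinearMap.range_eq_top.1 hrange⟩
  have hmap : ∀ a x, S (fun i => colAct (ψ i a) (x i)) = σ a (S x) := by
    intro a x
    rw [hS, hS, map_sum]
    exact Finset.sum_congr rfl fun i _ => hj i a (x i)
  have hf : ∀ x, S (f.symm x) = x := f.apply_symm_apply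
  refine ⟨f.symm, fun a x i => ?_, fun x y => ?_⟩
  · have hsymm : f.symm (σ a x) = fun i => colAct (ψ i a) (f.symm x i) :=
      f.symm_apply_eq.2 ((congrArg (σ a) (hf x)).symm.trans (hmap a _).symm)
    exact congrFun hsymm i
  · rw [← hinner, hf, hf]

end Frames

section VolumeElement

variable {m r : ℕ} {K : Type} [Ring K] [Algebra ℝ K] {E : Type*} [NormedAddCommGroup E]
  [InnerProductSpace ℝ E] {σ : Cl m →ₐ[ℝ] Module.End ℝ E}
  {χ : Cl m →ₐ[ℝ] Matrix (Fin r) (Fin r) K}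

theorem isSymmetric_volumeElement (hm : m % 4 = 0) (hσ : IsSymmRep σ) :
    (σ (volumeElement m)).IsSymmetric := by
  intro x y
  rw [hσ.inner_left, volumeElement, reverse_monomial, Finset.card_univ, Fintype.card_fin,
    monomialSign_succ_of_even (Nat.even_iff.2 (by lia)), if_pos hm, one_smul]

theorem colRep_twist_volumeElement (hm : Even m) {s : ℝ}
    (hs : ∀ x, colRep χ (volumeElement m) x = s • x) (x : Fin r → K) :
    colRep (twist χ) (volumeElement m) x = (-s) • x := by
  rw [colRep_twist, twistRep_volumeElement _ hm, LinearMap.neg_apply, hs, neg_smul]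

theorem exists_intertwines_range_le_of_le_eigenspace (hm : m % 4 = 0)
    [FiniteDimensional ℝ K] (hχ : Nontrivial (Fin r → K)) {s : ℝ}
    (hs : ∀ x, colRep χ (volumeElement m) x = s • x) {W : Submodule ℝ E}
    (hle : W ≤ Module.End.eigenspace (σ (volumeElement m)) s) (hW : IsInvariant σ W)
    (hW0 : W ≠ ⊥) : ∃ T, Intertwines (colRep χ) σ T ∧ T ≠ 0 ∧ LinearMap.range T ≤ W := by
  obtain ⟨w, hw, hw0⟩ := Submodule.exists_mem_ne_zero_of_ne_bot hW0
  obtain ⟨φ, hφ⟩ := exists_average_ne_zero_of_volumeElement_eq hm hs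
    (Module.End.mem_eigenspace_iff.1 (hle hw)) hw0
  exact ⟨_, intertwines_average φ w, hφ, range_average_le hW φ hw⟩

end VolumeElement

section Decomposition

variable {m r : ℕ} {K : Type} [DivisionRing K] [StarRing K] [Algebra ℝ K] [StarModule ℝ K]
  {E : Type} [NormedAddCommGroup E] [InnerProductSpace ℝ E] [FiniteDimensional ℝ E]
  {σ : Cl m →ₐ[ℝ] Module.End ℝ E} {χ : Cl m →ₐ[ℝ] Matrix (Fin r) (Fin r) K}

theorem IsCommutantField.exists_isIrreducibleRep [Nontrivial E] (hKm : IsCommutantField K m)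
    (hσ : IsSymmRep σ) :
    ∃ (r : ℕ) (χ : Cl m →ₐ[ℝ] Matrix (Fin r) (Fin r) K), IsIrreducibleRep χ := by
  obtain ⟨U, hU, hirr⟩ := exists_isIrreducible_subRep σ
  obtain ⟨l⟩ := (hKm U _ (hσ.subRep hU) hirr).1
  exact FKM.exists_isIrreducibleRep (hσ.subRep hU) hirr l

variable [FiniteDimensional ℝ K]

theorem exists_isUnitaryEmbedding_of_mod_four_eq_zero [Nontrivial E] (hm : m % 4 = 0)
    (hK : IsScalarStarAlgebra K) (hKm : IsCommutantField K m) (hσ : IsSymmRep σ)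
    (hχ : IsIrreducibleRep χ) {s : ℝ} (hs : ∀ x, colRep χ (volumeElement m) x = s • x)
    (hsup : Module.End.eigenspace (σ (volumeElement m)) s ⊔
      Module.End.eigenspace (σ (volumeElement m)) (-s) = ⊤) :
    ∃ j₀, IsUnitaryEmbedding χ σ j₀ := by
  have he : Even m := Nat.even_iff.2 (by lia)
  have hinv := isInvariant_eigenspace σ (commute_volumeElement he)
  by_cases h0 : Module.End.eigenspace (σ (volumeElement m)) s = ⊥
  · have h1 : Module.End.eigenspace (σ (volumeElement m)) (-s) ≠ ⊥ := fun h1 =>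
      bot_ne_top (by rw [← hsup, h0, h1, bot_sup_eq])
    obtain ⟨j₀, hj, hj0, -⟩ := exists_intertwines_range_le_of_le_eigenspace hm hχ.1
      (colRep_twist_volumeElement he hs) le_rfl (hinv _) h1
    exact ⟨j₀, (isUnitaryEmbedding_of_intertwines hK hKm hσ hχ.twist hj hj0).of_twist⟩
  · obtain ⟨j₀, hj, hj0, -⟩ := exists_intertwines_range_le_of_le_eigenspace hm hχ.1 hs le_rfl
      (hinv _) h0
    exact ⟨j₀, isUnitaryEmbedding_of_intertwines hK hKm hσ hχ hj hj0⟩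

theorem exists_isotypic_isFrame [Nontrivial E] (hm : Odd m ∨ m % 4 = 2)
    (hK : IsScalarStarAlgebra K) (hKm : IsCommutantField K m) (hσ : IsSymmRep σ)
    (hχ : IsIrreducibleRep χ) : ∃ j₀, IsUnitaryEmbedding χ σ j₀ ∧ ∃ (k : ℕ)
      (T : E ≃ₗ[ℝ] (Fin k → Fin r → K)), IsFrame σ j₀ (fun _ => χ) T := by
  have := hχ.1
  have hex : ∀ W : Submodule ℝ E, IsInvariant σ W → W ≠ ⊥ →
      ∃ T, Intertwines (colRep χ) σ T ∧ T ≠ 0 ∧ LinearMap.range T ≤ W := by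
    intro W hW hW0
    obtain ⟨w, hw, hw0⟩ := Submodule.exists_mem_ne_zero_of_ne_bot hW0
    obtain ⟨φ, hφ⟩ : ∃ φ, average (colRep χ) σ φ w ≠ 0 :=
      hm.elim (exists_average_ne_zero_of_odd · hw0)
        (exists_average_ne_zero_of_mod_four_eq_two · hw0)
    exact ⟨_, intertwines_average φ w, hφ, range_average_le hW φ hw⟩
  obtain ⟨j₀, hj, hj0, -⟩ := hex ⊤ (fun _ _ _ => trivial) top_ne_bot
  have hj₀ := isUnitaryEmbedding_of_intertwines hK hKm hσ hχ hj hj0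
  obtain ⟨k, j, hint, horth, htop⟩ := hσ.exists_orthogonal_intertwiners
    (fun T hT => hj₀.exists_inner_eq T (Or.inl hT)) ⊤ (fun _ _ _ => trivial) (fun W _ => hex W)
  exact ⟨j₀, hj₀, k, exists_isFrame hj₀.injective hint horth htop⟩

theorem exists_two_type_isFrame [Nontrivial E] (hm : m % 4 = 0)
    (hK : IsScalarStarAlgebra K) (hKm : IsCommutantField K m) (hσ : IsSymmRep σ)
    (hχ : IsIrreducibleRep χ) : ∃ j₀, IsUnitaryEmbedding χ σ j₀ ∧ ∃ (kp kn : ℕ)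
      (T : E ≃ₗ[ℝ] (Fin kp ⊕ Fin kn → Fin r → K)),
        IsFrame σ j₀ (Sum.elim (fun _ => χ) fun _ => twist χ) T := by
  have he : Even m := Nat.even_iff.2 (by lia)
  obtain ⟨s, hss, hs⟩ := (isIrreducible_colRep.2 hχ).exists_volumeElement_eq_smul hm
  have hst := colRep_twist_volumeElement he hs
  have hs0 : s ≠ 0 := by rintro rfl; norm_num at hss
  have hsq : σ (volumeElement m) * σ (volumeElement m) = 1 := by
    rw [← map_mul, volumeElement_mul_self, monomialSign_succ_of_even he, if_pos hm, one_smul,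
      map_one]
  have hinv := isInvariant_eigenspace σ (commute_volumeElement he)
  have hsup := eigenspace_sup_eigenspace_neg hsq hss
  obtain ⟨j₀, hj₀⟩ := exists_isUnitaryEmbedding_of_mod_four_eq_zero hm hK hKm hσ hχ hs hsup
  obtain ⟨kp, jp, hintp, horthp, htopp⟩ := hσ.exists_orthogonal_intertwiners
    (fun T hT => hj₀.exists_inner_eq T (Or.inl hT)) _ (hinv s)
    fun W => exists_intertwines_range_le_of_le_eigenspace hm hχ.1 hs
  obtain ⟨kn, jn, hintn, horthn, htopn⟩ := hσ.exists_orthogonal_intertwiners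
    (fun T hT => hj₀.exists_inner_eq T (Or.inr hT)) _ (hinv (-s))
    fun W => exists_intertwines_range_le_of_le_eigenspace hm hχ.1 hst
  have horth : ∀ a b x y, inner ℝ (jp a x) (jn b y) = 0 := fun a b x y =>
    (isSymmetric_volumeElement hm hσ).orthogonalFamily_eigenspaces (self_ne_neg.2 hs0)
      ⟨jp a x, htopp ▸ Submodule.mem_iSup_of_mem a ⟨x, rfl⟩⟩
      ⟨jn b y, htopn ▸ Submodule.mem_iSup_of_mem b ⟨y, rfl⟩⟩
  refine ⟨j₀, hj₀, kp, kn, exists_isFrame hj₀.injective (j := Sum.elim jp jn) ?_ ?_ ?_⟩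
  · rintro (i | i)
    exacts [hintp i, hintn i]
  · rintro (a | a) (b | b) x y
    · simp [horthp]
    · simp [horth]
    · rw [real_inner_comm]
      simp [horth]
    · simp [horthn]
  · simp only [iSup_sum, Sum.elim_inl, Sum.elim_inr, htopp, htopn, hsup]

end Decomposition

/-! ### Unitary matrices acting through a frame -/

section FrameAction

variable {m r : ℕ} {K : Type} [Ring K] [Algebra ℝ K] {E ι : Type*} [NormedAddCommGroup E]
  [InnerProductSpace ℝ E] [Fintype ι] [DecidableEq ι] {σ : Cl m →ₐ[ℝ] Module.End ℝ E}
  {j₀ : (Fin r → K) →ₗ[ℝ] E} {ψ : ι → Cl m →ₐ[ℝ] Matrix (Fin r) (Fin r) K}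
  {T : E ≃ₗ[ℝ] (ι → Fin r → K)}

open scoped Matrix.Module

/-- The action on `E` of the matrices over `Kᵐᵒᵖ`, through the coordinates `T`. The matrices have
entries in `Kᵐᵒᵖ` because scalars act on `K^r` from the right. -/
def frameAct (T : E ≃ₗ[ℝ] (ι → Fin r → K)) : Matrix ι ι Kᵐᵒᵖ →ₐ[ℝ] Module.End ℝ E :=
  (T.symm.conjAlgEquiv ℝ).toAlgHom.comp (Algebra.lsmul ℝ ℝ (ι → Fin r → K))

theorem apply_frameAct (Q : Matrix ι ι Kᵐᵒᵖ) (x : E) : T (frameAct T Q x) = Q • T x :=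
  T.apply_symm_apply _

theorem frameAct_symm_single (Q : Matrix ι ι Kᵐᵒᵖ) (a c : ι) (v : Fin r → K) :
    T (frameAct T Q (T.symm (Pi.single c v))) a = Q a c • v := by
  rw [apply_frameAct, T.apply_symm_apply, Matrix.Module.smul_apply,
    Fintype.sum_eq_single c fun d hd => by rw [Pi.single_eq_of_ne hd, smul_zero],
    Pi.single_eq_same]

theorem frameAct_injective [Nonempty (Fin r)] : Function.Injective (frameAct T) := by
  intro Q Q' h
  ext1 a c
  refine eq_of_smul_eq_smul (α := Fin r → K) fun v => ?_
  rw [← frameAct_symm_single (T := T), ← frameAct_symm_single (T := T), h]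

theorem eq_frameAct {S : Module.End ℝ E} {Q : Matrix ι ι Kᵐᵒᵖ}
    (h : ∀ a c v, T (S (T.symm (Pi.single c v))) a = Q a c • v) : S = frameAct T Q := by
  have hT : T.toLinearMap ∘ₗ S ∘ₗ T.symm.toLinearMap =
      T.toLinearMap ∘ₗ frameAct T Q ∘ₗ T.symm.toLinearMap := by
    refine LinearMap.pi_ext' fun c => LinearMap.ext fun v => funext fun a => ?_
    exact (h a c v).trans (frameAct_symm_single Q a c v).symm
  ext1 x
  apply T.injective
  simpa using LinearMap.congr_fun hT (T x)

theorem IsFrame.intertwines_frameAct (hT : IsFrame σ j₀ ψ T) {Q : Matrix ι ι Kᵐᵒᵖ}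
    (hQ : ∀ a c, ψ a ≠ ψ c → Q a c = 0) : Intertwines σ σ (frameAct T Q) := by
  refine fun f x => T.injective (funext fun a => ?_)
  rw [hT.map_rep, apply_frameAct, apply_frameAct, Matrix.Module.smul_apply,
    Matrix.Module.smul_apply, map_sum]
  refine Finset.sum_congr rfl fun d _ => ?_
  by_cases h : ψ a = ψ d
  · rw [hT.map_rep, colAct_smul, h]
  · rw [hQ a d h, zero_smul, zero_smul, map_zero]

theorem IsFrame.intertwines_symm_single (hT : IsFrame σ j₀ ψ T) (c : ι) :
    Intertwines (colRep (ψ c)) σ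
      (T.symm.toLinearMap ∘ₗ LinearMap.single ℝ (fun _ => Fin r → K) c) := by
  intro f v
  apply T.injective
  funext d
  simp only [LinearMap.comp_apply, LinearEquiv.coe_coe, LinearMap.coe_single]
  rw [hT.map_rep, T.apply_symm_apply, T.apply_symm_apply, colRep_apply]
  obtain rfl | hd := eq_or_ne d c
  · rw [Pi.single_eq_same, Pi.single_eq_same]
  · rw [Pi.single_eq_of_ne hd, Pi.single_eq_of_ne hd, map_zero]

theorem IsFrame.exists_eq_frameAct (hT : IsFrame σ j₀ ψ T)
    (hfull : ∀ a c S, Intertwines (colRep (ψ c)) (colRep (ψ a)) S →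
      ∃ q : Kᵐᵒᵖ, (∀ v, S v = q • v) ∧ (ψ a ≠ ψ c → q = 0))
    {S : Module.End ℝ E} (hS : Intertwines σ σ S) :
    ∃ Q : Matrix ι ι Kᵐᵒᵖ, (∀ a c, ψ a ≠ ψ c → Q a c = 0) ∧ S = frameAct T Q := by
  have hproj : ∀ a, Intertwines σ (colRep (ψ a)) (LinearMap.proj a ∘ₗ T.toLinearMap) :=
    fun a f x => hT.map_rep f x a
  choose Q hQ hQ0 using fun a c =>
    hfull a c _ ((hproj a).comp (hS.comp (hT.intertwines_symm_single c)))
  exact ⟨Matrix.of Q, hQ0, eq_frameAct hQ⟩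

variable [StarRing K]

theorem IsFrame.inner_frameAct_left (hT : IsFrame σ j₀ ψ T)
    (hj₀ : ∀ (q : Kᵐᵒᵖ) x y, inner ℝ (j₀ (q • x)) (j₀ y) = inner ℝ (j₀ x) (j₀ (star q • y)))
    (Q : Matrix ι ι Kᵐᵒᵖ) (x y : E) :
    inner ℝ (frameAct T Q x) y = inner ℝ x (frameAct T (star Q) y) := by
  rw [hT.inner_eq, hT.inner_eq]
  simp only [apply_frameAct, Matrix.Module.smul_apply, map_sum, sum_inner, inner_sum, hj₀,
    Matrix.star_apply]
  exact Finset.sum_comm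

theorem IsFrame.norm_frameAct_iff [Nonempty (Fin r)] (hT : IsFrame σ j₀ ψ T)
    (hj₀ : ∀ (q : Kᵐᵒᵖ) x y, inner ℝ (j₀ (q • x)) (j₀ y) = inner ℝ (j₀ x) (j₀ (star q • y)))
    {Q : Matrix ι ι Kᵐᵒᵖ} : (∀ x, ‖frameAct T Q x‖ = ‖x‖) ↔ star Q * Q = 1 := by
  have hinner : ∀ x y, inner ℝ (frameAct T Q x) (frameAct T Q y) =
      inner ℝ x (frameAct T (star Q * Q) y) := fun x y => by
    rw [hT.inner_frameAct_left hj₀, map_mul, Module.End.mul_apply]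
  constructor
  · intro h
    refine frameAct_injective (T := T) (LinearMap.ext fun y => ext_inner_left ℝ fun x => ?_)
    rw [← hinner, map_one, Module.End.one_apply]
    exact (LinearIsometry.mk (frameAct T Q) h).inner_map_map x y
  · intro h x
    rw [← sq_eq_sq₀ (norm_nonneg _) (norm_nonneg _), ← real_inner_self_eq_norm_sq, hinner, h,
      map_one, Module.End.one_apply, real_inner_self_eq_norm_sq]

end FrameAction

section UnitaryModel

variable {ι κ L R B B₁ B₂ : Type*} [Fintype ι] [DecidableEq ι] [Fintype κ] [DecidableEq κ] [Ring R]
  [Group B] [Group B₁] [Group B₂]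

/-- The block diagonal action of a product of two groups of matrices. -/
def blockHom (q₁ : B₁ →* Matrix ι ι R) (q₂ : B₂ →* Matrix κ κ R) :
    B₁ × B₂ →* Matrix (ι ⊕ κ) (ι ⊕ κ) R where
  toFun b := Matrix.fromBlocks (q₁ b.1) 0 0 (q₂ b.2)
  map_one' := by simp
  map_mul' b b' := by simp [Matrix.fromBlocks_multiply]

open scoped Matrix.Module in
theorem blockHom_smul_sumElim {M : Type*} [AddCommGroup M] [Module R M]
    (q₁ : B₁ →* Matrix ι ι R) (q₂ : B₂ →* Matrix κ κ R) (b : B₁ × B₂) (x : ι → M) (y : κ → M) :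
    blockHom q₁ q₂ b • Sum.elim x y = Sum.elim (q₁ b.1 • x) (q₂ b.2 • y) := by
  funext i
  cases i <;> simp [blockHom]

variable [StarRing R]

/-- The homomorphism `q` identifies the group `B` with the group of the unitary matrices that only
couple indices with the same label. -/
structure IsUnitaryModel (label : ι → L) (q : B →* Matrix ι ι R) : Prop where
  injective : Function.Injective q
  mem_range_iff : ∀ Q, Q ∈ Set.range q ↔
    star Q * Q = 1 ∧ ∀ a c, label a ≠ label c → Q a c = 0

theorem IsUnitaryModel.blockHom {s t : L} (hst : s ≠ t) {q₁ : B₁ →* Matrix ι ι R}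
    {q₂ : B₂ →* Matrix κ κ R} (h₁ : IsUnitaryModel (fun _ => s) q₁)
    (h₂ : IsUnitaryModel (fun _ => t) q₂) :
    IsUnitaryModel (Sum.elim (fun _ => s) fun _ => t) (blockHom q₁ q₂) := by
  have hstar : ∀ (A : Matrix ι ι R) (D : Matrix κ κ R),
      star (Matrix.fromBlocks A 0 0 D) * Matrix.fromBlocks A 0 0 D =
        Matrix.fromBlocks (star A * A) 0 0 (star D * D) := fun A D => by
    simp [Matrix.star_eq_conjTranspose, Matrix.fromBlocks_conjTranspose,
      Matrix.fromBlocks_multiply]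
  refine ⟨fun b b' h => ?_, fun Q => ⟨?_, fun ⟨hQ, hsupp⟩ => ?_⟩⟩
  · obtain ⟨hb₁, -, -, hb₂⟩ := Matrix.fromBlocks_inj.1 h
    exact Prod.ext (h₁.injective hb₁) (h₂.injective hb₂)
  · rintro ⟨b, rfl⟩
    refine ⟨?_, ?_⟩
    · rw [FKM.blockHom, MonoidHom.coe_mk, OneHom.coe_mk, hstar,
        ((h₁.mem_range_iff _).1 ⟨b.1, rfl⟩).1, ((h₂.mem_range_iff _).1 ⟨b.2, rfl⟩).1,
        Matrix.fromBlocks_one]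
    · rintro (a | a) (c | c) h
      exacts [absurd rfl h, rfl, rfl, absurd rfl h]
  · obtain ⟨A, D, rfl⟩ : ∃ A D, Q = Matrix.fromBlocks A 0 0 D := by
      refine ⟨Q.toBlocks₁₁, Q.toBlocks₂₂, ?_⟩
      ext (a | a) (c | c)
      exacts [rfl, hsupp _ _ hst, hsupp _ _ hst.symm, rfl]
    rw [hstar, ← Matrix.fromBlocks_one, Matrix.fromBlocks_inj] at hQ
    obtain ⟨b₁, rfl⟩ := (h₁.mem_range_iff A).2 ⟨hQ.1, fun _ _ h => absurd rfl h⟩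
    obtain ⟨b₂, rfl⟩ := (h₂.mem_range_iff D).2 ⟨hQ.2.2.2, fun _ _ h => absurd rfl h⟩
    exact ⟨(b₁, b₂), rfl⟩

end UnitaryModel

section FrameIsometries

variable {m r : ℕ} {K : Type} [Ring K] [StarRing K] [Algebra ℝ K] {E ι B : Type*}
  [NormedAddCommGroup E] [InnerProductSpace ℝ E] [FiniteDimensional ℝ E] [Fintype ι]
  [DecidableEq ι] [Group B] {σ : Cl m →ₐ[ℝ] Module.End ℝ E} {j₀ : (Fin r → K) →ₗ[ℝ] E}
  {ψ : ι → Cl m →ₐ[ℝ] Matrix (Fin r) (Fin r) K} {T : E ≃ₗ[ℝ] (ι → Fin r → K)}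
  {q : B →* Matrix ι ι Kᵐᵒᵖ}

theorem IsFrame.exists_isometryHom [Nonempty (Fin r)] (hT : IsFrame σ j₀ ψ T)
    (hj₀ : ∀ (q : Kᵐᵒᵖ) x y, inner ℝ (j₀ (q • x)) (j₀ y) = inner ℝ (j₀ x) (j₀ (star q • y)))
    (hfull : ∀ a c S, Intertwines (colRep (ψ c)) (colRep (ψ a)) S →
      ∃ q : Kᵐᵒᵖ, (∀ v, S v = q • v) ∧ (ψ a ≠ ψ c → q = 0))
    (hq : IsUnitaryModel ψ q) :
    ∃ Ψ : B →* (E ≃ₗᵢ[ℝ] E), Function.Injective Ψ ∧ (∀ b x, Ψ b x = frameAct T (q b) x) ∧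
      ∀ U : E ≃ₗᵢ[ℝ] E, U ∈ Ψ.range ↔ Intertwines σ σ (U.toLinearEquiv : E →ₗ[ℝ] E) := by
  have hrange : ∀ b, star (q b) * q b = 1 ∧ ∀ a c, ψ a ≠ ψ c → q b a c = 0 :=
    fun b => (hq.mem_range_iff _).1 ⟨b, rfl⟩
  let Ψ : B →* (E ≃ₗᵢ[ℝ] E) :=
    { toFun := fun b =>
        isometryOfNorm (frameAct T (q b)) ((hT.norm_frameAct_iff hj₀).2 (hrange b).1)
      map_one' := by ext1 x; simp
      map_mul' := fun b b' => by ext1 x; simp }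
  have hΨ : ∀ b x, Ψ b x = frameAct T (q b) x := fun _ _ => rfl
  refine ⟨Ψ, fun b b' h => hq.injective (frameAct_injective (T := T) ?_), hΨ, fun U => ⟨?_, ?_⟩⟩
  · ext1 x
    rw [← hΨ, ← hΨ, h]
  · rintro ⟨b, rfl⟩
    exact hT.intertwines_frameAct (hrange b).2
  · intro hU
    obtain ⟨Q, hQ, hUQ⟩ := hT.exists_eq_frameAct hfull hU
    have hunit : star Q * Q = 1 :=
      (hT.norm_frameAct_iff hj₀).1 fun x => by rw [← hUQ]; exact U.norm_map x
    obtain ⟨b, rfl⟩ := (hq.mem_range_iff Q).2 ⟨hunit, hQ⟩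
    exact ⟨b, LinearIsometryEquiv.ext fun x => (LinearMap.congr_fun hUQ x).symm⟩

end FrameIsometries

section Equivalence

variable {m n : ℕ} {C : CliffordSystem m n} {L : Subgroup (Cl m)ˣ}

theorem isEquivalentToAction_of_isometryHom (hL : L ≤ Pin m) {B : Type} [Group B]
    {Ψ : B →* OV n} (hΨ : Function.Injective Ψ) (hrange : Ψ.range = C.uPlus) {X : Type}
    [AddCommGroup X] [Module ℝ X] {act : Cl m → B → (X →ₗ[ℝ] X)} (T : V n ≃ₗ[ℝ] X)
    (hact : ∀ f b x, T (C.rep f (Ψ b x)) = act f b (T x)) :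
    IsEquivalentToAction C (C.image L ⊔ C.uPlus) L B X act := by
  let χ : L →* OV n := C.pinHom.comp (Subgroup.inclusion hL)
  have hΨu : ∀ b, Ψ b ∈ C.uPlus := fun b => hrange ▸ ⟨b, rfl⟩
  have hcomm : ∀ f b, Commute (χ f) (Ψ b) := fun f b =>
    LinearIsometryEquiv.ext fun x => (C.mem_uPlus_iff.1 (hΨu b) _ x).symm
  refine ⟨MonoidHom.noncommCoprod χ Ψ hcomm, ?_, ?_, fun f x => ?_, ?_, T, fun f b x =>
    hact _ b x⟩
  · rw [MonoidHom.noncommCoprod_range, C.range_pinHom_comp_inclusion hL, hrange]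
  · refine Set.Finite.of_injOn (f := fun p : L × B => (p.1 : (Cl m)ˣ)) ?_ ?_
      C.finite_pin_intertwines
    · rintro ⟨f, b⟩ (hp : χ f * Ψ b = 1)
      have hχ : χ f ∈ C.uPlus := eq_inv_of_mul_eq_one_left hp ▸ inv_mem (hΨu b)
      exact ⟨hL f.2, C.mem_uPlus_iff.1 hχ⟩
    · rintro ⟨f, b⟩ (hp : χ f * Ψ b = 1) ⟨f', b'⟩ (hp' : χ f' * Ψ b' = 1) h
      obtain rfl : f = f' := Subtype.ext h
      rw [hΨ (mul_left_cancel (hp.trans hp'.symm))]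
  · rw [MonoidHom.noncommCoprod_apply, map_one, mul_one]
    rfl
  · rw [MonoidHom.noncommCoprod_comp_inr, hrange]

open scoped Matrix.Module

theorem IsFrame.isEquivalentToAction {r : ℕ} [Nonempty (Fin r)] {K : Type} [Ring K] [StarRing K]
    [Algebra ℝ K] {ι : Type*} [Fintype ι] [DecidableEq ι]
    {j₀ : (Fin r → K) →ₗ[ℝ] V n} {ψ : ι → Cl m →ₐ[ℝ] Matrix (Fin r) (Fin r) K}
    {T : V n ≃ₗ[ℝ] (ι → Fin r → K)} (hT : IsFrame C.rep j₀ ψ T)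
    (hj₀ : ∀ (q : Kᵐᵒᵖ) x y, inner ℝ (j₀ (q • x)) (j₀ y) = inner ℝ (j₀ x) (j₀ (star q • y)))
    (hfull : ∀ a c S, Intertwines (colRep (ψ c)) (colRep (ψ a)) S →
      ∃ q : Kᵐᵒᵖ, (∀ v, S v = q • v) ∧ (ψ a ≠ ψ c → q = 0))
    {B : Type} [Group B] {q : B →* Matrix ι ι Kᵐᵒᵖ} (hq : IsUnitaryModel ψ q) (hL : L ≤ Pin m)
    {X : Type} [AddCommGroup X] [Module ℝ X] {act : Cl m → B → (X →ₗ[ℝ] X)}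
    (τ : X ≃ₗ[ℝ] (ι → Fin r → K))
    (hτ : ∀ f b z, τ (act f b z) = q b • fun a => colAct (ψ a f) (τ z a)) :
    IsEquivalentToAction C (C.image L ⊔ C.uPlus) L B X act := by
  obtain ⟨Ψ, hΨ, hΨq, hrange⟩ := hT.exists_isometryHom hj₀ hfull hq
  refine isEquivalentToAction_of_isometryHom hL hΨ
    (Subgroup.ext fun U => (hrange U).trans C.mem_uPlus_iff.symm) (T.trans τ.symm)
    fun f b x => τ.injective ?_
  have hcomm : C.rep f (Ψ b x) = frameAct T (q b) (C.rep f x) := by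
    rw [← hΨq]
    exact ((hrange (Ψ b)).1 ⟨b, rfl⟩ f x).symm
  rw [hτ, hcomm]
  simp only [LinearEquiv.trans_apply, LinearEquiv.apply_symm_apply, apply_frameAct]
  exact congrArg (q b • ·) (funext fun a => hT.map_rep f x a)

end Equivalence

/-! ### Tensor products with the standard representation of a classical group -/

section ColumnModels

open scoped Matrix.Module

variable {K : Type} [Ring K] {r k : ℕ}

/-- The pairs `(M, b)` of an `r × r` matrix and `b ∈ B` act on `X` as on `k` copies of `K^r`, on
which `M` acts diagonally and `B` is the group of the unitary matrices of right multiplications. -/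
def IsColumnModel [StarRing K] [Algebra ℝ K] {B X : Type} [Group B] [AddCommGroup X] [Module ℝ X]
    (act : Matrix (Fin r) (Fin r) K → B → (X →ₗ[ℝ] X)) (k : ℕ) : Prop :=
  ∃ (q : B →* Matrix (Fin k) (Fin k) Kᵐᵒᵖ) (τ : X ≃ₗ[ℝ] (Fin k → Fin r → K)),
    (∀ {L : Type} (s : L), IsUnitaryModel (fun _ => s) q) ∧
      ∀ M b z, τ (act M b z) = q b • fun a => colAct M (τ z a)

variable [StarRing K]

/-- The unitary matrices over `K` as matrices over the opposite ring. -/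
def unitaryOpHom (e : K ≃+* Kᵐᵒᵖ) :
    unitary (Matrix (Fin k) (Fin k) K) →* Matrix (Fin k) (Fin k) Kᵐᵒᵖ :=
  e.mapMatrix.toMonoidHom.comp (unitary _).subtype

theorem unitaryOpHom_apply (e : K ≃+* Kᵐᵒᵖ) (U : unitary (Matrix (Fin k) (Fin k) K))
    (a c : Fin k) : unitaryOpHom e U a c = e (U.1 a c) := rfl

theorem isUnitaryModel_unitaryOpHom [IsDedekindFiniteMonoid (Matrix (Fin k) (Fin k) K)]
    {e : K ≃+* Kᵐᵒᵖ} (he : ∀ q, e (star q) = star (e q)) {L : Type*} (s : L) :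
    IsUnitaryModel (fun _ => s) (unitaryOpHom (k := k) e) := by
  have hstar : ∀ A : Matrix (Fin k) (Fin k) K, e.mapMatrix (star A * A) =
      star (e.mapMatrix A) * e.mapMatrix A := fun A => by
    rw [map_mul]
    congr 1
    ext1 a c
    exact he (A c a)
  refine ⟨e.mapMatrix.injective.comp Subtype.val_injective, fun Q =>
    ⟨?_, fun ⟨hQ, _⟩ => ?_⟩⟩
  · rintro ⟨U, rfl⟩
    refine ⟨?_, fun _ _ h => absurd rfl h⟩
    exact (hstar U).symm.trans (by rw [Unitary.star_mul_self_of_mem U.2, map_one])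
  · obtain ⟨A, rfl⟩ := e.mapMatrix.surjective Q
    rw [← hstar, EmbeddingLike.map_eq_one_iff] at hQ
    exact ⟨⟨A, Unitary.mem_iff.2 ⟨hQ, mul_eq_one_comm.1 hQ⟩⟩, rfl⟩

variable [Algebra ℝ K]

theorem unitaryOpHom_smul_eq (e : K ≃+* Kᵐᵒᵖ) (M : Matrix (Fin r) (Fin r) K)
    (U : unitary (Matrix (Fin k) (Fin k) K)) (v : Fin r → K) (w : Fin k → K) :
    unitaryOpHom e U • (fun a => colAct M (e (w a) • v)) =
      fun a => e ((U.1.mulVec w) a) • colAct M v := by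
  funext a
  simp only [Matrix.Module.smul_apply, unitaryOpHom_apply, colAct_smul, smul_smul, ← map_mul]
  rw [← Finset.sum_smul, ← map_sum]
  rfl

theorem isColumnModel_unitary [IsDedekindFiniteMonoid (Matrix (Fin k) (Fin k) K)]
    {e : K ≃+* Kᵐᵒᵖ} (he : ∀ q, e (star q) = star (e q)) {X : Type} [AddCommGroup X] [Module ℝ X]
    {act : Matrix (Fin r) (Fin r) K → unitary (Matrix (Fin k) (Fin k) K) → (X →ₗ[ℝ] X)}
    (τ : X ≃ₗ[ℝ] (Fin k → Fin r → K)) (tensor : (Fin r → K) → (Fin k → K) → X)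
    (hspan : AddSubmonoid.closure (Set.range fun p : _ × _ => tensor p.1 p.2) = ⊤)
    (hτ : ∀ v w, τ (tensor v w) = fun a => e (w a) • v)
    (hact : ∀ M U v w, act M U (tensor v w) = tensor (colAct M v) (U.1.mulVec w)) :
    IsColumnModel act k := by
  refine ⟨unitaryOpHom e, τ, fun s => isUnitaryModel_unitaryOpHom he s, fun M U z => ?_⟩
  induction z using AddSubmonoid.dense_induction _ hspan with
  | mem _ hz =>
    obtain ⟨⟨v, w⟩, rfl⟩ := hz
    rw [hact, hτ, hτ, unitaryOpHom_smul_eq]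
  | zero =>
    simp only [map_zero, Pi.zero_apply]
    exact (smul_zero (unitaryOpHom e U)).symm
  | add x y hx hy =>
    simp only [map_add, Pi.add_apply, hx, hy]
    exact (smul_add (unitaryOpHom e U) _ _).symm

end ColumnModels

theorem closure_range_tmul {R M N : Type*} [CommSemiring R] [AddCommMonoid M] [AddCommMonoid N]
    [Module R M] [Module R N] :
    AddSubmonoid.closure (Set.range fun p : M × N => p.1 ⊗ₜ[R] p.2) = ⊤ := by
  refine eq_top_iff.2 fun z _ => ?_
  induction z with
  | zero => exact zero_mem _
  | add x y hx hy => exact add_mem (hx trivial) (hy trivial)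
  | tmul v w => exact AddSubmonoid.subset_closure ⟨(v, w), rfl⟩

theorem isColumnModel_unitaryGroup {K : Type} [Field K] [StarRing K] [Algebra ℝ K] (r k : ℕ) :
    IsColumnModel (fun (M : Matrix (Fin r) (Fin r) K) (U : Matrix.unitaryGroup (Fin k) K) =>
      tensorAct M U.1) k := by
  refine isColumnModel_unitary (e := RingEquiv.toOpposite K) (fun _ => rfl)
    ((TensorProduct.piScalarRight K K (Fin r → K) (Fin k)).restrictScalars ℝ)
    (fun v w => v ⊗ₜ w) closure_range_tmul (fun v w => ?_) fun _ _ _ _ => rfl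
  funext a i
  exact mul_comm (w a) (v i)

/-- The map `v ⊗ w ↦ (v * star (w a))_a`. -/
def quatTensorHom (r k : ℕ) : QuatTensor r k →ₗ[ℝ] (Fin k → Fin r → ℍ[ℝ]) :=
  (quatRel r k).liftQ (TensorProduct.lift (LinearMap.mk₂ ℝ
      (fun v w a => MulOpposite.op (star (w a)) • v)
      (fun _ _ _ => funext fun _ => smul_add _ _ _)
      (fun _ _ _ => funext fun _ => smul_comm _ _ _)
      (fun _ _ _ => by ext1 a; simp [add_smul])
      (fun _ _ _ => by ext1 a; simp)))
    (Submodule.span_le.2 (by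
      rintro _ ⟨v, w, q, rfl⟩
      rw [SetLike.mem_coe, LinearMap.mem_ker, map_sub, sub_eq_zero]
      funext a i
      simp [mul_assoc]))

theorem quatTensorHom_mk (r k : ℕ) (v : Fin r → ℍ[ℝ]) (w : Fin k → ℍ[ℝ]) :
    quatTensorHom r k (Submodule.Quotient.mk (v ⊗ₜ w)) =
      fun a => MulOpposite.op (star (w a)) • v := rfl

/-- The map `x ↦ ∑ a, x a ⊗ e_a`. -/
def quatTensorInv (r k : ℕ) : (Fin k → Fin r → ℍ[ℝ]) →ₗ[ℝ] QuatTensor r k :=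
  ∑ a, (quatRel r k).mkQ ∘ₗ
    (TensorProduct.mk ℝ (Fin r → ℍ[ℝ]) (Fin k → ℍ[ℝ])).flip (Pi.single a 1) ∘ₗ LinearMap.proj a

theorem quatTensorInv_apply (r k : ℕ) (x : Fin k → Fin r → ℍ[ℝ]) : quatTensorInv r k x =
    ∑ a, (Submodule.Quotient.mk (x a ⊗ₜ Pi.single a 1) : QuatTensor r k) := by
  simp [quatTensorInv, LinearMap.sum_apply]

theorem quatTensor_mk_smul_tmul {r k : ℕ} (v : Fin r → ℍ[ℝ]) (w : Fin k → ℍ[ℝ]) (q : ℍ[ℝ]) :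
    (Submodule.Quotient.mk ((MulOpposite.op q • v) ⊗ₜ w) : QuatTensor r k) =
      Submodule.Quotient.mk (v ⊗ₜ (MulOpposite.op (star q) • w)) :=
  (Submodule.Quotient.eq _).2 (Submodule.subset_span ⟨v, w, q, rfl⟩)

theorem quatTensorHom_comp_quatTensorInv (r k : ℕ) :
    quatTensorHom r k ∘ₗ quatTensorInv r k = LinearMap.id := by
  refine LinearMap.ext fun x => ?_
  funext a
  rw [LinearMap.comp_apply, quatTensorInv_apply, map_sum, Finset.sum_apply,
    Finset.sum_eq_single a]
  · simp [quatTensorHom_mk]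
  · intro c _ hc
    simp [quatTensorHom_mk, Pi.single_eq_of_ne hc.symm]
  · simp

theorem quatTensorInv_comp_quatTensorHom (r k : ℕ) :
    quatTensorInv r k ∘ₗ quatTensorHom r k = LinearMap.id := by
  refine Submodule.linearMap_qext _ (TensorProduct.ext' fun v w => ?_)
  change quatTensorInv r k (quatTensorHom r k (Submodule.Quotient.mk (v ⊗ₜ w))) =
    (quatRel r k).mkQ (v ⊗ₜ w)
  have hw : ∑ a, MulOpposite.op (w a) • Pi.single a (1 : ℍ[ℝ]) = w := by
    simp [← Pi.single_smul, Finset.univ_sum_single]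
  simp only [quatTensorHom_mk, quatTensorInv_apply, quatTensor_mk_smul_tmul, star_star]
  nth_rw 2 [← hw]
  rw [TensorProduct.tmul_sum, map_sum]
  rfl

/-- The isomorphism of `ℍ^r ⊗_ℍ ℍ^k` with `k` copies of `ℍ^r`. -/
def quatTensorEquiv (r k : ℕ) : QuatTensor r k ≃ₗ[ℝ] (Fin k → Fin r → ℍ[ℝ]) :=
  LinearEquiv.ofLinearMap (quatTensorHom r k) (quatTensorInv r k)
    (quatTensorHom_comp_quatTensorInv r k) (quatTensorInv_comp_quatTensorHom r k)

theorem isColumnModel_sp (r k : ℕ) :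
    IsColumnModel (fun (M : Matrix (Fin r) (Fin r) ℍ[ℝ]) (U : Sp k) => quatTensorAct M U.1) k := by
  refine isColumnModel_unitary (e := starRingEquiv) (fun _ => rfl) (quatTensorEquiv r k)
    (fun v w => Submodule.Quotient.mk (v ⊗ₜ w)) ?_ (fun v w => rfl) fun _ _ _ _ => rfl
  have hmk : (fun p : (Fin r → ℍ[ℝ]) × (Fin k → ℍ[ℝ]) =>
      (Submodule.Quotient.mk (p.1 ⊗ₜ p.2) : QuatTensor r k)) =
      (quatRel r k).mkQ.toAddMonoidHom ∘ fun p => p.1 ⊗ₜ p.2 := rfl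
  rw [hmk, Set.range_comp, ← AddMonoidHom.map_mclosure, closure_range_tmul,
    ← AddMonoidHom.mrange_eq_map, AddMonoidHom.mrange_eq_top]
  exact Submodule.mkQ_surjective _

section IsotypicDecomposition

open scoped Matrix.Module

section Twist

variable {m r : ℕ} {K : Type} [Ring K] [Algebra ℝ K] {χ : Cl m →ₐ[ℝ] Matrix (Fin r) (Fin r) K}

theorem IsIrreducibleRep.eq_zero_of_intertwines_twist (hχ : IsIrreducibleRep χ) (hm : m % 4 = 0)
    {S : Module.End ℝ (Fin r → K)} (hS : Intertwines (colRep χ) (colRep (FKM.twist χ)) S) :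
    S = 0 := by
  obtain ⟨s, hss, hs⟩ := (isIrreducible_colRep.2 hχ).exists_volumeElement_eq_smul hm
  have hs0 : s ≠ 0 := by rintro rfl; norm_num at hss
  exact hS.eq_zero_of_smul_ne (self_ne_neg.2 hs0) hs
    (colRep_twist_volumeElement (Nat.even_iff.2 (by lia)) hs)

theorem IsIrreducibleRep.ne_twist (hχ : IsIrreducibleRep χ) (hm : m % 4 = 0) :
    χ ≠ FKM.twist χ := by
  intro h
  have hid : Intertwines (colRep χ) (colRep (FKM.twist χ)) LinearMap.id := h ▸ fun _ _ => rfl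
  have := hχ.1
  obtain ⟨x, hx⟩ := exists_ne (0 : Fin r → K)
  exact hx (LinearMap.congr_fun (hχ.eq_zero_of_intertwines_twist hm hid) x)

theorem IsIrreducibleRep.nonempty_fin (hχ : IsIrreducibleRep χ) : Nonempty (Fin r) :=
  not_isEmpty_iff.1 fun _ => not_nontrivial_iff_subsingleton.2 inferInstance hχ.1

end Twist

variable {m n : ℕ} [Nontrivial (V n)] (C : CliffordSystem m n) {K : Type} [DivisionRing K]
  [StarRing K] [Algebra ℝ K] [StarModule ℝ K] [FiniteDimensional ℝ K] {r : ℕ}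
  {χ : Cl m →ₐ[ℝ] Matrix (Fin r) (Fin r) K}

theorem exists_isotypic_equivalence (hm : Odd m ∨ m % 4 = 2) (hK : IsScalarStarAlgebra K)
    (hKm : IsCommutantField K m) (hχ : IsIrreducibleRep χ) {L : Subgroup (Cl m)ˣ} (hL : L ≤ Pin m)
    {B X : ℕ → Type} [∀ k, Group (B k)] [∀ k, AddCommGroup (X k)] [∀ k, Module ℝ (X k)]
    {act : ∀ k, Matrix (Fin r) (Fin r) K → B k → (X k →ₗ[ℝ] X k)}
    (hact : ∀ k, IsColumnModel (act k) k) :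
    ∃ k, IsSumOf C χ k ∧
      IsEquivalentToAction C (C.image L ⊔ C.uPlus) L (B k) (X k) (fun f b => act k (χ f) b) := by
  have := hχ.nonempty_fin
  obtain ⟨j₀, hj₀, k, T, hT⟩ := exists_isotypic_isFrame hm hK hKm C.isSymmRep hχ
  obtain ⟨q, τ, hq, hτ⟩ := hact k
  refine ⟨k, ⟨T, hT.map_rep⟩, hT.isEquivalentToAction hj₀.inner_smul (fun _ _ S hS => ?_) (hq χ) hL
    τ fun f => hτ (χ f)⟩
  obtain ⟨p, hp⟩ := hj₀.exists_eq_smul S hS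
  exact ⟨p, hp, fun h => absurd rfl h⟩

theorem exists_two_type_equivalence (hm : m % 4 = 0) (hK : IsScalarStarAlgebra K)
    (hKm : IsCommutantField K m) (hχ : IsIrreducibleRep χ) {L : Subgroup (Cl m)ˣ} (hL : L ≤ Pin m)
    {B X : ℕ → Type} [∀ k, Group (B k)] [∀ k, AddCommGroup (X k)] [∀ k, Module ℝ (X k)]
    {act : ∀ k, Matrix (Fin r) (Fin r) K → B k → (X k →ₗ[ℝ] X k)}
    (hact : ∀ k, IsColumnModel (act k) k) :
    ∃ kp kn, IsSumOf₂ C χ (twist χ) kp kn ∧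
      IsEquivalentToAction C (C.image L ⊔ C.uPlus) L (B kp × B kn) (X kp × X kn)
        (fun f b => (act kp (χ f) b.1).prodMap (act kn (twist χ f) b.2)) := by
  have := hχ.nonempty_fin
  obtain ⟨j₀, hj₀, kp, kn, T, hT⟩ := exists_two_type_isFrame hm hK hKm C.isSymmRep hχ
  obtain ⟨q₁, τ₁, hq₁, hτ₁⟩ := hact kp
  obtain ⟨q₂, τ₂, hq₂, hτ₂⟩ := hact kn
  let e := LinearEquiv.sumArrowLequivProdArrow (Fin kp) (Fin kn) ℝ (Fin r → K)
  refine ⟨kp, kn, ⟨T.trans e, fun a x => ⟨fun i => hT.map_rep a x _, fun i => hT.map_rep a x _⟩⟩,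
    hT.isEquivalentToAction hj₀.inner_smul ?_ ((hq₁ χ).blockHom (hχ.ne_twist hm) (hq₂ (twist χ)))
      hL ((τ₁.prodCongr τ₂).trans e.symm) ?_⟩
  · rintro (a | a) (c | c) S hS
    · obtain ⟨p, hp⟩ := hj₀.exists_eq_smul S hS
      exact ⟨p, hp, fun h => absurd rfl h⟩
    · exact ⟨0, by simp [hχ.twist.eq_zero_of_intertwines_twist hm (by rwa [twist_twist])],
        fun _ => rfl⟩
    · exact ⟨0, by simp [hχ.eq_zero_of_intertwines_twist hm hS], fun _ => rfl⟩
    · obtain ⟨p, hp⟩ := hj₀.exists_eq_smul S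
        (by rw [← twist_twist χ]; exact Intertwines.twist hS)
      exact ⟨p, hp, fun h => absurd rfl h⟩
  · rintro f b ⟨z₁, z₂⟩
    have hblock := blockHom_smul_sumElim q₁ q₂ b (fun a => colAct (χ f) (τ₁ z₁ a))
      fun a => colAct (twist χ f) (τ₂ z₂ a)
    rw [← hτ₁, ← hτ₂] at hblock
    refine hblock.symm.trans (congrArg (blockHom q₁ q₂ b • ·) ?_)
    funext i
    cases i <;> rfl

end IsotypicDecomposition

/-! ### The Cartan–Münzner polynomial -/

section StdForm

variable {m : ℕ}

theorem stdForm_nonneg (v : Fin (m + 1) → ℝ) : 0 ≤ stdForm m v := by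
  rw [stdForm_apply]
  positivity

theorem eq_of_two_le_polar {v w : Fin (m + 1) → ℝ} (hv : stdForm m v ≤ 1) (hw : stdForm m w ≤ 1)
    (h : 2 ≤ QuadraticMap.polar (stdForm m) v w) : v = w := by
  have hsub : stdForm m (v - w) =
      stdForm m v + stdForm m w - QuadraticMap.polar (stdForm m) v w := by
    rw [sub_eq_add_neg, QuadraticMap.map_add (stdForm m), QuadraticMap.map_neg,
      QuadraticMap.polar_neg_right, sub_eq_add_neg]
  exact sub_eq_zero.1 (stdForm_eq_zero (le_antisymm (by linarith) (stdForm_nonneg _)))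

theorem stdForm_polar_smul_sub {v : Fin (m + 1) → ℝ} (hv : stdForm m v = 1)
    (w : Fin (m + 1) → ℝ) :
    stdForm m (QuadraticMap.polar (stdForm m) v w • v - w) = stdForm m w := by
  rw [sub_eq_add_neg, QuadraticMap.map_add (stdForm m), QuadraticMap.map_smul,
    QuadraticMap.map_neg, QuadraticMap.polar_neg_right, QuadraticMap.polar_smul_left, hv,
    smul_eq_mul, smul_eq_mul]
  ring

end StdForm

namespace CliffordSystem

variable {m n : ℕ} (C : CliffordSystem m n)

/-- The quadratic map `x ↦ (⟨P_i x, x⟩)_i`, through which the Cartan–Münzner polynomial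
factors. -/
def quadMap (x : V n) : Fin (m + 1) → ℝ := fun i => inner ℝ (C.P i x) x

theorem gen_single (i : Fin (m + 1)) : C.gen (Pi.single i 1) = C.P i := by
  rw [gen, Fintype.linearCombination_apply_single, one_smul]

theorem two_mul_inner_gen_self (v : Fin (m + 1) → ℝ) (x : V n) :
    2 * inner ℝ (C.gen v x) x = QuadraticMap.polar (stdForm m) v (C.quadMap x) := by
  simp [gen_apply, polar_stdForm, quadMap, LinearMap.sum_apply, sum_inner, inner_smul_left]

theorem inner_gen_quadMap_self (x : V n) :
    inner ℝ (C.gen (C.quadMap x) x) x = stdForm m (C.quadMap x) := by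
  have h := C.two_mul_inner_gen_self (C.quadMap x) x
  rw [QuadraticMap.polar_self, two_smul] at h
  linarith

theorem inner_gen_gen (v : Fin (m + 1) → ℝ) (x y : V n) :
    inner ℝ (C.gen v x) (C.gen v y) = stdForm m v * inner ℝ x y := by
  rw [C.isSymmetric_gen v, C.gen_gen, inner_smul_right]

theorem quadMap_smul (c : ℝ) (x : V n) : C.quadMap (c • x) = c ^ 2 • C.quadMap x := by
  ext i
  simp [quadMap, inner_smul_left, inner_smul_right, pow_two, mul_assoc]

theorem quadMap_add (x y : V n) (i : Fin (m + 1)) :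
    C.quadMap (x + y) i = C.quadMap x i + C.quadMap y i + 2 * inner ℝ (C.P i x) y := by
  have h : inner ℝ (C.P i y) x = inner ℝ (C.P i x) y := by rw [C.symm i y x, real_inner_comm]
  simp only [quadMap, map_add, inner_add_left, inner_add_right, h]
  ring

theorem stdForm_quadMap_le {x : V n} (hx : ‖x‖ = 1) : stdForm m (C.quadMap x) ≤ 1 := by
  have h := real_inner_mul_inner_self_le (C.gen (C.quadMap x) x) x
  rw [inner_gen_quadMap_self, inner_gen_gen, real_inner_self_eq_norm_sq, hx] at h
  nlinarith

theorem cartanMunzner_eq (x : V n) :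
    C.cartanMunzner x = inner ℝ x x ^ 2 - 2 * stdForm m (C.quadMap x) := by
  rw [stdForm_apply]
  rfl

theorem cartanMunzner_of_norm_eq_one {x : V n} (hx : ‖x‖ = 1) :
    C.cartanMunzner x = 1 - 2 * stdForm m (C.quadMap x) := by
  rw [cartanMunzner_eq, real_inner_self_eq_norm_sq, hx, one_pow, one_pow]

theorem cartanMunzner_mem_Icc {x : V n} (hx : ‖x‖ = 1) : C.cartanMunzner x ∈ Set.Icc (-1) 1 := by
  have h := C.stdForm_quadMap_le hx
  have h' := stdForm_nonneg (C.quadMap x)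
  rw [C.cartanMunzner_of_norm_eq_one hx]
  constructor <;> linarith

theorem continuous_cartanMunzner : Continuous C.cartanMunzner := by
  have h (i : Fin (m + 1)) : Continuous (C.P i) := (C.P i).continuous_of_finiteDimensional
  unfold cartanMunzner
  fun_prop

/-! ### Orthogonal transformations that preserve the Cartan–Münzner polynomial -/

theorem image_eq_of_mem_leaves {A : OV n} (h : ∀ x, C.cartanMunzner (A x) = C.cartanMunzner x)
    {L : Set (V n)} (hL : L ∈ C.leaves) : A '' L = L := by
  obtain ⟨-, c, rfl⟩ := hL
  ext x
  constructor
  · rintro ⟨y, ⟨hy, hc⟩, rfl⟩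
    exact ⟨by simpa using hy, (h y).trans hc⟩
  · rintro ⟨hx, hc⟩
    refine ⟨A.symm x, ⟨by simpa using hx, ?_⟩, A.apply_symm_apply x⟩
    rw [← h, A.apply_symm_apply, hc]

theorem mem_aut_of_cartanMunzner {A : OV n}
    (h : ∀ x, C.cartanMunzner (A x) = C.cartanMunzner x) : A ∈ C.aut := by
  have h' (x : V n) : C.cartanMunzner ((A⁻¹ : OV n) x) = C.cartanMunzner x := by
    rw [← h]
    exact congrArg C.cartanMunzner (A.apply_symm_apply x)
  intro L hL
  rw [C.image_eq_of_mem_leaves h hL, C.image_eq_of_mem_leaves h' hL]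
  exact ⟨hL, hL⟩

theorem cartanMunzner_apply_eq_iff {A : OV n} (hA : A ∈ C.aut) {x y : V n} (hx : ‖x‖ = 1)
    (hy : ‖y‖ = 1) :
    C.cartanMunzner (A x) = C.cartanMunzner (A y) ↔ C.cartanMunzner x = C.cartanMunzner y := by
  have key (B : OV n) (hB : ∀ L ∈ C.leaves, B '' L ∈ C.leaves) {x y : V n} (hx : ‖x‖ = 1)
      (hy : ‖y‖ = 1) (h : C.cartanMunzner x = C.cartanMunzner y) :
      C.cartanMunzner (B x) = C.cartanMunzner (B y) := by
    let L : Set (V n) := {z | z ∈ Metric.sphere 0 1 ∧ C.cartanMunzner z = C.cartanMunzner x}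
    have hxL : x ∈ L := ⟨by simpa using hx, rfl⟩
    have hyL : y ∈ L := ⟨by simpa using hy, h.symm⟩
    obtain ⟨-, c, hc⟩ := hB L ⟨⟨x, hxL⟩, _, rfl⟩
    have hBx := hc ▸ Set.mem_image_of_mem B hxL
    have hBy := hc ▸ Set.mem_image_of_mem B hyL
    exact hBx.2.trans hBy.2.symm
  refine ⟨fun h => ?_, key A (fun L hL => (hA L hL).1) hx hy⟩
  have hinv (z : V n) : (A⁻¹ : OV n) (A z) = z := A.symm_apply_apply z
  simpa only [hinv] using key A⁻¹ (fun L hL => (hA L hL).2) ((A.norm_map x).trans hx)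
    ((A.norm_map y).trans hy) h

theorem quadMap_gen (v : Fin (m + 1) → ℝ) (x : V n) :
    C.quadMap (C.gen v x) =
      QuadraticMap.polar (stdForm m) v (C.quadMap x) • v - stdForm m v • C.quadMap x := by
  ext i
  have h := congrArg (fun a => C.rep a x)
    (CliffordAlgebra.ι_mul_ι_mul_ι (Q := stdForm m) v (Pi.single i 1))
  simp only [map_mul, Module.End.mul_apply, rep_ι, gen_single, map_sub, map_smul,
    LinearMap.sub_apply, LinearMap.smul_apply] at h
  have hpolar : QuadraticMap.polar (stdForm m) v (Pi.single i 1) = 2 * v i := by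
    simp [polar_stdForm, Pi.single_apply]
  rw [quadMap, ← C.isSymmetric_gen v, h, hpolar, inner_sub_left, inner_smul_left, inner_smul_left,
    ← C.two_mul_inner_gen_self]
  simp only [conj_trivial, Pi.sub_apply, Pi.smul_apply, smul_eq_mul, quadMap]
  ring

theorem cartanMunzner_gen {v : Fin (m + 1) → ℝ} (hv : stdForm m v = 1) (x : V n) :
    C.cartanMunzner (C.gen v x) = C.cartanMunzner x := by
  rw [cartanMunzner_eq, cartanMunzner_eq, inner_gen_gen,
    quadMap_gen, hv, one_mul, one_smul, stdForm_polar_smul_sub hv]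

theorem cartanMunzner_rep {u : (Cl m)ˣ} (hu : u ∈ Pin m) (x : V n) :
    C.cartanMunzner (C.rep (u : Cl m) x) = C.cartanMunzner x := by
  induction hu using pin_induction with
  | one => simp
  | mul v h u _ ih =>
    rw [Units.val_mul, map_mul, Module.End.mul_apply, val_unitVector, rep_ι, C.cartanMunzner_gen h,
      ih]

theorem image_sup_uPlus_le_aut {L : Subgroup (Cl m)ˣ} (hL : L ≤ Pin m) :
    C.image L ⊔ C.uPlus ≤ C.aut := by
  refine sup_le ?_ fun A hA => C.mem_aut_of_cartanMunzner fun x => ?_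
  · rintro A ⟨u, hu, hA⟩
    exact C.mem_aut_of_cartanMunzner fun x => by rw [hA, C.cartanMunzner_rep (hL hu)]
  · have hP (i : Fin (m + 1)) : C.P i (A x) = A (C.P i x) :=
      hA _ (Submodule.subset_span ⟨i, rfl⟩) x
    simp only [cartanMunzner, hP, A.inner_map_map]

end CliffordSystem

/-! ### Eigenspaces and focal submanifolds -/

theorem exists_norm_eq_one_of_finrank_lt {E : Type*} [NormedAddCommGroup E] [InnerProductSpace ℝ E]
    [FiniteDimensional ℝ E] {U W : Submodule ℝ E} (h : Module.finrank ℝ W < Module.finrank ℝ U) :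
    ∃ z ∈ U, ‖z‖ = 1 ∧ ∀ w ∈ W, inner ℝ w z = 0 := by
  have hne : U ⊓ Wᗮ ≠ ⊥ := by
    intro hbot
    have hsum := Submodule.finrank_sup_add_finrank_inf_eq U Wᗮ
    have hle := (U ⊔ Wᗮ).finrank_le
    have hW := W.finrank_add_finrank_orthogonal
    rw [hbot, finrank_bot] at hsum
    omega
  obtain ⟨z, ⟨hzU, hzW⟩, hz⟩ := Submodule.exists_mem_ne_zero_of_ne_bot hne
  refine ⟨(‖z‖⁻¹ : ℝ) • z, U.smul_mem _ hzU, norm_smul_inv_norm hz, fun w hw => ?_⟩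
  rw [inner_smul_right, hzW w hw, mul_zero]

theorem even_finrank_of_mul_self_eq_neg_one {E : Type*} [AddCommGroup E] [Module ℝ E]
    {J : Module.End ℝ E} (hJ : J * J = -1) : Even (Module.finrank ℝ E) := by
  have hdet := congrArg LinearMap.det hJ
  rw [map_mul, ← neg_one_smul ℝ (1 : Module.End ℝ E), LinearMap.det_smul, map_one, mul_one] at hdet
  by_contra hodd
  rw [(Nat.not_even_iff_odd.1 hodd).neg_one_pow] at hdet
  linarith [mul_self_nonneg (LinearMap.det J)]

theorem norm_cos_smul_add_sin_smul {E : Type*} [NormedAddCommGroup E] [InnerProductSpace ℝ E]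
    {a b : E} (ha : ‖a‖ = 1) (hb : ‖b‖ = 1) (hab : inner ℝ a b = 0) (t : ℝ) :
    ‖Real.cos t • a + Real.sin t • b‖ = 1 := by
  have h : inner ℝ (Real.cos t • a) (Real.sin t • b) = 0 := by
    rw [inner_smul_left, inner_smul_right, hab, mul_zero, mul_zero]
  rw [norm_add_eq_sqrt_iff_real_inner_eq_zero.2 h, norm_smul, norm_smul, ha, hb, mul_one, mul_one,
    Real.norm_eq_abs, Real.norm_eq_abs, abs_mul_abs_self, abs_mul_abs_self, ← pow_two, ← pow_two,
    Real.cos_sq_add_sin_sq, Real.sqrt_one]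

namespace CliffordSystem

variable {m n : ℕ} (C : CliffordSystem m n)

/-- The eigenspace `E_+(P)` of `P = ∑ v_i P_i` for the eigenvalue `1`; that for `-1` is
`C.eigenspace (-v)`. -/
def eigenspace (v : Fin (m + 1) → ℝ) : Submodule ℝ (V n) := Module.End.eigenspace (C.gen v) 1

theorem mem_eigenspace {v : Fin (m + 1) → ℝ} {x : V n} : x ∈ C.eigenspace v ↔ C.gen v x = x := by
  rw [eigenspace, Module.End.mem_eigenspace_iff, one_smul]

theorem mem_eigenspace_neg {v : Fin (m + 1) → ℝ} {x : V n} :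
    x ∈ C.eigenspace (-v) ↔ C.gen v x = -x := by
  rw [mem_eigenspace, map_neg, LinearMap.neg_apply, neg_eq_iff_eq_neg]

theorem add_gen_mem_eigenspace {v : Fin (m + 1) → ℝ} (hv : stdForm m v = 1) (x : V n) :
    x + C.gen v x ∈ C.eigenspace v := by
  rw [mem_eigenspace, map_add, C.gen_gen, hv, one_smul, add_comm]

theorem sub_gen_mem_eigenspace_neg {v : Fin (m + 1) → ℝ} (hv : stdForm m v = 1) (x : V n) :
    x - C.gen v x ∈ C.eigenspace (-v) := by
  rw [mem_eigenspace_neg, map_sub, C.gen_gen, hv, one_smul, neg_sub]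

theorem trace_gen (hm : 1 ≤ m) (v : Fin (m + 1) → ℝ) : LinearMap.trace ℝ _ (C.gen v) = 0 := by
  rw [gen_apply, map_sum]
  refine Finset.sum_eq_zero fun i _ => ?_
  have h := trace_monomial C.rep (I := {i}) (Finset.singleton_ne_empty i) fun ⟨h, _⟩ => by
    have hcard := congrArg Finset.card h
    rw [Finset.card_singleton, Finset.card_univ, Fintype.card_fin] at hcard
    omega
  rw [monomial, Finset.sort_singleton, List.map_singleton, List.prod_singleton, rep_stdGen] at h
  rw [map_smul, h, smul_zero]

theorem isProj_gen {v : Fin (m + 1) → ℝ} (hv : stdForm m v = 1) :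
    LinearMap.IsProj (C.eigenspace v) ((1 / 2 : ℝ) • (1 + C.gen v)) where
  map_mem x := Submodule.smul_mem _ _ (C.add_gen_mem_eigenspace hv x)
  map_id x hx := by
    rw [LinearMap.smul_apply, LinearMap.add_apply, Module.End.one_apply, C.mem_eigenspace.1 hx]
    module

theorem finrank_eigenspace (hm : 1 ≤ m) {v : Fin (m + 1) → ℝ} (hv : stdForm m v = 1) :
    Module.finrank ℝ (C.eigenspace v) = n + 1 := by
  have h := (C.isProj_gen hv).trace
  rw [map_smul, map_add, C.trace_gen hm, LinearMap.trace_one, finrank_euclideanSpace_fin,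
    smul_eq_mul] at h
  push_cast at h
  have hcast : (Module.finrank ℝ (C.eigenspace v) : ℝ) = (n + 1 : ℕ) := by
    push_cast
    linarith
  exact_mod_cast hcast

theorem exists_mem_eigenspace_norm_eq_one (hm : 1 ≤ m) {v : Fin (m + 1) → ℝ}
    (hv : stdForm m v = 1) : ∃ z ∈ C.eigenspace v, ‖z‖ = 1 := by
  obtain ⟨z, hz, hz1, -⟩ := exists_norm_eq_one_of_finrank_lt (U := C.eigenspace v) (W := ⊥)
    (by rw [finrank_bot, C.finrank_eigenspace hm hv]; omega)
  exact ⟨z, hz, hz1⟩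

theorem exists_mem_eigenspace_inner_eq_zero (hm : 1 ≤ m) {v : Fin (m + 1) → ℝ}
    (hv : stdForm m v = 1) {ι : Type*} [Fintype ι] (f : ι → V n) (hι : Fintype.card ι ≤ n) :
    ∃ z ∈ C.eigenspace v, ‖z‖ = 1 ∧ ∀ i, inner ℝ (f i) z = 0 := by
  have hlt : Module.finrank ℝ (Submodule.span ℝ (Set.range f)) <
      Module.finrank ℝ (C.eigenspace v) := by
    rw [C.finrank_eigenspace hm hv]
    exact Nat.lt_succ_of_le ((finrank_range_le_card f).trans hι)
  obtain ⟨z, hz, hz1, h⟩ := exists_norm_eq_one_of_finrank_lt hlt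
  exact ⟨z, hz, hz1, fun i => h _ (Submodule.subset_span ⟨i, rfl⟩)⟩

/-- The focal submanifold `M_-` of the FKM-foliation, on which `F = -1`. -/
def focalMinus : Set (V n) := {x | ‖x‖ = 1 ∧ C.cartanMunzner x = -1}

/-- The focal submanifold `M_+` of the FKM-foliation, on which `F = 1`. -/
def focalPlus : Set (V n) := {x | ‖x‖ = 1 ∧ C.cartanMunzner x = 1}

variable {C}

theorem mem_focalMinus {x : V n} : x ∈ C.focalMinus ↔ ‖x‖ = 1 ∧ stdForm m (C.quadMap x) = 1 := by
  refine and_congr_right fun hx => ?_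
  rw [C.cartanMunzner_of_norm_eq_one hx]
  constructor <;> intro h <;> linarith

theorem mem_focalPlus {x : V n} : x ∈ C.focalPlus ↔ ‖x‖ = 1 ∧ C.quadMap x = 0 := by
  refine and_congr_right fun hx => ?_
  rw [C.cartanMunzner_of_norm_eq_one hx]
  refine ⟨fun h => stdForm_eq_zero (by linarith), fun h => ?_⟩
  rw [h, QuadraticMap.map_zero, mul_zero, sub_zero]

theorem mem_eigenspace_quadMap {x : V n} (hx : x ∈ C.focalMinus) :
    x ∈ C.eigenspace (C.quadMap x) := by
  obtain ⟨hx1, hq⟩ := mem_focalMinus.1 hx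
  rw [mem_eigenspace, ← inner_eq_one_iff_of_norm_eq_one (𝕜 := ℝ)
    ((C.norm_gen hq x).trans hx1) hx1, inner_gen_quadMap_self, hq]

theorem quadMap_of_mem_eigenspace {v : Fin (m + 1) → ℝ} (hv : stdForm m v = 1) {x : V n}
    (hx : x ∈ C.eigenspace v) (hx1 : ‖x‖ = 1) : C.quadMap x = v := by
  refine (eq_of_two_le_polar hv.le (C.stdForm_quadMap_le hx1) ?_).symm
  rw [← two_mul_inner_gen_self, C.mem_eigenspace.1 hx, real_inner_self_eq_norm_sq, hx1]
  norm_num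

theorem mem_focalMinus_of_mem_eigenspace {v : Fin (m + 1) → ℝ} (hv : stdForm m v = 1) {x : V n}
    (hx : x ∈ C.eigenspace v) (hx1 : ‖x‖ = 1) : x ∈ C.focalMinus :=
  mem_focalMinus.2 ⟨hx1, by rw [quadMap_of_mem_eigenspace hv hx hx1, hv]⟩

theorem inv_norm_smul_mem_focalMinus {v : Fin (m + 1) → ℝ} (hv : stdForm m v = 1) {x : V n}
    (hx : x ∈ C.eigenspace v) (h0 : x ≠ 0) : (‖x‖⁻¹ : ℝ) • x ∈ C.focalMinus :=
  mem_focalMinus_of_mem_eigenspace hv (Submodule.smul_mem _ _ hx) (norm_smul_inv_norm h0)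

theorem inner_eq_zero_of_mem_eigenspace_neg {v : Fin (m + 1) → ℝ} {a b : V n}
    (ha : a ∈ C.eigenspace v) (hb : b ∈ C.eigenspace (-v)) : inner ℝ a b = 0 := by
  have h := C.isSymmetric_gen v a b
  rw [C.mem_eigenspace.1 ha, C.mem_eigenspace_neg.1 hb, inner_neg_right] at h
  linarith

theorem quadMap_smul_add_smul {a b : V n} (hab : ∀ i, inner ℝ (C.P i a) b = 0) (s t : ℝ) :
    C.quadMap (s • a + t • b) = s ^ 2 • C.quadMap a + t ^ 2 • C.quadMap b := by
  ext i
  rw [quadMap_add, quadMap_smul, quadMap_smul, map_smul, inner_smul_left, inner_smul_right, hab,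
    mul_zero, mul_zero, mul_zero, add_zero, Pi.add_apply]

theorem quadMap_cos_smul_add_sin_smul {v : Fin (m + 1) → ℝ} (hv : stdForm m v = 1) {a b : V n}
    (ha : a ∈ C.eigenspace v) (ha1 : ‖a‖ = 1) (hb : b ∈ C.eigenspace (-v)) (hb1 : ‖b‖ = 1)
    (hab : ∀ i, inner ℝ (C.P i a) b = 0) (t : ℝ) :
    C.quadMap (Real.cos t • a + Real.sin t • b) = Real.cos (2 * t) • v := by
  rw [quadMap_smul_add_smul hab, quadMap_of_mem_eigenspace hv ha ha1,
    quadMap_of_mem_eigenspace ((QuadraticMap.map_neg _ v).trans hv) hb hb1, Real.cos_two_mul',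
    smul_neg, sub_smul, sub_eq_add_neg]

end CliffordSystem

/-! ### The images of the focal submanifolds -/

theorem endpoints_of_image_Icc_eq {f : ℝ → ℝ} {a b c d : ℝ} (hab : a ≤ b)
    (hf : ContinuousOn f (Set.Icc a b)) (hinj : Set.InjOn f (Set.Icc a b))
    (himage : f '' Set.Icc a b = Set.Icc c d) : f a = c ∧ f b = d ∨ f a = d ∧ f b = c := by
  have ha := Set.left_mem_Icc.2 hab
  have hb := Set.right_mem_Icc.2 hab
  rcases hf.strictMonoOn_of_injOn_Icc' hab hinj with h | h
  · rw [hf.image_Icc_of_monotoneOn hab h.monotoneOn,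
      Set.Icc_eq_Icc_iff (h.monotoneOn ha hb hab)] at himage
    exact Or.inl himage
  · rw [hf.image_Icc_of_antitoneOn hab h.antitoneOn,
      Set.Icc_eq_Icc_iff (h.antitoneOn ha hb hab)] at himage
    exact Or.inr himage.symm

namespace CliffordSystem

variable {m n : ℕ} (C : CliffordSystem m n)

theorem exists_path_cartanMunzner_eq_neg_cos (hm : 1 ≤ m) (hn : m < n) :
    ∃ x : ℝ → V n, Continuous x ∧ (∀ t, ‖x t‖ = 1) ∧ ∀ t, C.cartanMunzner (x t) = -Real.cos t := by
  have hE := stdForm_single (m := m) 0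
  obtain ⟨a, ha, ha1⟩ := C.exists_mem_eigenspace_norm_eq_one hm hE
  obtain ⟨b, hb, hb1, hab⟩ := C.exists_mem_eigenspace_inner_eq_zero hm
    ((QuadraticMap.map_neg _ _).trans hE) (fun i => C.P i a) ((Fintype.card_fin _).trans_le hn)
  have hnorm := norm_cos_smul_add_sin_smul ha1 hb1 (inner_eq_zero_of_mem_eigenspace_neg ha hb)
  refine ⟨fun t => Real.cos (t / 4) • a + Real.sin (t / 4) • b, by fun_prop, fun t => hnorm _,
    fun t => ?_⟩
  rw [C.cartanMunzner_of_norm_eq_one (hnorm _),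
    quadMap_cos_smul_add_sin_smul hE ha ha1 hb hb1 hab, QuadraticMap.map_smul, hE, smul_eq_mul,
    mul_one, ← pow_two, show t = 2 * (2 * (t / 4)) by ring, Real.cos_two_mul (2 * (t / 4))]
  ring_nf

theorem aut_focal (hm : 1 ≤ m) (hn : m < n) {A : OV n} (hA : A ∈ C.aut) :
    Set.MapsTo A C.focalMinus C.focalMinus ∨
      Set.MapsTo A C.focalMinus C.focalPlus ∧ Set.MapsTo A C.focalPlus C.focalMinus := by
  obtain ⟨x, hcont, hx1, hF⟩ := C.exists_path_cartanMunzner_eq_neg_cos hm hn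
  let ψ : ℝ → ℝ := fun t => C.cartanMunzner (A (x t))
  have hAψ {y : V n} {t : ℝ} (hy : ‖y‖ = 1) (h : C.cartanMunzner y = -Real.cos t) :
      C.cartanMunzner (A y) = ψ t :=
    (C.cartanMunzner_apply_eq_iff hA hy (hx1 t)).2 (h.trans (hF t).symm)
  have hinj : Set.InjOn ψ (Set.Icc 0 Real.pi) := fun s hs t ht h =>
    Real.injOn_cos hs ht <| neg_injective <| by
      rw [← hF, ← hF]
      exact (C.cartanMunzner_apply_eq_iff hA (hx1 s) (hx1 t)).1 h
  have hsurj {c : ℝ} (hc : c ∈ Set.Icc (-1 : ℝ) 1) : ∃ t ∈ Set.Icc 0 Real.pi, -Real.cos t = c := by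
    obtain ⟨t, ht, h⟩ := Real.surjOn_cos (show -c ∈ Set.Icc (-1 : ℝ) 1 by
      constructor <;> linarith [hc.1, hc.2])
    exact ⟨t, ht, by rw [h, neg_neg]⟩
  have himage : ψ '' Set.Icc 0 Real.pi = Set.Icc (-1) 1 := by
    refine subset_antisymm ?_ fun c hc => ?_
    · rintro _ ⟨t, -, rfl⟩
      exact C.cartanMunzner_mem_Icc ((A.norm_map _).trans (hx1 t))
    · obtain ⟨s, -, rfl⟩ := hsurj hc
      have hy : ‖A.symm (x s)‖ = 1 := (A.symm.norm_map _).trans (hx1 s)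
      obtain ⟨t, ht, h⟩ := hsurj (C.cartanMunzner_mem_Icc hy)
      exact ⟨t, ht, by rw [← hAψ hy h.symm, A.apply_symm_apply, hF]⟩
  have h0 {y : V n} (hy : y ∈ C.focalMinus) : C.cartanMunzner (A y) = ψ 0 :=
    hAψ hy.1 (by rw [hy.2, Real.cos_zero])
  have hpi {y : V n} (hy : y ∈ C.focalPlus) : C.cartanMunzner (A y) = ψ Real.pi :=
    hAψ hy.1 (by rw [hy.2, Real.cos_pi, neg_neg])
  have hψ : Continuous ψ := C.continuous_cartanMunzner.comp (A.continuous.comp hcont)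
  rcases endpoints_of_image_Icc_eq Real.pi_pos.le hψ.continuousOn hinj himage with h | h
  · exact Or.inl fun y hy => ⟨(A.norm_map y).trans hy.1, (h0 hy).trans h.1⟩
  · exact Or.inr ⟨fun y hy => ⟨(A.norm_map y).trans hy.1, (h0 hy).trans h.1⟩,
      fun y hy => ⟨(A.norm_map y).trans hy.1, (hpi hy).trans h.2⟩⟩

end CliffordSystem

/-! ### Conjugation by an orthogonal transformation -/

namespace CliffordSystem

variable {m n : ℕ} (C : CliffordSystem m n)

/-- The Clifford system `A⁻¹ P_i A`. -/
def conj (A : OV n) : CliffordSystem m n where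
  P i := A.toLinearEquiv.symm.conj (C.P i)
  symm i x y :=
    calc inner ℝ (A.symm (C.P i (A x))) y = inner ℝ (C.P i (A x)) (A y) := by
          rw [A.symm.inner_map_eq_flip, A.symm_symm]
      _ = inner ℝ x (A.symm (C.P i (A y))) := by rw [C.symm, A.inner_map_eq_flip]
  rel i j := by
    ext1 x
    have h := congrArg (fun f : Module.End ℝ (V n) => A.symm (f (A x))) (C.rel i j)
    split_ifs at h ⊢ <;> simpa [two_mul] using h

theorem conj_P (A : OV n) (i : Fin (m + 1)) (x : V n) :
    (C.conj A).P i x = A.symm (C.P i (A x)) := rfl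

theorem conj_gen (A : OV n) (v : Fin (m + 1) → ℝ) (x : V n) :
    (C.conj A).gen v x = A.symm (C.gen v (A x)) := by
  simp [gen_apply, LinearMap.sum_apply, conj_P]

theorem cartanMunzner_conj (A : OV n) (x : V n) :
    (C.conj A).cartanMunzner x = C.cartanMunzner (A x) := by
  have h (i : Fin (m + 1)) : inner ℝ ((C.conj A).P i x) x = inner ℝ (C.P i (A x)) (A x) := by
    rw [conj_P, A.symm.inner_map_eq_flip, A.symm_symm]
  simp only [cartanMunzner, h, A.inner_map_map]

theorem focalMinus_conj (A : OV n) : (C.conj A).focalMinus = A ⁻¹' C.focalMinus := by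
  ext x
  simp only [focalMinus, Set.mem_preimage, Set.mem_ofPred_eq, cartanMunzner_conj, A.norm_map]

theorem focalPlus_conj (A : OV n) : (C.conj A).focalPlus = A ⁻¹' C.focalPlus := by
  ext x
  simp only [focalPlus, Set.mem_preimage, Set.mem_ofPred_eq, cartanMunzner_conj, A.norm_map]

/-! ### The focal submanifolds are not exchanged -/

section Exchange

variable {C} {C' : CliffordSystem m n}

theorem quadMap_add_add_quadMap_sub (x y : V n) :
    C.quadMap (x + y) + C.quadMap (x - y) = 2 • (C.quadMap x + C.quadMap y) := by
  ext i
  rw [sub_eq_add_neg, ← neg_one_smul ℝ y, Pi.add_apply, quadMap_add, quadMap_add, quadMap_smul,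
    inner_smul_right]
  simp only [Pi.smul_apply, Pi.add_apply, smul_eq_mul, nsmul_eq_mul]
  push_cast
  ring

theorem quadMap_eq_zero_of_mem_eigenspace (h : C.focalMinus ⊆ C'.focalPlus)
    {v : Fin (m + 1) → ℝ} (hv : stdForm m v = 1) {x : V n} (hx : x ∈ C.eigenspace v) :
    C'.quadMap x = 0 := by
  rcases eq_or_ne x 0 with rfl | h0
  · simpa using C'.quadMap_smul 0 0
  · have hq := (mem_focalPlus.1 (h (inv_norm_smul_mem_focalMinus hv hx h0))).2
    rw [quadMap_smul] at hq
    exact (smul_eq_zero.1 hq).resolve_left (pow_ne_zero 2 (inv_ne_zero (norm_ne_zero_iff.2 h0)))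

theorem gen_gen_eq_neg_of_focalMinus_subset (h : C.focalMinus ⊆ C'.focalPlus)
    {v : Fin (m + 1) → ℝ} (hv : stdForm m v = 1) (w : Fin (m + 1) → ℝ) (x : V n) :
    C.gen v (C'.gen w x) = -C'.gen w (C.gen v x) := by
  have hquad (x : V n) : C'.quadMap x + C'.quadMap (C.gen v x) = 0 := by
    have hsum := quadMap_add_add_quadMap_sub (C := C') x (C.gen v x)
    rw [quadMap_eq_zero_of_mem_eigenspace h hv (C.add_gen_mem_eigenspace hv x),
      quadMap_eq_zero_of_mem_eigenspace h ((QuadraticMap.map_neg _ v).trans hv)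
        (C.sub_gen_mem_eigenspace_neg hv x), add_zero] at hsum
    exact (smul_eq_zero.1 hsum.symm).resolve_left two_ne_zero
  let T : Module.End ℝ (V n) := C'.gen w + C.gen v * C'.gen w * C.gen v
  have hT : T.IsSymmetric := fun x y => by
    simp only [T, LinearMap.add_apply, Module.End.mul_apply, inner_add_left, inner_add_right,
      C.isSymmetric_gen v _ _, C'.isSymmetric_gen w _ _]
  have hT0 : T = 0 := hT.inner_map_self_eq_zero.1 fun x => by
    have hx := QuadraticMap.polar_add_right (Q := stdForm m) w (C'.quadMap x)
      (C'.quadMap (C.gen v x))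
    rw [hquad, QuadraticMap.polar_zero_right, ← two_mul_inner_gen_self,
      ← two_mul_inner_gen_self] at hx
    rw [LinearMap.add_apply, inner_add_left, Module.End.mul_apply, Module.End.mul_apply,
      C.isSymmetric_gen v]
    linarith
  have hx := congrArg (C.gen v) (LinearMap.congr_fun hT0 x)
  rw [LinearMap.add_apply, map_add, Module.End.mul_apply, Module.End.mul_apply, C.gen_gen, hv,
    one_smul, LinearMap.zero_apply, map_zero] at hx
  exact eq_neg_of_add_eq_zero_left hx

theorem focalMinus_subset_symm (h : C.focalMinus ⊆ C'.focalPlus) :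
    C'.focalMinus ⊆ C.focalPlus := by
  intro z hz
  have hgen := C'.mem_eigenspace.1 (mem_eigenspace_quadMap hz)
  refine mem_focalPlus.2 ⟨hz.1, funext fun i => ?_⟩
  have hi := gen_gen_eq_neg_of_focalMinus_subset h (stdForm_single i) (C'.quadMap z) z
  rw [hgen, gen_single] at hi
  have hneg : inner ℝ (C.P i z) z = -inner ℝ (C.P i z) z :=
    calc inner ℝ (C.P i z) z = inner ℝ (-C'.gen (C'.quadMap z) (C.P i z)) z := by rw [← hi]
      _ = -inner ℝ (C.P i z) z := by rw [inner_neg_left, C'.isSymmetric_gen, hgen]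
  rw [quadMap, Pi.zero_apply]
  linarith

theorem odd_of_focalMinus_subset (hm : 1 ≤ m) (h : C.focalMinus ⊆ C'.focalPlus) : Odd n := by
  have h01 : (0 : Fin (m + 1)) ≠ Fin.last m := fun h => by
    rw [Fin.ext_iff, Fin.val_zero, Fin.val_last] at h
    omega
  let v : Fin (m + 1) → ℝ := Pi.single 0 1
  have hU (x) (hx : x ∈ C'.eigenspace v) : (C.P 0 * C.P (Fin.last m)) x ∈ C'.eigenspace v := by
    have hanti (i : Fin (m + 1)) := gen_gen_eq_neg_of_focalMinus_subset h (stdForm_single i) v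
    simp only [gen_single] at hanti
    rw [C'.mem_eigenspace, Module.End.mul_apply, ← neg_eq_iff_eq_neg.2 (hanti 0 _),
      ← neg_eq_iff_eq_neg.2 (hanti (Fin.last m) x), C'.mem_eigenspace.1 hx, map_neg, neg_neg]
  have hsq (i : Fin (m + 1)) (x : V n) : C.P i (C.P i x) = x := by
    rw [← gen_single, gen_gen, stdForm_single, one_smul]
  have hanti (x : V n) : C.P 0 (C.P (Fin.last m) x) = -C.P (Fin.last m) (C.P 0 x) := by
    have hrel := LinearMap.congr_fun (C.rel 0 (Fin.last m)) x
    rw [if_neg h01] at hrel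
    exact eq_neg_of_add_eq_zero_left hrel
  have hJ : (C.P 0 * C.P (Fin.last m)).restrict hU * (C.P 0 * C.P (Fin.last m)).restrict hU =
      -1 := LinearMap.ext fun x => Subtype.ext <| by
    change C.P 0 (C.P (Fin.last m) (C.P 0 (C.P (Fin.last m) x))) = -(x : V n)
    rw [hanti x, map_neg, map_neg, hsq, hsq]
  have heven := even_finrank_of_mul_self_eq_neg_one hJ
  rw [C'.finrank_eigenspace hm (stdForm_single 0), Nat.even_add_one, Nat.not_even_iff_odd] at heven
  exact heven

theorem exists_mem_focalPlus_inter (hm : 1 ≤ m) (hn : 2 * m < n)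
    (h : C.focalMinus ⊆ C'.focalPlus) : (C.focalPlus ∩ C'.focalPlus).Nonempty := by
  have hE := stdForm_single (m := m) 0
  have hE' := (QuadraticMap.map_neg _ _).trans hE
  obtain ⟨a, ha, ha1⟩ := C'.exists_mem_eigenspace_norm_eq_one hm hE
  obtain ⟨b, hb, hb1, hab⟩ := C'.exists_mem_eigenspace_inner_eq_zero hm hE'
    (Sum.elim (fun i : Fin (m + 1) => C.P i a) fun j : Fin m => C'.P j.succ a)
    (by simp; omega)
  have hinner : inner ℝ a b = 0 := inner_eq_zero_of_mem_eigenspace_neg ha hb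
  have hab' (i : Fin (m + 1)) : inner ℝ (C'.P i a) b = 0 := by
    refine Fin.cases ?_ (fun j => hab (Sum.inr j)) i
    rw [← gen_single, C'.mem_eigenspace.1 ha, hinner]
  have hsymm := focalMinus_subset_symm h
  have hnorm := norm_cos_smul_add_sin_smul ha1 hb1 hinner (Real.pi / 4)
  refine ⟨_, mem_focalPlus.2 ⟨hnorm, ?_⟩, mem_focalPlus.2 ⟨hnorm, ?_⟩⟩
  · rw [quadMap_smul_add_smul fun i => hab (Sum.inl i),
      quadMap_eq_zero_of_mem_eigenspace hsymm hE ha,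
      quadMap_eq_zero_of_mem_eigenspace hsymm hE' hb, smul_zero, smul_zero, add_zero]
  · rw [quadMap_cos_smul_add_sin_smul hE ha ha1 hb hb1 hab', show 2 * (Real.pi / 4) = Real.pi / 2 by
      ring, Real.cos_pi_div_two, zero_smul]

theorem not_focalPlus_subset (hm : 1 ≤ m) (hn : 2 * m ≤ n) (h : C.focalMinus ⊆ C'.focalPlus) :
    ¬C.focalPlus ⊆ C'.focalMinus := by
  intro h'
  rcases hn.eq_or_lt with rfl | hn
  · exact Nat.not_odd_iff_even.2 (even_two_mul m) (odd_of_focalMinus_subset hm h)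
  · obtain ⟨x, hx, hx'⟩ := exists_mem_focalPlus_inter hm hn h
    have hF := (h' hx).2
    rw [hx'.2] at hF
    norm_num at hF

end Exchange

end CliffordSystem

/-! ### Clifford systems with the same focal submanifold -/

namespace CliffordSystem

variable {m n : ℕ} (C : CliffordSystem m n)

/-- The vectors `P x`, `P ∈ 𝒫`, orthogonal to `x`; at a point of `M_-` they are the horizontal
directions of the sphere bundle `M_- → S(𝒫)`. -/
def horizontalSpace (x : V n) : Submodule ℝ (V n) := LinearMap.range (C.gen.flip x) ⊓ (ℝ ∙ x)ᗮ

variable {C} {C' : CliffordSystem m n}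

theorem finrank_horizontalSpace_le {x : V n} (hx : x ∈ C.focalMinus) :
    Module.finrank ℝ (C.horizontalSpace x) ≤ m := by
  have hlt : C.horizontalSpace x < LinearMap.range (C.gen.flip x) := by
    refine lt_of_le_of_ne inf_le_left fun h => ?_
    have hmem : x ∈ C.horizontalSpace x :=
      h ▸ ⟨C.quadMap x, C.mem_eigenspace.1 (mem_eigenspace_quadMap hx)⟩
    have h0 := Submodule.mem_orthogonal_singleton_iff_inner_right.1 hmem.2
    rw [real_inner_self_eq_norm_sq, hx.1] at h0
    norm_num at h0
  have hrange := (C.gen.flip x).finrank_range_le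
  rw [Module.finrank_fin_fun] at hrange
  exact Nat.le_of_lt_succ ((Submodule.finrank_lt_finrank_of_lt hlt).trans_le hrange)

theorem inner_P_of_forall_horizontalSpace {x z : V n} (hx : x ∈ C.focalMinus)
    (hz : ∀ y ∈ C.horizontalSpace x, inner ℝ y z = 0) (i : Fin (m + 1)) :
    inner ℝ (C.P i x) z = inner ℝ x z * C.quadMap x i := by
  have hmem : C.P i x - C.quadMap x i • x ∈ C.horizontalSpace x := by
    refine Submodule.mem_inf.2 ⟨?_, ?_⟩
    · refine sub_mem ⟨Pi.single i 1, ?_⟩ (Submodule.smul_mem _ _ ⟨C.quadMap x, ?_⟩)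
      · rw [LinearMap.flip_apply, gen_single]
      · exact C.mem_eigenspace.1 (mem_eigenspace_quadMap hx)
    · rw [Submodule.mem_orthogonal_singleton_iff_inner_left, inner_sub_left, inner_smul_left,
        real_inner_self_eq_norm_sq, hx.1, one_pow, mul_one]
      exact sub_self _
  have h := hz _ hmem
  rw [inner_sub_left, inner_smul_left, conj_trivial, sub_eq_zero] at h
  rw [h, mul_comm]

theorem stdForm_quadMap_of_focalMinus_subset (h : C.focalMinus ⊆ C'.focalMinus)
    {v : Fin (m + 1) → ℝ} (hv : stdForm m v = 1) {x : V n} (hx : x ∈ C.eigenspace v) :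
    stdForm m (C'.quadMap x) = (‖x‖ ^ 2) ^ 2 := by
  rcases eq_or_ne x 0 with rfl | h0
  · rw [← zero_smul ℝ (0 : V n), quadMap_smul, zero_pow two_ne_zero, zero_smul,
      QuadraticMap.map_zero, zero_smul, norm_zero, zero_pow two_ne_zero, zero_pow two_ne_zero]
  · have hq := (mem_focalMinus.1 (h (inv_norm_smul_mem_focalMinus hv hx h0))).2
    rw [quadMap_smul, QuadraticMap.map_smul, smul_eq_mul] at hq
    have hnorm := norm_ne_zero_iff.2 h0
    field_simp at hq
    rw [hq]
    ring

theorem quadMap_eq_of_inner_eq (h : C.focalMinus ⊆ C'.focalMinus) {v : Fin (m + 1) → ℝ}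
    (hv : stdForm m v = 1) {x z : V n} (hx : x ∈ C.eigenspace v) (hz : z ∈ C.eigenspace v)
    (hx1 : ‖x‖ = 1) (hz1 : ‖z‖ = 1)
    (hxz : ∀ i, inner ℝ (C'.P i x) z = inner ℝ x z * C'.quadMap x i) :
    C'.quadMap x = C'.quadMap z := by
  have hqx := (mem_focalMinus.1 (h (mem_focalMinus_of_mem_eigenspace hv hx hx1))).2
  have hqz := (mem_focalMinus.1 (h (mem_focalMinus_of_mem_eigenspace hv hz hz1))).2
  have hpolar {c : ℝ} (hc : c ^ 2 = 1) :
      (1 + 2 * (c * inner ℝ x z)) * QuadraticMap.polar (stdForm m) (C'.quadMap x) (C'.quadMap z) =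
        2 * (1 + 2 * (c * inner ℝ x z)) := by
    have hquad : C'.quadMap (x + c • z) =
        (1 + 2 * (c * inner ℝ x z)) • C'.quadMap x + C'.quadMap z := by
      ext i
      rw [quadMap_add, quadMap_smul, hc, one_smul, inner_smul_right, hxz, Pi.add_apply,
        Pi.smul_apply, smul_eq_mul]
      ring
    have hnorm : ‖x + c • z‖ ^ 2 = 2 + 2 * (c * inner ℝ x z) := by
      rw [norm_add_sq_real, hx1, inner_smul_right, norm_smul, hz1, mul_one, Real.norm_eq_abs,
        sq_abs, hc]
      ring
    have hform := stdForm_quadMap_of_focalMinus_subset h hv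
      (add_mem hx (Submodule.smul_mem _ c hz))
    rw [hquad, hnorm, QuadraticMap.map_add (stdForm m), QuadraticMap.map_smul, hqx, hqz,
      QuadraticMap.polar_smul_left, smul_eq_mul, smul_eq_mul] at hform
    linarith
  refine eq_of_two_le_polar hqx.le hqz.le ?_
  linarith [hpolar (one_pow 2), hpolar neg_one_sq]

theorem quadMap_eq_of_mem_eigenspace (hm : 1 ≤ m) (hn : 2 * m ≤ n)
    (h : C.focalMinus ⊆ C'.focalMinus) {v : Fin (m + 1) → ℝ} (hv : stdForm m v = 1) {x y : V n}
    (hx : x ∈ C.eigenspace v) (hy : y ∈ C.eigenspace v) (hx1 : ‖x‖ = 1) (hy1 : ‖y‖ = 1) :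
    C'.quadMap x = C'.quadMap y := by
  have hfx := h (mem_focalMinus_of_mem_eigenspace hv hx hx1)
  have hfy := h (mem_focalMinus_of_mem_eigenspace hv hy hy1)
  have hlt : Module.finrank ℝ ↥(C'.horizontalSpace x ⊔ C'.horizontalSpace y) <
      Module.finrank ℝ (C.eigenspace v) := by
    rw [C.finrank_eigenspace hm hv]
    have hle := Submodule.finrank_add_le_finrank_add_finrank (C'.horizontalSpace x)
      (C'.horizontalSpace y)
    have hlex := finrank_horizontalSpace_le hfx
    have hley := finrank_horizontalSpace_le hfy
    omega
  obtain ⟨z, hz, hz1, horth⟩ := exists_norm_eq_one_of_finrank_lt hlt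
  rw [quadMap_eq_of_inner_eq h hv hx hz hx1 hz1 <| inner_P_of_forall_horizontalSpace hfx
      fun w hw => horth w (Submodule.mem_sup_left hw),
    quadMap_eq_of_inner_eq h hv hy hz hy1 hz1 <| inner_P_of_forall_horizontalSpace hfy
      fun w hw => horth w (Submodule.mem_sup_right hw)]

theorem gen_eq_gen_of_eigenspace_eq {v w : Fin (m + 1) → ℝ} (hv : stdForm m v = 1)
    (hw : stdForm m w = 1) (h : C.eigenspace v = C'.eigenspace w) : C.gen v = C'.gen w := by
  have hproj (D : CliffordSystem m n) {u : Fin (m + 1) → ℝ} (hu : stdForm m u = 1) :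
      ((1 / 2 : ℝ) • (1 + D.gen u)).IsSymmetricProjection :=
    ⟨(D.isProj_gen hu).isIdempotentElem,
      (LinearMap.IsSymmetric.one.add (D.isSymmetric_gen u)).smul (conj_trivial _)⟩
  have heq := (hproj C hv).ext (hproj C' hw)
    ((C.isProj_gen hv).range.trans (h.trans (C'.isProj_gen hw).range.symm))
  exact add_left_cancel (smul_right_injective _ (by norm_num : (1 / 2 : ℝ) ≠ 0) heq)

theorem exists_gen_eq (hm : 1 ≤ m) (hn : 2 * m ≤ n) (h : C.focalMinus ⊆ C'.focalMinus)
    {v : Fin (m + 1) → ℝ} (hv : stdForm m v = 1) : ∃ w, C.gen v = C'.gen w := by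
  obtain ⟨a, ha, ha1⟩ := C.exists_mem_eigenspace_norm_eq_one hm hv
  have hw := (mem_focalMinus.1 (h (mem_focalMinus_of_mem_eigenspace hv ha ha1))).2
  have hle : C.eigenspace v ≤ C'.eigenspace (C'.quadMap a) := by
    intro x hx
    rcases eq_or_ne x 0 with rfl | h0
    · exact Submodule.zero_mem _
    · rw [← Submodule.smul_mem_iff _ (inv_ne_zero (norm_ne_zero_iff.2 h0)),
        quadMap_eq_of_mem_eigenspace hm hn h hv ha (Submodule.smul_mem _ _ hx) ha1
          (norm_smul_inv_norm h0)]
      exact mem_eigenspace_quadMap (h (inv_norm_smul_mem_focalMinus hv hx h0))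
  exact ⟨C'.quadMap a, gen_eq_gen_of_eigenspace_eq hv hw <| Submodule.eq_of_le_of_finrank_eq hle
    (by rw [C.finrank_eigenspace hm hv, C'.finrank_eigenspace hm hw])⟩

theorem range_gen_le_of_focalMinus_subset (hm : 1 ≤ m) (hn : 2 * m ≤ n)
    (h : C.focalMinus ⊆ C'.focalMinus) : LinearMap.range C.gen ≤ LinearMap.range C'.gen := by
  rintro _ ⟨v, rfl⟩
  rw [gen_apply]
  refine sum_mem fun i _ => Submodule.smul_mem _ _ ?_
  obtain ⟨w, hw⟩ := exists_gen_eq hm hn h (stdForm_single i)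
  exact ⟨w, by rw [← hw, gen_single]⟩

end CliffordSystem

/-! ### The pin group covers the orthogonal group -/

section Covering

variable {m : ℕ}

theorem exists_pin_eq_volumeElement : ∃ u ∈ Pin m, (u : Cl m) = volumeElement m := by
  refine ⟨((Finset.univ.sort (· ≤ ·)).map fun i => unitVector _ (stdForm_single i)).prod,
    list_prod_mem ?_, ?_⟩
  · simp only [List.forall_mem_map]
    exact fun i _ => unitVector_mem_pin _ _
  · rw [← Units.coeHom_apply, map_list_prod, List.map_map]
    rfl

theorem semiconjBy_volumeElement (hm : Odd m) (w : Fin (m + 1) → ℝ) :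
    SemiconjBy (volumeElement m) (CliffordAlgebra.ι (stdForm m) w)
      (-CliffordAlgebra.ι (stdForm m) w) := by
  have hgen (i : Fin (m + 1)) : volumeElement m * stdGen i = -(stdGen i * volumeElement m) := by
    rw [stdGen_mul_volumeElement, hm.neg_one_pow, neg_one_smul, neg_neg]
  rw [SemiconjBy, ι_eq_sum, neg_mul, Finset.mul_sum, Finset.sum_mul, ← Finset.sum_neg_distrib]
  exact Finset.sum_congr rfl fun i _ => by rw [mul_smul_comm, smul_mul_assoc, hgen, smul_neg]

theorem stdForm_ofLp (v : EuclideanSpace ℝ (Fin (m + 1))) : stdForm m v.ofLp = ‖v‖ ^ 2 := by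
  rw [stdForm_apply, EuclideanSpace.real_norm_sq_eq]

theorem polar_stdForm_ofLp (v w : EuclideanSpace ℝ (Fin (m + 1))) :
    QuadraticMap.polar (stdForm m) v.ofLp w.ofLp = 2 * inner ℝ v w := by
  rw [polar_stdForm, PiLp.inner_apply]
  exact congrArg (2 * ·) (Finset.sum_congr rfl fun i _ => mul_comm _ _)

theorem semiconjBy_ι_reflection {v : EuclideanSpace ℝ (Fin (m + 1))} (hv : ‖v‖ = 1)
    (w : EuclideanSpace ℝ (Fin (m + 1))) :
    SemiconjBy (CliffordAlgebra.ι (stdForm m) v.ofLp) (CliffordAlgebra.ι (stdForm m) w.ofLp)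
      (-CliffordAlgebra.ι (stdForm m) (Submodule.reflection (ℝ ∙ v)ᗮ w).ofLp) := by
  have hs : stdForm m v.ofLp = 1 := by rw [stdForm_ofLp, hv, one_pow]
  have hreflection : -(Submodule.reflection (ℝ ∙ v)ᗮ w).ofLp =
      QuadraticMap.polar (stdForm m) v.ofLp w.ofLp • v.ofLp - stdForm m v.ofLp • w.ofLp := by
    rw [Submodule.reflection_orthogonal_apply, Submodule.reflection_singleton_apply,
      polar_stdForm_ofLp, hs, hv]
    ext i
    simp [mul_assoc, mul_left_comm]
  rw [SemiconjBy, ← map_neg, hreflection, ← CliffordAlgebra.ι_mul_ι_mul_ι, mul_assoc _ _ (_ : Cl m),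
    ι_mul_ι_self hs, mul_one]

/-- Conjugation by a unit vector is the negative of a reflection; for odd `m` the volume element
corrects the sign. -/
theorem exists_pin_semiconjBy_reflection (hm : Odd m) (v : EuclideanSpace ℝ (Fin (m + 1))) :
    ∃ u ∈ Pin m, ∀ w : EuclideanSpace ℝ (Fin (m + 1)),
      SemiconjBy (u : Cl m) (CliffordAlgebra.ι (stdForm m) w.ofLp)
        (CliffordAlgebra.ι (stdForm m) (Submodule.reflection (ℝ ∙ v)ᗮ w).ofLp) := by
  rcases eq_or_ne v 0 with rfl | hv
  · refine ⟨1, (Pin m).one_mem, fun w => ?_⟩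
    rw [Submodule.reflection_orthogonal_apply, Submodule.reflection_singleton_apply]
    simp
  · have hnorm : ‖(‖v‖⁻¹ : ℝ) • v‖ = 1 := norm_smul_inv_norm hv
    have hspan := Submodule.span_singleton_smul_eq
      (IsUnit.mk0 _ (inv_ne_zero (norm_ne_zero_iff.2 hv))) v
    simp only [← hspan]
    obtain ⟨u, hu, hvol⟩ := exists_pin_eq_volumeElement (m := m)
    refine ⟨u * unitVector _ ((stdForm_ofLp _).trans (by rw [hnorm, one_pow])),
      (Pin m).mul_mem hu (unitVector_mem_pin _ _), fun w => ?_⟩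
    rw [Units.val_mul, hvol, ← neg_neg (CliffordAlgebra.ι _ (Submodule.reflection _ w).ofLp)]
    exact (semiconjBy_volumeElement hm _).neg_right.mul_left (semiconjBy_ι_reflection hnorm w)

theorem exists_pin_semiconjBy (hm : Odd m)
    (R : EuclideanSpace ℝ (Fin (m + 1)) ≃ₗᵢ[ℝ] EuclideanSpace ℝ (Fin (m + 1))) :
    ∃ u ∈ Pin m, ∀ w : EuclideanSpace ℝ (Fin (m + 1)),
      SemiconjBy (u : Cl m) (CliffordAlgebra.ι (stdForm m) w.ofLp)
        (CliffordAlgebra.ι (stdForm m) (R w).ofLp) := by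
  have hR := LinearIsometryEquiv.reflections_generate
    (F := EuclideanSpace ℝ (Fin (m + 1))).ge (Subgroup.mem_top R)
  induction hR using Subgroup.closure_induction with
  | mem R hR =>
    obtain ⟨v, rfl⟩ := hR
    exact exists_pin_semiconjBy_reflection hm v
  | one => exact ⟨1, (Pin m).one_mem, fun w => SemiconjBy.one_left _⟩
  | mul R R' _ _ h h' =>
    obtain ⟨u, hu, h⟩ := h
    obtain ⟨u', hu', h'⟩ := h'
    exact ⟨u * u', (Pin m).mul_mem hu hu', fun w => (h (R' w)).mul_left (h' w)⟩
  | inv R _ h =>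
    obtain ⟨u, hu, h⟩ := h
    refine ⟨u⁻¹, (Pin m).inv_mem hu, fun w => ?_⟩
    have hw := (h (R⁻¹ w)).units_inv_symm_left
    rwa [show R (R⁻¹ w) = w from R.apply_symm_apply w] at hw

end Covering

/-! ### The automorphism group -/

namespace CliffordSystem

variable {m n : ℕ} (C : CliffordSystem m n)

theorem exists_isometry_gen_eq {C C' : CliffordSystem m n}
    (h : LinearMap.range C'.gen ≤ LinearMap.range C.gen) :
    ∃ R : EuclideanSpace ℝ (Fin (m + 1)) ≃ₗᵢ[ℝ] EuclideanSpace ℝ (Fin (m + 1)),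
      ∀ w, C'.gen w.ofLp = C.gen (R w).ofLp := by
  let r : (Fin (m + 1) → ℝ) →ₗ[ℝ] Fin (m + 1) → ℝ :=
    (LinearEquiv.ofInjective C.gen C.gen_injective).symm ∘ₗ
      C'.gen.codRestrict (LinearMap.range C.gen) fun v => h ⟨v, rfl⟩
  have hr (v : Fin (m + 1) → ℝ) : C'.gen v = C.gen (r v) :=
    (congrArg Subtype.val ((LinearEquiv.ofInjective C.gen C.gen_injective).apply_symm_apply
      ⟨C'.gen v, h ⟨v, rfl⟩⟩)).symm
  have hform (v : Fin (m + 1) → ℝ) : stdForm m (r v) = stdForm m v := by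
    obtain ⟨x, hx⟩ := exists_ne (0 : V n)
    refine smul_left_injective ℝ hx ?_
    change stdForm m (r v) • x = stdForm m v • x
    rw [← C.gen_gen, ← C'.gen_gen, hr]
  let e := WithLp.linearEquiv 2 ℝ (Fin (m + 1) → ℝ)
  let R : EuclideanSpace ℝ (Fin (m + 1)) →ₗᵢ[ℝ] EuclideanSpace ℝ (Fin (m + 1)) :=
    ⟨e.symm ∘ₗ r ∘ₗ e, fun v => (sq_eq_sq₀ (norm_nonneg _) (norm_nonneg _)).1 <| by
      rw [← stdForm_ofLp, ← stdForm_ofLp]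
      exact hform _⟩
  exact ⟨R.toLinearIsometryEquiv rfl, fun w => hr _⟩

theorem mem_image_sup_uPlus (hm : Odd m) {A : OV n}
    (hA : LinearMap.range (C.conj A).gen ≤ LinearMap.range C.gen) :
    A ∈ C.image (Pin m) ⊔ C.uPlus := by
  obtain ⟨R, hR⟩ := exists_isometry_gen_eq hA
  obtain ⟨u, hu, h⟩ := exists_pin_semiconjBy hm R
  have hU : A * C.pinHom ⟨u, hu⟩ ∈ C.uPlus := by
    refine C.mem_uPlus_iff.2 (intertwines_of_adjoin_eq_top adjoin_range_stdGen ?_)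
    rintro _ ⟨i, rfl⟩ x
    have hrep := congrArg (fun a => C.rep a x) (h (WithLp.toLp 2 (Pi.single i 1))).eq
    have hgen := congrArg A (C.conj_gen A (Pi.single i 1) (C.rep u x))
    simp only [map_mul, Module.End.mul_apply, rep_ι, ← hR] at hrep
    rw [A.apply_symm_apply, ← hrep, gen_single] at hgen
    rw [rep_stdGen]
    exact hgen
  rw [← mul_inv_cancel_right A (C.pinHom ⟨u, hu⟩)]
  exact mul_mem (Subgroup.mem_sup_right hU)
    (Subgroup.mem_sup_left (inv_mem ⟨u, hu, fun x => rfl⟩))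

theorem aut_eq (hm : Odd m) (hn : 2 * m ≤ n) : C.aut = C.image (Pin m) ⊔ C.uPlus := by
  refine le_antisymm (fun A hA => ?_) (C.image_sup_uPlus_le_aut le_rfl)
  have hpre {S T : Set (V n)} (h : Set.MapsTo (A⁻¹ : OV n) S T) : A ⁻¹' S ⊆ T := fun x hx => by
    rw [← A.symm_apply_apply x]
    exact h hx
  refine C.mem_image_sup_uPlus hm (range_gen_le_of_focalMinus_subset hm.pos hn ?_)
  rcases C.aut_focal hm.pos (by have := hm.pos; omega) (inv_mem hA) with h | ⟨h, h'⟩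
  · exact (C.focalMinus_conj A).trans_subset (hpre h)
  · exact absurd ((C.focalPlus_conj A).trans_subset (hpre h'))
      (not_focalPlus_subset hm.pos hn ((C.focalMinus_conj A).trans_subset (hpre h)))

end CliffordSystem

theorem spin_le_pin (m : ℕ) : Spin m ≤ Pin m := inf_le_left

instance : StarModule ℝ ℍ[ℝ] := ⟨fun c q => by rw [Quaternion.star_smul, star_trivial c]⟩

end FKM

end

theorem mainTheorem8_general (m n : ℕ) (C : CliffordSystem m n) (hle : Odd m → 2 * m ≤ n) :
    (m % 8 = 1 ∨ m % 8 = 7 →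
      (∃ (r : ℕ) (χ : Cl m →ₐ[ℝ] Matrix (Fin r) (Fin r) ℝ), IsIrreducibleRep χ) ∧
      ∀ (r : ℕ) (χ : Cl m →ₐ[ℝ] Matrix (Fin r) (Fin r) ℝ), IsIrreducibleRep χ →
        ∃ k : ℕ, IsSumOf C χ k ∧
          IsEquivalentToAction C C.aut (Pin m) (Matrix.orthogonalGroup (Fin k) ℝ)
            ((Fin r → ℝ) ⊗[ℝ] (Fin k → ℝ)) (fun f U => tensorAct (χ f) U.1)) ∧
    (m % 8 = 3 ∨ m % 8 = 5 →
      (∃ (r : ℕ) (χ : Cl m →ₐ[ℝ] Matrix (Fin r) (Fin r) ℍ[ℝ]), IsIrreducibleRep χ) ∧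
      ∀ (r : ℕ) (χ : Cl m →ₐ[ℝ] Matrix (Fin r) (Fin r) ℍ[ℝ]), IsIrreducibleRep χ →
        ∃ k : ℕ, IsSumOf C χ k ∧
          IsEquivalentToAction C C.aut (Pin m) (Sp k)
            (QuatTensor r k) (fun f U => quatTensorAct (χ f) U.1)) ∧
    (m % 4 = 2 →
      C.spinUPlus ≤ C.aut ∧
      (∃ (r : ℕ) (χ : Cl m →ₐ[ℝ] Matrix (Fin r) (Fin r) ℂ), IsIrreducibleRep χ) ∧
      ∀ (r : ℕ) (χ : Cl m →ₐ[ℝ] Matrix (Fin r) (Fin r) ℂ), IsIrreducibleRep χ →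
        ∃ k : ℕ, IsSumOf C χ k ∧
          IsEquivalentToAction C C.spinUPlus (Spin m) (Matrix.unitaryGroup (Fin k) ℂ)
            ((Fin r → ℂ) ⊗[ℂ] (Fin k → ℂ)) (fun f U => tensorAct (χ f) U.1)) ∧
    (m % 8 = 0 →
      C.spinUPlus ≤ C.aut ∧
      (∃ (r : ℕ) (χ : Cl m →ₐ[ℝ] Matrix (Fin r) (Fin r) ℝ), IsIrreducibleRep χ) ∧
      ∀ (r : ℕ) (χ : Cl m →ₐ[ℝ] Matrix (Fin r) (Fin r) ℝ), IsIrreducibleRep χ →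
        ∃ kp kn : ℕ, IsSumOf₂ C χ (twist χ) kp kn ∧
          IsEquivalentToAction C C.spinUPlus (Spin m)
            (Matrix.orthogonalGroup (Fin kp) ℝ × Matrix.orthogonalGroup (Fin kn) ℝ)
            (((Fin r → ℝ) ⊗[ℝ] (Fin kp → ℝ)) × ((Fin r → ℝ) ⊗[ℝ] (Fin kn → ℝ)))
            (fun f U => (tensorAct (χ f) U.1.1).prodMap (tensorAct (twist χ f) U.2.1))) ∧
    (m % 8 = 4 →
      C.spinUPlus ≤ C.aut ∧
      (∃ (r : ℕ) (χ : Cl m →ₐ[ℝ] Matrix (Fin r) (Fin r) ℍ[ℝ]), IsIrreducibleRep χ) ∧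
      ∀ (r : ℕ) (χ : Cl m →ₐ[ℝ] Matrix (Fin r) (Fin r) ℍ[ℝ]), IsIrreducibleRep χ →
        ∃ kp kn : ℕ, IsSumOf₂ C χ (twist χ) kp kn ∧
          IsEquivalentToAction C C.spinUPlus (Spin m) (Sp kp × Sp kn)
            (QuatTensor r kp × QuatTensor r kn)
            (fun f U =>
              (quatTensorAct (χ f) U.1.1).prodMap (quatTensorAct (twist χ f) U.2.1))) := by
  have haut (hm : Odd m) : C.aut = C.image (Pin m) ⊔ C.uPlus := C.aut_eq hm (hle hm)
  have hsub : C.spinUPlus ≤ C.aut := C.image_sup_uPlus_le_aut (spin_le_pin m)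
  refine ⟨fun hm => ?_, fun hm => ?_, fun hm => ?_, fun hm => ?_, fun hm => ?_⟩
  · have hK := isCommutantField_real (m := m) (by omega)
    have hodd : Odd m := Nat.odd_iff.2 (by omega)
    refine ⟨hK.exists_isIrreducibleRep C.isSymmRep, fun r χ hχ => ?_⟩
    rw [haut hodd]
    exact exists_isotypic_equivalence C (Or.inl hodd) .real hK hχ le_rfl
      (isColumnModel_unitaryGroup r)
  · have hK := isCommutantField_quaternion (m := m) (by omega)
    have hodd : Odd m := Nat.odd_iff.2 (by omega)
    refine ⟨hK.exists_isIrreducibleRep C.isSymmRep, fun r χ hχ => ?_⟩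
    rw [haut hodd]
    exact exists_isotypic_equivalence C (Or.inl hodd) .quaternion hK hχ le_rfl (isColumnModel_sp r)
  · have hK := isCommutantField_complex (m := m) hm
    exact ⟨hsub, hK.exists_isIrreducibleRep C.isSymmRep, fun r χ hχ => exists_isotypic_equivalence C
      (Or.inr hm) .complex hK hχ (spin_le_pin m) (isColumnModel_unitaryGroup r)⟩
  · have hK := isCommutantField_real (m := m) (by omega)
    exact ⟨hsub, hK.exists_isIrreducibleRep C.isSymmRep, fun r χ hχ => exists_two_type_equivalence C
      (by omega) .real hK hχ (spin_le_pin m) (isColumnModel_unitaryGroup r)⟩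
  · have hK := isCommutantField_quaternion (m := m) (by omega)
    exact ⟨hsub, hK.exists_isIrreducibleRep C.isSymmRep, fun r χ hχ => exists_two_type_equivalence C
      (by omega) .quaternion hK hχ (spin_le_pin m) (isColumnModel_sp r)⟩

theorem mainTheorem8 (m n : ℕ) (C : CliffordSystem m n) (hpos : 0 < (n : ℤ) - m)
    (hle : (m : ℤ) ≤ (n : ℤ) - m) :
    (m % 8 = 1 ∨ m % 8 = 7 →
      (∃ (r : ℕ) (χ : Cl m →ₐ[ℝ] Matrix (Fin r) (Fin r) ℝ), IsIrreducibleRep χ) ∧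
      ∀ (r : ℕ) (χ : Cl m →ₐ[ℝ] Matrix (Fin r) (Fin r) ℝ), IsIrreducibleRep χ →
        ∃ k : ℕ, IsSumOf C χ k ∧
          IsEquivalentToAction C C.aut (Pin m) (Matrix.orthogonalGroup (Fin k) ℝ)
            ((Fin r → ℝ) ⊗[ℝ] (Fin k → ℝ)) (fun f U => tensorAct (χ f) U.1)) ∧
    (m % 8 = 3 ∨ m % 8 = 5 →
      (∃ (r : ℕ) (χ : Cl m →ₐ[ℝ] Matrix (Fin r) (Fin r) ℍ[ℝ]), IsIrreducibleRep χ) ∧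
      ∀ (r : ℕ) (χ : Cl m →ₐ[ℝ] Matrix (Fin r) (Fin r) ℍ[ℝ]), IsIrreducibleRep χ →
        ∃ k : ℕ, IsSumOf C χ k ∧
          IsEquivalentToAction C C.aut (Pin m) (Sp k)
            (QuatTensor r k) (fun f U => quatTensorAct (χ f) U.1)) ∧
    (m % 4 = 2 →
      C.spinUPlus ≤ C.aut ∧
      (∃ (r : ℕ) (χ : Cl m →ₐ[ℝ] Matrix (Fin r) (Fin r) ℂ), IsIrreducibleRep χ) ∧
      ∀ (r : ℕ) (χ : Cl m →ₐ[ℝ] Matrix (Fin r) (Fin r) ℂ), IsIrreducibleRep χ →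
        ∃ k : ℕ, IsSumOf C χ k ∧
          IsEquivalentToAction C C.spinUPlus (Spin m) (Matrix.unitaryGroup (Fin k) ℂ)
            ((Fin r → ℂ) ⊗[ℂ] (Fin k → ℂ)) (fun f U => tensorAct (χ f) U.1)) ∧
    (m % 8 = 0 →
      C.spinUPlus ≤ C.aut ∧
      (∃ (r : ℕ) (χ : Cl m →ₐ[ℝ] Matrix (Fin r) (Fin r) ℝ), IsIrreducibleRep χ) ∧
      ∀ (r : ℕ) (χ : Cl m →ₐ[ℝ] Matrix (Fin r) (Fin r) ℝ), IsIrreducibleRep χ →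
        ∃ kp kn : ℕ, IsSumOf₂ C χ (twist χ) kp kn ∧
          IsEquivalentToAction C C.spinUPlus (Spin m)
            (Matrix.orthogonalGroup (Fin kp) ℝ × Matrix.orthogonalGroup (Fin kn) ℝ)
            (((Fin r → ℝ) ⊗[ℝ] (Fin kp → ℝ)) × ((Fin r → ℝ) ⊗[ℝ] (Fin kn → ℝ)))
            (fun f U => (tensorAct (χ f) U.1.1).prodMap (tensorAct (twist χ f) U.2.1))) ∧
    (m % 8 = 4 →
      C.spinUPlus ≤ C.aut ∧
      (∃ (r : ℕ) (χ : Cl m →ₐ[ℝ] Matrix (Fin r) (Fin r) ℍ[ℝ]), IsIrreducibleRep χ) ∧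
      ∀ (r : ℕ) (χ : Cl m →ₐ[ℝ] Matrix (Fin r) (Fin r) ℍ[ℝ]), IsIrreducibleRep χ →
        ∃ kp kn : ℕ, IsSumOf₂ C χ (twist χ) kp kn ∧
          IsEquivalentToAction C C.spinUPlus (Spin m) (Sp kp × Sp kn)
            (QuatTensor r kp × QuatTensor r kn)
            (fun f U =>
              (quatTensorAct (χ f) U.1.1).prodMap (quatTensorAct (twist χ f) U.2.1))) :=
  mainTheorem8_general m n C fun _ => by omega
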